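/- Conventions. Let $n\ge 2$ and $\ell\ge 1$. Every $k\in\mathbb Z$ is written uniquely as $k=c+n(d-1)-n\ell m$ with $1\le c\le n$, $1\le d\le\ell$, $m\in\mathbb Z$. For $s\in\mathbb Z$, let $P(s)$ be the set of integer sequences $\mathbf k=(k_1,k_2,\dots)$ with $k_r=s-r+1$ for all sufficiently large $r$, and let $\Lambda^s$ be the $\mathbb Q(q)$-vector space spanned by the $q$-wedges $u_{\mathbf k}=u_{k_1}\wedge u_{k_2}\wedge\cdots$ $(\mathbf k\in P(s))$ subject to the straightening rules, applied to any two adjacent factors: for $k_2\le k_1$, $k_a=c_a+n(d_a-1)-n\ell m_a$, $$u_{k_2}\wedge u_{k_1}=(-q^{-1})^{[d_1=d_2]}\Big(q^{[c_1=c_2]}\,u_{k_1}\wedge u_{k_2}+(q-q^{-1})\sum_{i=[c_1\le c_2]}^{m_2-m_1-[d_1\le d_2]}u_{k_1-c_1+c_2-n\ell i}\wedge u_{k_2+c_1-c_2+n\ell i}\Big),$$ where $[\cdot]$ is $1$ if the condition holds and $0$ otherwise. The $u_{\mathbf k}$ with $\mathbf k$ strictly decreasing form a basis of $\Lambda^s$.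 For $\boldsymbol s=(s_1,\dots,s_\ell)\in\mathbb Z^\ell$ with sum $s$ and an $\ell$-tuple $\boldsymbol\lambda=(\lambda^{(1)},\dots,\lambda^{(\ell)})$ of Young diagrams, $|\boldsymbol\lambda;\boldsymbol s\rangle=u_{\mathbf k}$, where $\mathbf k$ lists in decreasing order all the integers $k=c+n(d-1)-n\ell m$ with $c-nm=s_d+\lambda^{(d)}_r-r+1$ for some $r\ge 1$. Let $\mathbf F_q[\boldsymbol s]=\bigoplus_{\boldsymbol\lambda}\mathbb Q(q)\,|\boldsymbol\lambda;\boldsymbol s\rangle$ (the Fock space of level $\ell$). The bar involution is semilinear with respect to $q\mapsto q^{-1}$ and satisfies, for $\mathbf k$ strictly decreasing and all sufficiently large $r$, $$\overline{u_{\mathbf k}}=(-q)^{\kappa(d_1,\dots,d_r)}q^{-\kappa(c_1,\dots,c_r)}\,(u_{k_r}\wedge\cdots\wedge u_{k_1})\wedge u_{k_{r+1}}\wedge\cdots,$$ where $c_a,d_a$ belong to $k_a$ and $\kappa(a_1,\dots,a_r)=\#\{(i,j): i<j,\ a_i=a_j\}$. The canonical bases $\{G^{+}(\boldsymbol\lambda;\boldsymbol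 s)\}$, $\{G^{-}(\boldsymbol\lambda;\boldsymbol s)\}$ of $\mathbf F_q[\boldsymbol s]$ are the unique bases consisting of bar-invariant elements with $G^{\pm}(\boldsymbol\lambda;\boldsymbol s)\equiv|\boldsymbol\lambda;\boldsymbol s\rangle$ modulo $q^{\pm1}\bigoplus_{\boldsymbol\mu}\mathbb Q[q^{\pm1}]\,|\boldsymbol\mu;\boldsymbol s\rangle$, and the $q$-decomposition numbers of level $\ell$ are defined by $G^{\varepsilon}(\boldsymbol\lambda;\boldsymbol s)=\sum_{\boldsymbol\mu}\Delta^{\varepsilon}_{\boldsymbol\lambda,\boldsymbol\mu;\boldsymbol s}(q)\,|\boldsymbol\mu;\boldsymbol s\rangle$. **Theorem A.** Let $n\ge2$, $\ell\ge 2$, $\varepsilon\in\{+,-\}$, $\boldsymbol s\in\mathbb Z^\ell$, $1\le j\le \ell$, and let $\boldsymbol\lambda$ be an $\ell$-tuple of Young diagrams such that $s_j$ is sufficiently large for $|\boldsymbol\lambda;\boldsymbol s\rangle$, i.e. $s_j-s_i\ge\lambda^{(i)}_1$ for all $i=1,\dots,\ell$. Write $\check{\boldsymbol\lambda},\check{\boldsymbol\mu},\check{\boldsymbol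 s}$ for the tuples obtained from $\boldsymbol\lambda,\boldsymbol\mu,\boldsymbol s$ by deleting the $j$-th component. Then the canonical bases of $\mathbf F_q[\boldsymbol s]$ (level $\ell$) and of $\mathbf F_q[\check{\boldsymbol s}]$ (level $\ell-1$) exist and are unique, and 1. for every $\ell$-tuple $\boldsymbol\mu$ of Young diagrams with $\mu^{(j)}=\emptyset$ or $|\boldsymbol\mu|=|\boldsymbol\lambda|$, $$\Delta^{\varepsilon}_{\boldsymbol\lambda,\boldsymbol\mu;\boldsymbol s}(q)=\Delta^{\varepsilon}_{\check{\boldsymbol\lambda},\check{\boldsymbol\mu};\check{\boldsymbol s}}(q);$$ 2. for every $\ell$-tuple $\boldsymbol\mu$ with $\mu^{(j)}\neq\emptyset$, $\Delta^{\varepsilon}_{\boldsymbol\lambda,\boldsymbol\mu;\boldsymbol s}(q)=0$. -/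

import Mathlib

noncomputable section

namespace FockSpace

open Filter

/-! ## The field `ℚ(q)` and the automorphism `q ↦ q⁻¹` -/

/-- The field `ℚ(q)`. -/
abbrev Kq : Type := RatFunc ℚ

/-- The indeterminate `q`. -/
def q : Kq := RatFunc.X

/-- Evaluation of a polynomial with coefficients in `ℚ` at an element of `ℚ(q)`. -/
def evalAt (v : Kq) : Polynomial ℚ →+* Kq := Polynomial.eval₂RingHom RatFunc.C v

theorem evalAt_inv_injective : Function.Injective (evalAt q⁻¹) := by
  let : Algebra ℚ Kq := RatFunc.instAlgebraOfPolynomial ℚ ℚ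
  have h : Transcendental ℚ (q : Kq) := RatFunc.transcendental_X
  have h' : Transcendental ℚ (q⁻¹ : Kq) := fun hh => h (by simpa using hh.inv)
  exact transcendental_iff_injective.mp h'

/-- The field endomorphism of `ℚ(q)` that is the identity on `ℚ` and sends `q` to `q⁻¹`. -/
def qBar : Kq →+* Kq :=
  RatFunc.liftRingHom (evalAt q⁻¹)
    (nonZeroDivisors_le_comap_nonZeroDivisors_of_injective _ evalAt_inv_injective)

theorem qBar_q : qBar q = q⁻¹ := by
  have h := RatFunc.liftRingHom_apply_div (L := Kq) (φ := evalAt q⁻¹)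
    (nonZeroDivisors_le_comap_nonZeroDivisors_of_injective _ evalAt_inv_injective)
    Polynomial.X 1
  simpa only [qBar, q, evalAt, map_one, div_one, RatFunc.algebraMap_X,
    Polynomial.coe_eval₂RingHom, Polynomial.eval₂_X] using h

/-! ## The abacus: `k = c + n (d - 1) - n ℓ m` with `1 ≤ c ≤ n`, `1 ≤ d ≤ ℓ` -/

/-- The integer `c` attached to `k`. -/
def cPart (n : ℕ) (k : ℤ) : ℤ := (k - 1) % n + 1

/-- The integer `d` attached to `k`. -/
def dPart (n l : ℕ) (k : ℤ) : ℤ := ((k - 1) / n) % l + 1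

/-- The integer `m` attached to `k`. -/
def mPart (n l : ℕ) (k : ℤ) : ℤ := -(((k - 1) / n) / l)

theorem cdm_spec (n l : ℕ) [NeZero n] [NeZero l] (k : ℤ) :
    k = cPart n k + n * (dPart n l k - 1) - n * l * mPart n l k ∧
      1 ≤ cPart n k ∧ cPart n k ≤ n ∧ 1 ≤ dPart n l k ∧ dPart n l k ≤ l := by
  have hn : (0 : ℤ) < n := by exact_mod_cast Nat.pos_of_ne_zero (NeZero.ne n)
  have hl : (0 : ℤ) < l := by exact_mod_cast Nat.pos_of_ne_zero (NeZero.ne l)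
  have h1 := Int.emod_add_mul_ediv (k - 1) n
  have h2 := Int.emod_add_mul_ediv ((k - 1) / n) l
  have h3 := Int.emod_nonneg (k - 1) hn.ne'
  have h4 := Int.emod_lt_of_pos (k - 1) hn
  have h5 := Int.emod_nonneg ((k - 1) / n) hl.ne'
  have h6 := Int.emod_lt_of_pos ((k - 1) / n) hl
  refine ⟨?_, ?_, ?_, ?_, ?_⟩ <;> simp only [cPart, dPart, mPart] <;> try omega
  linear_combination -h1 - (n : ℤ) * h2

/-- The position `k` with `u_k = u_x^{(d)}`, that is, `k = c + n (d - 1) - n ℓ m` where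
`x = c - n m`; the component `d` is numbered from `0` here. -/
def position (n l : ℕ) (d : Fin l) (x : ℤ) : ℤ :=
  ((x - 1) % n + 1) + n * (d : ℕ) + n * l * ((x - 1) / n)

theorem position_spec (n l : ℕ) [NeZero n] (d : Fin l) (x : ℤ) :
    dPart n l (position n l d x) = (d : ℕ) + 1 ∧
      cPart n (position n l d x) - n * mPart n l (position n l d x) = x := by
  have hn : (0 : ℤ) < n := by exact_mod_cast Nat.pos_of_ne_zero (NeZero.ne n)
  have hl : (0 : ℤ) < l := by exact_mod_cast d.pos
  have h1 := Int.emod_add_mul_ediv (x - 1) n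
  have h3 := Int.emod_nonneg (x - 1) hn.ne'
  have h4 := Int.emod_lt_of_pos (x - 1) hn
  have hd : ((d : ℕ) : ℤ) < l := by exact_mod_cast d.2
  have hd0 : (0 : ℤ) ≤ ((d : ℕ) : ℤ) := by positivity
  have e : position n l d x - 1 = (x - 1) % n + n * ((d : ℕ) + l * ((x - 1) / n)) := by
    simp only [position]; ring
  have a1 : (position n l d x - 1) / n = (d : ℕ) + l * ((x - 1) / n) := by
    rw [e, Int.add_mul_ediv_left _ _ hn.ne', Int.ediv_eq_zero_of_lt h3 h4, zero_add]
  have a2 : (position n l d x - 1) % n = (x - 1) % n := by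
    rw [e, Int.add_mul_emod_self_left, Int.emod_emod]
  have a3 : ((position n l d x - 1) / n) % l = (d : ℕ) := by
    rw [a1, Int.add_mul_emod_self_left, Int.emod_eq_of_lt hd0 hd]
  have a4 : ((position n l d x - 1) / n) / l = (x - 1) / n := by
    rw [a1, Int.add_mul_ediv_left _ _ hl.ne', Int.ediv_eq_zero_of_lt hd0 hd, zero_add]
  constructor
  · simp only [dPart, a3]
  · simp only [cPart, mPart, a2, a4]; linarith

/-! ## Semi-infinite `q`-wedge products and straightening rules -/

/-- `P(s)`: the integer sequences `(k_1, k_2, …)` with `k_r = s - r + 1` for all large `r`.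
Sequences are numbered from `0` here: `k r` stands for `k_{r+1}`. -/
def P (s : ℤ) : Type := {k : ℕ → ℤ // ∀ᶠ r in atTop, k r = s - r}

/-- Replace the adjacent entries number `i`, `i + 1` of `k` by `a`, `b`. -/
def P.setPair {s : ℤ} (k : P s) (i : ℕ) (a b : ℤ) : P s :=
  ⟨fun t => if t = i then a else if t = i + 1 then b else k.1 t, by
    filter_upwards [k.2, eventually_gt_atTop (i + 1)] with t h1 h2
    rw [if_neg (by omega), if_neg (by omega), h1]⟩

/-- Reverse the order of the first `r` entries of `k`. -/
def P.reverseFirst {s : ℤ} (k : P s) (r : ℕ) : P s :=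
  ⟨fun t => if t < r then k.1 (r - 1 - t) else k.1 t, by
    filter_upwards [k.2, eventually_ge_atTop r] with t h1 h2
    rw [if_neg (by omega), h1]⟩

/-- The straightening rule applied to the adjacent factors number `i`, `i + 1` of `u_k`.
Put `k_2 = k i`, `k_1 = k (i + 1)` and write `k_a = c_a + n (d_a - 1) - n ℓ m_a`. If
`k_2 ≤ k_1`, the rule is
`u_{k_2} ∧ u_{k_1} = (-q⁻¹)^{[d_1 = d_2]} ( q^{[c_1 = c_2]} u_{k_1} ∧ u_{k_2}
  + (q - q⁻¹) ∑_j u_{k_1 - c_1 + c_2 - n ℓ j} ∧ u_{k_2 + c_1 - c_2 + n ℓ j} )`,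
the sum being over `[c_1 ≤ c_2] ≤ j ≤ m_2 - m_1 - [d_1 ≤ d_2]`. This is the right-hand side. -/
def straighten (n l : ℕ) {s : ℤ} (k : P s) (i : ℕ) : P s →₀ Kq :=
  let k₂ := k.1 i
  let k₁ := k.1 (i + 1)
  let c₁ := cPart n k₁
  let c₂ := cPart n k₂
  let d₁ := dPart n l k₁
  let d₂ := dPart n l k₂
  let m₁ := mPart n l k₁
  let m₂ := mPart n l k₂
  (if d₁ = d₂ then -q⁻¹ else 1 : Kq) •
    ((if c₁ = c₂ then q else 1 : Kq) • Finsupp.single (k.setPair i k₁ k₂) (1 : Kq) +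
      (q - q⁻¹) • ∑ j ∈ Finset.Icc (if c₁ ≤ c₂ then 1 else 0 : ℤ)
          (m₂ - m₁ - (if d₁ ≤ d₂ then 1 else 0)),
        Finsupp.single (k.setPair i (k₁ - c₁ + c₂ - n * l * j) (k₂ + c₁ - c₂ + n * l * j))
          (1 : Kq))

/-- The span of the straightening relations. -/
def relations (n l : ℕ) (s : ℤ) : Submodule Kq (P s →₀ Kq) :=
  Submodule.span Kq {x | ∃ (k : P s) (i : ℕ), k.1 i ≤ k.1 (i + 1) ∧
    x = Finsupp.single k (1 : Kq) - straighten n l k i}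

/-- The space `Λ^s` spanned by the `q`-wedge products `u_k`, `k ∈ P(s)`, subject to the
straightening rules. -/
abbrev Wedge (n l : ℕ) (s : ℤ) : Type := (P s →₀ Kq) ⧸ relations n l s

/-- The `q`-wedge product `u_k`. -/
def wedge (n l : ℕ) {s : ℤ} (k : P s) : Wedge n l s :=
  (relations n l s).mkQ (Finsupp.single k (1 : Kq))

/-! ## Multipartitions and the standard basis -/

/-- `ℓ`-tuples of Young diagrams; `(lam d).rowLen r` is the part `λ^{(d)}_{r+1}`. -/
abbrev MultiPartition (l : ℕ) : Type := Fin l → YoungDiagram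

/-- The total number of boxes. -/
def MultiPartition.size {l : ℕ} (lam : MultiPartition l) : ℕ := ∑ d, (lam d).card

/-- The set of all `k` such that `u_k = u_x^{(d)}` with `x = s_d + λ^{(d)}_r - r + 1` for some `d`
and some `r ≥ 1`. -/
def beads (n l : ℕ) (lam : MultiPartition l) (s : Fin l → ℤ) : Set ℤ :=
  {k | ∃ (d : Fin l) (r : ℕ), k = position n l d (s d + (lam d).rowLen r - r)}

theorem lt_position_iff (n l : ℕ) [NeZero n] (d : Fin l) (x T : ℤ) :
    -(n * l * T) < position n l d x ↔ -(n * T) < x := by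
  have hn : (0 : ℤ) < n := by exact_mod_cast Nat.pos_of_ne_zero (NeZero.ne n)
  have hl : (0 : ℤ) < l := by exact_mod_cast d.pos
  have h1 := Int.emod_add_mul_ediv (x - 1) n
  have h3 := Int.emod_nonneg (x - 1) hn.ne'
  have h4 := Int.emod_lt_of_pos (x - 1) hn
  have hd : ((d : ℕ) : ℤ) + 1 ≤ l := by exact_mod_cast d.2
  have hd0 : (0 : ℤ) ≤ ((d : ℕ) : ℤ) := by positivity
  simp only [position]
  generalize (x - 1) % (n : ℤ) = a at *
  generalize (x - 1) / (n : ℤ) = b at *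
  generalize ((d : ℕ) : ℤ) = e at *
  have hx : x = a + n * b + 1 := by linarith
  subst hx
  have hnd : (0 : ℤ) ≤ n * e := by positivity
  have hnd' : (n : ℤ) * e + n ≤ n * l := by nlinarith
  constructor
  · intro h
    by_contra hc
    have hb : b + T < 0 := by
      by_contra hb
      push Not at hb
      have : 0 ≤ (n : ℤ) * (b + T) := by positivity
      nlinarith
    have : (n : ℤ) * l * (b + T) ≤ n * l * (-1) :=
      mul_le_mul_of_nonneg_left (by omega) (by positivity)
    nlinarith
  · intro h
    have hb : 0 ≤ b + T := by
      by_contra hb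
      push Not at hb
      have : (n : ℤ) * (b + T) ≤ n * (-1) :=
        mul_le_mul_of_nonneg_left (by omega) (by positivity)
      nlinarith
    have : 0 ≤ (n : ℤ) * l * (b + T) := by positivity
    nlinarith

theorem exists_position (n l : ℕ) [NeZero n] [NeZero l] (k : ℤ) :
    ∃ (d : Fin l) (x : ℤ), k = position n l d x := by
  have hn : (0 : ℤ) < n := by exact_mod_cast Nat.pos_of_ne_zero (NeZero.ne n)
  obtain ⟨h1, h2, h3, h4, h5⟩ := cdm_spec n l k
  refine ⟨⟨(dPart n l k - 1).toNat, by omega⟩, cPart n k - n * mPart n l k, ?_⟩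
  have e : cPart n k - n * mPart n l k - 1 = (cPart n k - 1) + n * (-mPart n l k) := by ring
  have b1 : (cPart n k - n * mPart n l k - 1) % n = cPart n k - 1 := by
    rw [e, Int.add_mul_emod_self_left, Int.emod_eq_of_lt (by omega) (by omega)]
  have b2 : (cPart n k - n * mPart n l k - 1) / n = -mPart n l k := by
    rw [e, Int.add_mul_ediv_left _ _ hn.ne', Int.ediv_eq_zero_of_lt (by omega) (by omega),
      zero_add]
  have b3 : (((dPart n l k - 1).toNat : ℕ) : ℤ) = dPart n l k - 1 := by omega
  simp only [position, b1, b2, b3]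
  linarith

/-- The beads, listed in decreasing order, form an element of `P^{++}(s_1 + ⋯ + s_ℓ)`. -/
theorem exists_ordered (n l : ℕ) [NeZero n] [NeZero l] (lam : MultiPartition l)
    (s : Fin l → ℤ) :
    ∃ k : P (∑ d, s d), StrictAnti k.1 ∧ Set.range k.1 = beads n l lam s := by
  classical
  have hn : (1 : ℤ) ≤ n := by exact_mod_cast Nat.one_le_iff_ne_zero.mpr (NeZero.ne n)
  -- a bound below which every position is occupied
  obtain ⟨T, hT0, hT⟩ : ∃ T : ℤ, 0 ≤ T ∧ ∀ d, ((lam d).colLen 0 : ℤ) ≤ s d + n * T := by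
    refine ⟨∑ d, (|s d| + (lam d).colLen 0), by positivity, fun d => ?_⟩
    have h1 : |s d| + ((lam d).colLen 0 : ℤ) ≤ ∑ d, (|s d| + ((lam d).colLen 0 : ℤ)) :=
      Finset.single_le_sum (f := fun d => |s d| + ((lam d).colLen 0 : ℤ))
        (fun i _ => by positivity) (Finset.mem_univ d)
    have h2 := neg_abs_le (s d)
    have h3 : (0 : ℤ) ≤ ∑ d, (|s d| + ((lam d).colLen 0 : ℤ)) := by positivity
    nlinarith
  have hrow : ∀ d (r : ℕ), s d + n * T ≤ r → (lam d).rowLen r = 0 := by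
    intro d r hr
    by_contra hne
    have hmem : (r, 0) ∈ lam d := by
      rw [YoungDiagram.mem_iff_lt_rowLen]; omega
    rw [YoungDiagram.mem_iff_lt_colLen] at hmem
    have := hT d
    omega
  set N : ℤ := n * l * T with hN
  set x : (d : Fin l) → ℕ → ℤ := fun d r => s d + (lam d).rowLen r - r with hx
  have hxanti : ∀ d, StrictAnti (x d) := by
    intro d a b hab
    have := (lam d).rowLen_anti a b hab.le
    simp only [hx]
    omega
  have hinj : ∀ d d' y y', position n l d y = position n l d' y' → d = d' ∧ y = y' := by
    intro d d' y y' h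
    obtain ⟨p1, p2⟩ := position_spec n l d y
    obtain ⟨p3, p4⟩ := position_spec n l d' y'
    rw [h] at p1 p2
    exact ⟨Fin.ext (by omega), by omega⟩
  -- the finitely many beads above the bound
  let I : Finset (Σ _ : Fin l, ℕ) :=
    Finset.univ.sigma fun d => Finset.range (s d + n * T).toNat
  let f : (Σ _ : Fin l, ℕ) → ℤ := fun p => position n l p.1 (x p.1 p.2)
  have hf : Function.Injective f := by
    rintro ⟨d, r⟩ ⟨d', r'⟩ h
    obtain ⟨h1, h2⟩ := hinj _ _ _ _ h
    dsimp only at h1 h2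
    subst h1
    rw [(hxanti d).injective h2]
  let B : Finset ℤ := I.image f
  have hcard : (B.card : ℤ) = ∑ d, s d + N := by
    rw [Finset.card_image_of_injective _ hf, Finset.card_sigma]
    push_cast
    simp only [Finset.card_range]
    have : ∀ d, (((s d + n * T).toNat : ℕ) : ℤ) = s d + n * T := by
      intro d
      have := hT d
      omega
    simp only [this, Finset.sum_add_distrib, Finset.sum_const, Finset.card_univ,
      Fintype.card_fin, nsmul_eq_mul, hN]
    ring
  have hB : ∀ k, k ∈ B ↔ k ∈ beads n l lam s ∧ -N < k := by
    intro k
    constructor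
    · intro hk
      obtain ⟨⟨d, r⟩, hp, rfl⟩ := Finset.mem_image.mp hk
      refine ⟨⟨d, r, rfl⟩, (lt_position_iff n l d _ T).mpr ?_⟩
      have hr : r < (s d + n * T).toNat := by simpa [I] using hp
      simp only [hx]
      omega
    · rintro ⟨⟨d, r, rfl⟩, hk⟩
      rw [hN, lt_position_iff] at hk
      refine Finset.mem_image.mpr ⟨⟨d, r⟩, ?_, rfl⟩
      have : r < (s d + n * T).toNat := by
        by_contra hc
        have hr0 := hrow d r (by omega)
        rw [hr0] at hk
        omega
      simpa [I] using this
  have hlow : ∀ k, k ≤ -N → k ∈ beads n l lam s := by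
    intro k hk
    obtain ⟨d, y, rfl⟩ := exists_position n l k
    have hy : ¬ (-(n * T) < y) := by
      rw [← lt_position_iff n l d]; omega
    have hTd := hT d
    have e : (((s d - y).toNat : ℕ) : ℤ) = s d - y := by omega
    refine ⟨d, (s d - y).toNat, ?_⟩
    rw [hrow d _ (by omega), e]
    congr 1
    simp
  let g := B.orderEmbOfFin rfl
  let kf : ℕ → ℤ := fun r =>
    if h : r < B.card then g ⟨B.card - 1 - r, by omega⟩ else ∑ d, s d - r
  refine ⟨⟨kf, ?_⟩, ?_, ?_⟩
  · filter_upwards [eventually_ge_atTop B.card] with r hr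
    simp only [kf]
    rw [dif_neg (by omega)]
  · intro a b hab
    simp only [kf]
    by_cases hb : b < B.card
    · rw [dif_pos hb, dif_pos (by omega)]
      exact g.strictMono (by rw [Fin.mk_lt_mk]; omega)
    · rw [dif_neg hb]
      by_cases ha : a < B.card
      · rw [dif_pos ha]
        have := ((hB _).mp (B.orderEmbOfFin_mem rfl ⟨B.card - 1 - a, by omega⟩)).2
        change _ < B.orderEmbOfFin rfl _
        omega
      · rw [dif_neg ha]
        omega
  · ext k
    constructor
    · rintro ⟨r, rfl⟩
      simp only [kf]
      split_ifs with h
      · exact ((hB _).mp (B.orderEmbOfFin_mem rfl _)).1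
      · exact hlow _ (by omega)
    · intro hk
      by_cases hkN : -N < k
      · have : k ∈ Set.range (B.orderEmbOfFin rfl) := by
          rw [Finset.range_orderEmbOfFin]; exact (hB k).mpr ⟨hk, hkN⟩
        obtain ⟨t, rfl⟩ := this
        have ht := t.2
        refine ⟨B.card - 1 - t, ?_⟩
        simp only [kf]
        rw [dif_pos (by omega)]
        change B.orderEmbOfFin rfl _ = _
        congr 1
        ext
        dsimp only
        omega
      · refine ⟨(∑ d, s d - k).toNat, ?_⟩
        simp only [kf]
        rw [dif_neg (by omega)]
        omega

/-- The sequence `k ∈ P^{++}(s_1 + ⋯ + s_ℓ)` with `u_k = |λ; s⟩`: the strictly decreasing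
sequence that lists the beads. -/
def ketSeq (n l : ℕ) [NeZero n] [NeZero l] (s : Fin l → ℤ) (lam : MultiPartition l) :
    P (∑ d, s d) :=
  (exists_ordered n l lam s).choose

/-- The `q`-deformed Fock space `F_q[s] = ⨁_λ ℚ(q) |λ; s⟩` of level `ℓ`: the element `x` stands
for `∑_λ x_λ |λ; s⟩`, and `|λ; s⟩` is `Finsupp.single λ 1`. -/
abbrev Fock (l : ℕ) : Type := MultiPartition l →₀ Kq

/-- The map `F_q[s] → Λ^s` that sends `|λ; s⟩` to the ordered `q`-wedge product that it denotes. -/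
def toWedge (n l : ℕ) [NeZero n] [NeZero l] (s : Fin l → ℤ) :
    Fock l →ₗ[Kq] Wedge n l (∑ d, s d) :=
  Finsupp.linearCombination Kq fun lam => wedge n l (ketSeq n l s lam)

/-! ## The bar involution -/

/-- `κ(a_1, …, a_r)`, the number of pairs `i < j` with `a_i = a_j`. -/
def kappa (r : ℕ) (a : ℕ → ℤ) : ℕ :=
  ((Finset.range r ×ˢ Finset.range r).filter fun p => p.1 < p.2 ∧ a p.1 = a p.2).card

/-- `(-q)^{κ(d_1, …, d_r)} q^{-κ(c_1, …, c_r)} (u_{k_r} ∧ ⋯ ∧ u_{k_1}) ∧ u_{k_{r+1}} ∧ ⋯`. -/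
def barWedge (n l r : ℕ) {s : ℤ} (k : P s) : Wedge n l s :=
  ((-q) ^ kappa r (fun i => dPart n l (k.1 i)) *
      (q⁻¹) ^ kappa r (fun i => cPart n (k.1 i)) : Kq) •
    wedge n l (k.reverseFirst r)

/-- The bar involution on `F_q[s]`, computed by reversing the first `r` factors: the semilinear
extension (with respect to `q ↦ q⁻¹`) of `|λ; s⟩ = u_k ↦ barWedge r k`. -/
def barTrunc (n l r : ℕ) [NeZero n] [NeZero l] (s : Fin l → ℤ) (x : Fock l) :
    Wedge n l (∑ d, s d) :=
  x.sum fun lam a => qBar a • barWedge n l r (ketSeq n l s lam)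

/-- The bar involution of `x` is `y`. The bar involution is the value of `barTrunc r` for all
sufficiently large `r`. -/
def IsBar (n l : ℕ) [NeZero n] [NeZero l] (s : Fin l → ℤ) (x y : Fock l) : Prop :=
  ∀ᶠ r in atTop, barTrunc n l r s x = toWedge n l s y

/-! ## Canonical bases and `q`-decomposition numbers -/

/-- The index `ε ∈ {+, -}`. -/
inductive Sgn : Type
  | plus
  | minus

/-- `q` for `ε = +` and `q⁻¹` for `ε = -`. -/
def Sgn.q : Sgn → Kq
  | .plus => FockSpace.q
  | .minus => FockSpace.q⁻¹

/-- The lattice `𝓛^ε`: the elements whose coefficients lie in `ℚ[q]` if `ε = +`, in `ℚ[q⁻¹]` if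
`ε = -`. -/
def lattice (l : ℕ) (ε : Sgn) : Set (Fock l) :=
  {x | ∀ mu, ∃ p : Polynomial ℚ, x mu = evalAt ε.q p}

/-- `G` is the canonical basis `{G^ε(λ; s)}` of `F_q[s]`: each `G λ` is invariant under the bar
involution and congruent to `|λ; s⟩` modulo `q 𝓛^+` if `ε = +`, modulo `q⁻¹ 𝓛^-` if `ε = -`. -/
def IsCanonicalBasis (n l : ℕ) [NeZero n] [NeZero l] (ε : Sgn) (s : Fin l → ℤ)
    (G : Module.Basis (MultiPartition l) Kq (Fock l)) : Prop :=
  ∀ lam, IsBar n l s (G lam) (G lam) ∧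
    ∃ y ∈ lattice l ε, G lam = Finsupp.single lam (1 : Kq) + ε.q • y

open Classical in
/-- The `q`-decomposition number `Δ^ε_{λ, μ; s}(q)` of level `ℓ`: the coefficient of `|μ; s⟩` in
`G^ε(λ; s)`. -/
def decompositionNumber (n l : ℕ) [NeZero n] [NeZero l] (ε : Sgn) (s : Fin l → ℤ)
    (lam mu : MultiPartition l) : Kq :=
  if h : ∃ G : Module.Basis (MultiPartition l) Kq (Fock l), IsCanonicalBasis n l ε s G then
    h.choose lam mu
  else 0

/-- `s_j` is sufficiently large for `|λ; s⟩`: `s_j - s_i ≥ λ^{(i)}_1` for all `i`. -/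
def SufficientlyLarge {l : ℕ} (s : Fin l → ℤ) (j : Fin l) (lam : MultiPartition l) : Prop :=
  ∀ i, ((lam i).rowLen 0 : ℤ) ≤ s j - s i

end FockSpace

end

/-!
Why the theorem is true.

*The canonical bases.* A strictly decreasing sequence agrees with the vacuum from some point on, so
everything reduces to finite wedges: words in the letters `k ∈ ℤ` modulo the straightening rules.
Straightening expresses every word by ordered words; it lowers the energy `∑ k ^ 2`
(`cls_sub_sortWord_mem`), so the bar involution is unitriangular with Laurent polynomial entries
(`barFinite_cls_sub_mem`), and the argument of Kazhdan and Lusztig yields a unique canonical basis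
(`IsBarMatrix.existsUnique_basis`). This needs two facts on the rules.

* The ordered words are linearly independent. A letter `k` is a triple `(c, m, d)`. The affine Hecke
  algebra acts on the sequences of the `(c, m)` by operators `A_i` of Demazure–Lusztig type, and the
  finite Hecke algebra acts on the sequences of the `d` by Jimbo's operators `B_i`. The rules lie in
  the images of the `A_i - B_i` (`straighten_mem_range`). The operators `C_i = A_i B_i` satisfy the
  braid relations, and `(1 + C_i) (A_i - B_i) = 0`, so the quantum antisymmetrizer, the sum of the
  lifts of all permutations to products of the `C_i`, kills all relations
  (`symmetrizer_opC_mul`). At `q = 1` it becomes an ordinary signed symmetrization, which is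
  injective on ordered sequences (`eq_zero_of_mem_iSup_range`).
* The bar involution is well defined on finite wedges, because reversing two factors conjugates
  `A - B` into itself (`flip_mem_range`), and it does not depend on the number of factors that are
  reversed (`eventually_barWedge_eq`): the letters that are moved are so small that there is no room
  for corrections, as a comparison of sums of letters shows.

*The comparison.* If `s_j` is sufficiently large for `|λ; s⟩`, then `λ^{(j)} = ∅`. Cut off at a level
`M`, the beads of the component `j` are then *all* letters `x` of this component above the cut-off
for which `c - n m ≤ s_j`, and the beads of the other components satisfy the same inequality, a
condition that straightening preserves (`letterClosed_xPart_le`). Since the number of letters of each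
component is preserved too, the component `j` cannot change. So the beads of `j` can be moved
through the other ones without corrections: the wedge of `λ` is, up to a power of `q`, the product of
the wedge of `λ` without its component `j` and of the bar-invariant wedge `J` of the beads of `j`
(`IsComplete.cls_append`, `IsComplete.barFinite_cls`, `IsComplete.cls_append_comm`). The power of
`q` is given by a sum over the beads that is additive in `c`, `d` and `m`
(`sum_vacuumList_indicator`). Such sums are preserved by straightening, so the power is the same for
all multipartitions that occur in the canonical basis vector of level `ℓ`. Therefore inserting an
empty component into this vector gives a bar-invariant vector
(`invariant_mapDomain_insertEmpty`), which has to be the canonical basis vector of level `ℓ + 1`.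
-/

noncomputable section

namespace FockSpace

open Filter

/-! ### Laurent polynomials in `ℚ(q)` -/

theorem q_ne_zero : q ≠ 0 := RatFunc.X_ne_zero

theorem evalAt_C (v : Kq) (a : ℚ) : evalAt v (Polynomial.C a) = RatFunc.C a := by simp [evalAt]

theorem evalAt_X (v : Kq) : evalAt v Polynomial.X = v := by simp [evalAt]

theorem evalAt_q (p : Polynomial ℚ) : evalAt q p = algebraMap (Polynomial ℚ) Kq p := by
  induction p using Polynomial.induction_on' with
  | add a b ha hb => rw [map_add, map_add, ha, hb]
  | monomial n a =>
    rw [← Polynomial.C_mul_X_pow_eq_monomial]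
    simp [evalAt, q]

theorem evalAt_q_injective : Function.Injective (evalAt q) := by
  intro a b h
  rw [evalAt_q, evalAt_q] at h
  exact RatFunc.algebraMap_injective ℚ h

theorem qBar_evalAt_q (p : Polynomial ℚ) : qBar (evalAt q p) = evalAt q⁻¹ p := by
  have h := RatFunc.liftRingHom_apply_div (L := Kq) (φ := evalAt q⁻¹)
    (nonZeroDivisors_le_comap_nonZeroDivisors_of_injective _ evalAt_inv_injective) p 1
  rw [evalAt_q]
  simpa only [qBar, map_one, div_one] using h

theorem qBar_qInv : qBar q⁻¹ = q := by rw [map_inv₀, qBar_q, inv_inv]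

theorem qBar_C (a : ℚ) : qBar (RatFunc.C a) = RatFunc.C a := by
  simpa only [evalAt_C] using qBar_evalAt_q (Polynomial.C a)

theorem qBar_evalAt_qInv (p : Polynomial ℚ) : qBar (evalAt q⁻¹ p) = evalAt q p := by
  induction p using Polynomial.induction_on' with
  | add a b ha hb => rw [map_add, map_add, map_add, ha, hb]
  | monomial n a =>
    rw [← Polynomial.C_mul_X_pow_eq_monomial]
    simp only [map_mul, map_pow, evalAt_C, evalAt_X, qBar_C, qBar_qInv]

theorem qBar_qBar (x : Kq) : qBar (qBar x) = x := by
  induction x using RatFunc.induction_on with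
  | f a b hb =>
    simp only [map_div₀, ← evalAt_q, qBar_evalAt_q, qBar_evalAt_qInv]

/-- `q` as a unit of `ℚ(q)`. -/
def qUnit : Kqˣ := Units.mk0 q q_ne_zero

/-- The subring `ℚ[q, q⁻¹]` of `ℚ(q)`. -/
def laurent : Subring Kq := (LaurentPolynomial.eval₂ (RatFunc.C : ℚ →+* Kq) qUnit).range

theorem zpow_mem_laurent (a : ℚ) (n : ℤ) : RatFunc.C a * q ^ n ∈ laurent :=
  ⟨LaurentPolynomial.C a * LaurentPolynomial.T n, by
    rw [LaurentPolynomial.eval₂_C_mul_T, Units.val_zpow_eq_zpow_val]; rfl⟩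

theorem q_mem_laurent : q ∈ laurent := by simpa using zpow_mem_laurent 1 1

theorem qInv_mem_laurent : q⁻¹ ∈ laurent := by simpa using zpow_mem_laurent 1 (-1)

theorem laurent_induction {motive : Kq → Prop} (add : ∀ x y, motive x → motive y → motive (x + y))
    (monomial : ∀ (a : ℚ) (n : ℤ), motive (RatFunc.C a * q ^ n)) {x : Kq} (hx : x ∈ laurent) :
    motive x := by
  obtain ⟨f, rfl⟩ := hx
  induction f using LaurentPolynomial.induction_on' with
  | add a b ha hb => rw [map_add]; exact add _ _ ha hb
  | C_mul_T n a =>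
    rw [LaurentPolynomial.eval₂_C_mul_T, Units.val_zpow_eq_zpow_val]
    exact monomial a n

theorem exists_pow_mul_of_mem_laurent {x : Kq} (hx : x ∈ laurent) :
    ∃ (N : ℕ) (p : Polynomial ℚ), q ^ N * x = evalAt q p := by
  refine laurent_induction (motive := fun x => ∃ (N : ℕ) (p : Polynomial ℚ), q ^ N * x = evalAt q p)
    (fun x y hx hy => ?_) (fun a n => ?_) hx
  · obtain ⟨N, p, hp⟩ := hx
    obtain ⟨N', p', hp'⟩ := hy
    refine ⟨N + N', Polynomial.X ^ N' * p + Polynomial.X ^ N * p', ?_⟩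
    rw [map_add, map_mul, map_mul, ← hp, ← hp', map_pow, map_pow, evalAt_X]
    ring
  · refine ⟨n.natAbs, Polynomial.C a * Polynomial.X ^ (n.natAbs + n).toNat, ?_⟩
    rw [map_mul, map_pow, evalAt_X, evalAt_C]
    rw [← zpow_natCast q, ← zpow_natCast q, Int.toNat_of_nonneg (by omega), zpow_add₀ q_ne_zero]
    ring

/-- The specialisation `q = 1` makes sense on `ℚ[q, q⁻¹]`. -/
theorem sub_one_mul_ne_one {x : Kq} (hx : x ∈ laurent) : (q - 1) * x ≠ 1 := by
  intro h
  obtain ⟨N, p, hp⟩ := exists_pow_mul_of_mem_laurent hx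
  have e : evalAt q ((Polynomial.X - 1) * p) = evalAt q (Polynomial.X ^ N) := by
    rw [map_mul, ← hp, map_sub, map_pow, evalAt_X, map_one]
    linear_combination q ^ N * h
  have := congrArg (Polynomial.eval 1) (evalAt_q_injective e)
  simp at this

theorem qBar_sgn (ε : Sgn) : qBar ε.q = ε.q⁻¹ := by
  cases ε
  · exact qBar_q
  · simp only [Sgn.q, qBar_qInv, inv_inv]

theorem sgn_ne_zero (ε : Sgn) : ε.q ≠ 0 := by
  cases ε
  · exact q_ne_zero
  · exact inv_ne_zero q_ne_zero

/-- A bar-antisymmetric Laurent polynomial is `x - x̄` with `x` in `q ℚ[q]` (`q⁻¹ ℚ[q⁻¹]`). -/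
theorem exists_sub_qBar (ε : Sgn) {c : Kq} (hc : c ∈ laurent) (hbar : qBar c = -c) :
    ∃ p : Polynomial ℚ, ε.q * evalAt ε.q p - qBar (ε.q * evalAt ε.q p) = c := by
  suffices H : ∀ c ∈ laurent, ∃ p : Polynomial ℚ,
      ε.q * evalAt ε.q p - qBar (ε.q * evalAt ε.q p) = c - qBar c by
    obtain ⟨p, hp⟩ := H c hc
    refine ⟨Polynomial.C (1 / 2) * p, ?_⟩
    have h2 : evalAt ε.q (Polynomial.C (1 / 2) * p) = 2⁻¹ * evalAt ε.q p := by
      rw [map_mul]; simp [evalAt]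
    rw [h2]
    have h3 : qBar (ε.q * (2⁻¹ * evalAt ε.q p)) = 2⁻¹ * qBar (ε.q * evalAt ε.q p) := by
      simp only [map_mul, map_inv₀, map_ofNat]; ring
    rw [h3, hbar] at *
    have : (2 : Kq) ≠ 0 := two_ne_zero
    field_simp
    linear_combination hp
  intro c hc
  -- `v ^ n` and `v ^ (-n)` have opposite antisymmetrisations
  have key : ∀ (a : ℚ) (n : ℕ), ∃ p : Polynomial ℚ,
      ε.q * evalAt ε.q p - qBar (ε.q * evalAt ε.q p)
        = RatFunc.C a * ε.q ^ n - RatFunc.C a * (ε.q⁻¹) ^ n := by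
    intro a n
    rcases n with _ | n
    · exact ⟨0, by simp⟩
    · refine ⟨Polynomial.C a * Polynomial.X ^ n, ?_⟩
      simp only [map_mul, map_pow, evalAt_C, evalAt_X, qBar_C, qBar_sgn]
      ring
  have key2 : ∀ (a : ℚ) (n : ℤ), ∃ p : Polynomial ℚ,
      ε.q * evalAt ε.q p - qBar (ε.q * evalAt ε.q p)
        = RatFunc.C a * ε.q ^ n - qBar (RatFunc.C a * ε.q ^ n) := by
    intro a n
    obtain ⟨m, rfl | rfl⟩ := n.eq_nat_or_neg
    · obtain ⟨p, hp⟩ := key a m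
      refine ⟨p, hp.trans ?_⟩
      rw [map_mul, qBar_C, map_zpow₀, qBar_sgn, zpow_natCast, zpow_natCast]
    · obtain ⟨p, hp⟩ := key (-a) m
      refine ⟨p, hp.trans ?_⟩
      rw [map_mul, qBar_C, map_zpow₀, qBar_sgn, zpow_neg, zpow_neg, zpow_natCast, zpow_natCast,
        inv_pow, inv_inv, map_neg]
      ring
  refine laurent_induction (motive := fun c => ∃ p : Polynomial ℚ,
      ε.q * evalAt ε.q p - qBar (ε.q * evalAt ε.q p) = c - qBar c)
    (fun x y hx hy => ?_) (fun a n => ?_) hc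
  · obtain ⟨p, hp⟩ := hx
    obtain ⟨p', hp'⟩ := hy
    refine ⟨p + p', ?_⟩
    simp only [map_add, mul_add] at *
    linear_combination hp + hp'
  · cases ε with
    | plus => exact key2 a n
    | minus => simpa [Sgn.q] using key2 a (-n)

/-- The lattices `q ℚ[q]` and `q⁻¹ ℚ[q⁻¹]` contain no nonzero bar-invariant element. -/
theorem evalAt_eq_zero_of_qBar_eq (ε : Sgn) (p : Polynomial ℚ)
    (h : qBar (ε.q * evalAt ε.q p) = ε.q * evalAt ε.q p) : ε.q * evalAt ε.q p = 0 := by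
  have main : q⁻¹ * evalAt q⁻¹ p = q * evalAt q p := by
    cases ε
    · simpa only [Sgn.q, map_mul, qBar_q, qBar_evalAt_q] using h
    · simpa only [Sgn.q, map_mul, qBar_qInv, qBar_evalAt_qInv] using h.symm
  let _ : Invertible q := invertibleOfNonzero q_ne_zero
  have hr : evalAt q⁻¹ p * q ^ p.natDegree = evalAt q p.reverse := by
    have := Polynomial.eval₂_reflect_mul_pow (RatFunc.C : ℚ →+* Kq) q p.natDegree p.reverse
      (Polynomial.reverse_natDegree_le p)
    simpa [Polynomial.reverse, evalAt] using this
  have e : evalAt q p.reverse = evalAt q (p * Polynomial.X ^ (p.natDegree + 2)) := by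
    rw [← hr, map_mul, map_pow, evalAt_X]
    have hq : q * q⁻¹ = 1 := mul_inv_cancel₀ q_ne_zero
    linear_combination q ^ p.natDegree * (q * main - evalAt q⁻¹ p * hq)
  have e2 := evalAt_q_injective e
  have hp : p = 0 := by
    by_contra hp
    have h1 := Polynomial.reverse_natDegree_le p
    rw [e2, Polynomial.natDegree_mul_X_pow _ hp] at h1
    omega
  rw [hp, map_zero, mul_zero]

theorem qBar_mem_laurent {x : Kq} (hx : x ∈ laurent) : qBar x ∈ laurent := by
  refine laurent_induction (motive := fun x => qBar x ∈ laurent)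
    (fun x y hx hy => ?_) (fun a n => ?_) hx
  · rw [map_add]; exact add_mem hx hy
  · rw [map_mul, qBar_C, map_zpow₀, qBar_q, inv_zpow']
    exact zpow_mem_laurent a (-n)

theorem evalAt_sgn_mem_laurent (ε : Sgn) (p : Polynomial ℚ) : evalAt ε.q p ∈ laurent := by
  induction p using Polynomial.induction_on' with
  | add a b ha hb => rw [map_add]; exact add_mem ha hb
  | monomial n a =>
    rw [← Polynomial.C_mul_X_pow_eq_monomial, map_mul, map_pow, evalAt_C, evalAt_X]
    refine mul_mem (by simpa using zpow_mem_laurent a 0) (pow_mem ?_ n)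
    cases ε
    · exact q_mem_laurent
    · exact qInv_mem_laurent

theorem sgn_mem_laurent (ε : Sgn) : ε.q ∈ laurent := by
  simpa only [evalAt_X] using evalAt_sgn_mem_laurent ε Polynomial.X

/-! ### Canonical bases of unitriangular semilinear involutions -/

/-- The extension of `i ↦ a i` to a map that is semilinear with respect to `q ↦ q⁻¹`. -/
def semilinearExt {X M : Type*} [AddCommGroup M] [Module Kq M] (a : X → M) :
    (X →₀ Kq) →ₛₗ[qBar] M where
  toFun x := x.sum fun i c => qBar c • a i
  map_add' x y := by
    classical
    exact Finsupp.sum_add_index' (by simp) (by intro i b c; rw [map_add, add_smul])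
  map_smul' c x := by
    rw [Finsupp.sum_smul_index' (by simp), Finsupp.smul_sum]
    simp only [smul_eq_mul, map_mul, mul_smul]

theorem semilinearExt_apply {X M : Type*} [AddCommGroup M] [Module Kq M] (a : X → M)
    (x : X →₀ Kq) : semilinearExt a x = x.sum fun i c => qBar c • a i := rfl

theorem semilinearExt_single {X M : Type*} [AddCommGroup M] [Module Kq M] (a : X → M) (i : X)
    (c : Kq) : semilinearExt a (Finsupp.single i c) = qBar c • a i := by
  rw [semilinearExt_apply, Finsupp.sum_single_index (by simp)]

/-- The vectors `a i` are the columns of a semilinear involution of `⨁ ℚ(q) e_i` that is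
unitriangular for the height function `f` and has entries in `ℚ[q, q⁻¹]`. -/
structure IsBarMatrix {X : Type*} (a : X → X →₀ Kq) (f : X → ℕ) : Prop where
  diag : ∀ i, a i i = 1
  lower : ∀ i j, a i j ≠ 0 → j ≠ i → f j < f i
  mem_laurent : ∀ i j, a i j ∈ laurent
  invol : ∀ i, semilinearExt a (a i) = Finsupp.single i 1

namespace IsBarMatrix

variable {X : Type*} {a : X → X →₀ Kq} {f : X → ℕ}

theorem apply_top (h : IsBarMatrix a f) {z : X →₀ Kq} {j : X}
    (hz : ∀ i, z i ≠ 0 → f i ≤ f j) : semilinearExt a z j = qBar (z j) := by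
  rw [semilinearExt_apply, Finsupp.sum, Finsupp.finsetSum_apply, Finset.sum_eq_single j]
  · rw [Finsupp.smul_apply, h.diag, smul_eq_mul, mul_one]
  · intro i hi hij
    rw [Finsupp.smul_apply, smul_eq_mul, mul_eq_zero]
    right
    by_contra hne
    have := h.lower i j hne (Ne.symm hij)
    have := hz i (Finsupp.mem_support_iff.mp hi)
    omega
  · intro hj
    rw [Finsupp.notMem_support_iff.mp hj, map_zero, zero_smul, Finsupp.zero_apply]

theorem apply_mem_laurent (h : IsBarMatrix a f) {z : X →₀ Kq} (hz : ∀ i, z i ∈ laurent) (j : X) :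
    semilinearExt a z j ∈ laurent := by
  rw [semilinearExt_apply, Finsupp.sum, Finsupp.finsetSum_apply]
  exact sum_mem fun i _ => mul_mem (qBar_mem_laurent (hz i)) (h.mem_laurent i j)

theorem apply_apply (h : IsBarMatrix a f) (z : X →₀ Kq) :
    semilinearExt a (semilinearExt a z) = z := by
  induction z using Finsupp.induction_linear with
  | zero => simp
  | add x y hx hy => rw [map_add, map_add, hx, hy]
  | single i c =>
    rw [semilinearExt_single, LinearMap.map_smulₛₗ, h.invol, qBar_qBar, Finsupp.smul_single,
      smul_eq_mul, mul_one]

theorem eq_of_invariant (h : IsBarMatrix a f) (ε : Sgn) {x y : X →₀ Kq}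
    (hx : semilinearExt a x = x) (hy : semilinearExt a y = y)
    (hxy : ∀ j, ∃ p, (x - y) j = ε.q * evalAt ε.q p) : x = y := by
  rw [← sub_eq_zero]
  have hz : semilinearExt a (x - y) = x - y := by rw [map_sub, hx, hy]
  generalize x - y = z at hz hxy
  by_contra hne
  obtain ⟨j, hj, hmax⟩ := z.support.exists_max_image f (Finsupp.support_nonempty_iff.mpr hne)
  have := h.apply_top (z := z) (j := j) fun i hi => hmax i (Finsupp.mem_support_iff.mpr hi)
  rw [hz] at this
  obtain ⟨p, hp⟩ := hxy j
  rw [hp] at this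
  exact Finsupp.mem_support_iff.mp hj
    (hp.trans (evalAt_eq_zero_of_qBar_eq ε p this.symm))

/-- The element of the canonical basis with leading term `e_i`. It lives on every set of indices
that contains `i` and is closed under the involution. The defect `g̅ - g` of an approximation `g` is
antisymmetric, so its part of largest height can be cancelled. -/
theorem exists_invariant (h : IsBarMatrix a f) (ε : Sgn) (i : X) :
    ∃ g : X →₀ Kq, semilinearExt a g = g ∧
      (∀ j, ∃ p, (g - Finsupp.single i (1 : Kq) : X →₀ Kq) j = ε.q * evalAt ε.q p) ∧
      (∀ j, (g - Finsupp.single i (1 : Kq) : X →₀ Kq) j ≠ 0 → f j < f i) ∧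
      ∀ C : X → Prop, (∀ k j, C k → a k j ≠ 0 → C j) → C i → ∀ j, g j ≠ 0 → C j := by
  classical
  suffices H : ∀ n, ∃ g : X →₀ Kq, (∀ j, f i - n ≤ f j → (semilinearExt a g - g) j = 0) ∧
      (∀ j, ∃ p, (g - Finsupp.single i (1 : Kq) : X →₀ Kq) j = ε.q * evalAt ε.q p) ∧
      (∀ j, (g - Finsupp.single i (1 : Kq) : X →₀ Kq) j ≠ 0 → f j < f i) ∧
      ∀ C : X → Prop, (∀ k j, C k → a k j ≠ 0 → C j) → C i → ∀ j, g j ≠ 0 → C j by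
    obtain ⟨g, h1, h2⟩ := H (f i)
    refine ⟨g, ?_, h2⟩
    rw [← sub_eq_zero]
    ext j
    exact h1 j (by omega)
  intro n
  induction n with
  | zero =>
    refine ⟨Finsupp.single i 1, fun j hj => ?_, fun j => ⟨0, by simp⟩, fun j hj => by simp at hj,
      fun C _ hi j hj => ?_⟩
    · rw [semilinearExt_single, map_one, one_smul, Finsupp.sub_apply]
      by_cases hij : j = i
      · rw [hij, h.diag, Finsupp.single_eq_same, sub_self]
      · rw [Finsupp.single_eq_of_ne hij, sub_zero]
        by_contra hne
        have := h.lower i j hne hij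
        omega
    · by_cases hij : j = i
      · rwa [hij]
      · rw [Finsupp.single_eq_of_ne hij] at hj
        exact absurd rfl hj
  | succ n ih =>
    obtain ⟨g, h1, h2, h3, h4⟩ := ih
    by_cases hn : f i - (n + 1) = f i - n
    · exact ⟨g, by rwa [hn], h2, h3, h4⟩
    obtain ⟨m, hm⟩ : ∃ m, m = f i - (n + 1) := ⟨_, rfl⟩
    have hm' : f i - n = m + 1 := by omega
    rw [hm'] at h1
    rw [← hm]
    have hmi : m < f i := by omega
    set r := semilinearExt a g - g with hr
    have hrbar : semilinearExt a r = -r := by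
      rw [hr, map_sub, h.apply_apply]; abel
    have hg : ∀ j, g j ∈ laurent := by
      intro j
      obtain ⟨p, hp⟩ := h2 j
      have : g j = ε.q * evalAt ε.q p + Finsupp.single i 1 j := by
        rw [← hp, Finsupp.sub_apply, sub_add_cancel]
      rw [this]
      refine add_mem (mul_mem (sgn_mem_laurent ε) (evalAt_sgn_mem_laurent ε p)) ?_
      rw [Finsupp.single_apply]
      split_ifs
      · exact one_mem _
      · exact zero_mem _
    have hrl : ∀ j, r j ∈ laurent := fun j =>
      sub_mem (h.apply_mem_laurent hg j) (hg j)
    have hle : ∀ k, r k ≠ 0 → f k ≤ m := by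
      intro k hk
      by_contra hc
      exact hk (h1 k (by omega))
    have hex : ∀ j, ∃ p : Polynomial ℚ, f j = m →
        ε.q * evalAt ε.q p - qBar (ε.q * evalAt ε.q p) = r j := by
      intro j
      by_cases hj : f j = m
      · obtain ⟨p, hp⟩ := exists_sub_qBar ε (hrl j) (by
          rw [← h.apply_top (z := r) (j := j) (by rwa [hj]), hrbar, Finsupp.neg_apply])
        exact ⟨p, fun _ => hp⟩
      · exact ⟨0, fun hc => absurd hc hj⟩
    choose P hP using hex
    let t : X →₀ Kq := Finsupp.onFinset (r.support.filter fun j => f j = m)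
      (fun j => if j ∈ r.support.filter (fun j => f j = m) then ε.q * evalAt ε.q (P j) else 0)
      (fun j hj => by by_contra hc; exact hj (if_neg hc))
    have ht : ∀ j, t j = if j ∈ r.support.filter (fun j => f j = m) then ε.q * evalAt ε.q (P j)
      else 0 := fun j => rfl
    have htm : ∀ j, t j ≠ 0 → r j ≠ 0 ∧ f j = m := by
      intro j hj
      rw [ht] at hj
      have : j ∈ r.support.filter (fun j => f j = m) := by
        by_contra hc; exact hj (if_neg hc)
      simpa using this
    have hrC : ∀ C : X → Prop, (∀ k j, C k → a k j ≠ 0 → C j) → C i → ∀ j, r j ≠ 0 → C j := by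
      intro C hC hi j hj
      by_cases hgj : g j = 0
      · rw [hr, Finsupp.sub_apply, hgj, sub_zero, semilinearExt_apply, Finsupp.sum,
          Finsupp.finsetSum_apply] at hj
        obtain ⟨k, hk, hkj⟩ := Finset.exists_ne_zero_of_sum_ne_zero hj
        exact hC k j (h4 C hC hi k (Finsupp.mem_support_iff.mp hk))
          (fun h0 => hkj (by rw [Finsupp.smul_apply, h0, smul_zero]))
      · exact h4 C hC hi j hgj
    refine ⟨g + t, fun j hj => ?_, fun j => ?_, fun j hj => ?_, fun C hC hi j hj => ?_⟩
    · have e : semilinearExt a (g + t) - (g + t) = r + (semilinearExt a t - t) := by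
        rw [hr, map_add]; abel
      rw [e, Finsupp.add_apply, Finsupp.sub_apply _ t,
        h.apply_top (z := t) (j := j) fun k hk => (htm k hk).2.le.trans hj]
      by_cases hjm : f j = m ∧ r j ≠ 0
      · rw [ht, if_pos (by simpa using hjm.symm), ← hP j hjm.1]
        ring
      · have hr0 : r j = 0 := by
          by_contra hne
          exact hjm ⟨le_antisymm (hle j hne) hj, hne⟩
        have ht0 : t j = 0 := by
          by_contra hne
          exact (htm j hne).1 hr0
        rw [hr0, ht0, map_zero, sub_zero, add_zero]
    · obtain ⟨p, hp⟩ := h2 j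
      rw [add_sub_right_comm, Finsupp.add_apply, hp, ht]
      split_ifs
      · exact ⟨p + P j, by rw [map_add]; ring⟩
      · exact ⟨p, add_zero _⟩
    · rw [add_sub_right_comm, Finsupp.add_apply] at hj
      by_cases ht0 : t j = 0
      · rw [ht0, add_zero] at hj
        exact h3 j hj
      · rw [(htm j ht0).2]; exact hmi
    · by_cases ht0 : t j = 0
      · rw [Finsupp.add_apply, ht0, add_zero] at hj
        exact h4 C hC hi j hj
      · exact hrC C hC hi j (htm j ht0).1

theorem span_eq_top_of_lower {g : X → X →₀ Kq}
    (hg : ∀ i j, (g i - Finsupp.single i (1 : Kq) : X →₀ Kq) j ≠ 0 → f j < f i) :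
    ⊤ ≤ Submodule.span Kq (Set.range g) := by
  have key : ∀ n i, f i < n → Finsupp.single i (1 : Kq) ∈ Submodule.span Kq (Set.range g) := by
    intro n
    induction n with
    | zero => intro i hi; omega
    | succ n ih =>
      intro i hi
      have e : Finsupp.single i (1 : Kq) = g i - (g i - Finsupp.single i 1) := by abel
      rw [e]
      refine sub_mem (Submodule.subset_span ⟨i, rfl⟩) ?_
      rw [← Finsupp.sum_single (g i - Finsupp.single i 1)]
      refine sum_mem fun j hj => ?_
      rw [← mul_one ((g i - Finsupp.single i (1 : Kq) : X →₀ Kq) j), ← smul_eq_mul, ← Finsupp.smul_single]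
      refine Submodule.smul_mem _ _ (ih j ?_)
      have := hg i j (Finsupp.mem_support_iff.mp hj)
      omega
  intro z _
  rw [← Finsupp.sum_single z]
  refine sum_mem fun j hj => ?_
  rw [← mul_one (z j), ← smul_eq_mul, ← Finsupp.smul_single]
  exact Submodule.smul_mem _ _ (key _ j (Nat.lt_succ_self _))

theorem linearIndependent_of_lower {g : X → X →₀ Kq}
    (hg : ∀ i j, (g i - Finsupp.single i (1 : Kq) : X →₀ Kq) j ≠ 0 → f j < f i) :
    LinearIndependent Kq g := by
  rw [linearIndependent_iff]
  intro c hc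
  by_contra hne
  obtain ⟨j, hj, hmax⟩ := c.support.exists_max_image f (Finsupp.support_nonempty_iff.mpr hne)
  have hcj := DFunLike.congr_fun hc j
  have hgij : ∀ i, f i ≤ f j → g i j = Finsupp.single i 1 j := by
    intro i hi
    by_contra hc
    have := hg i j (by rw [Finsupp.sub_apply]; exact sub_ne_zero.mpr hc)
    omega
  rw [Finsupp.linearCombination_apply, Finsupp.sum, Finsupp.finsetSum_apply,
    Finset.sum_eq_single j, Finsupp.smul_apply, hgij j le_rfl, Finsupp.single_eq_same, smul_eq_mul,
    mul_one] at hcj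
  · exact Finsupp.mem_support_iff.mp hj hcj
  · intro i hi hij
    rw [Finsupp.smul_apply, hgij i (hmax i hi), Finsupp.single_eq_of_ne (Ne.symm hij), smul_zero]
  · intro h; exact absurd hj h

theorem existsUnique_basis (h : IsBarMatrix a f) (ε : Sgn) :
    ∃! G : Module.Basis X Kq (X →₀ Kq), ∀ i, semilinearExt a (G i) = G i ∧
      ∀ j, ∃ p, (G i - Finsupp.single i (1 : Kq) : X →₀ Kq) j = ε.q * evalAt ε.q p := by
  choose g h1 h2 h3 _ using h.exists_invariant ε
  refine ⟨Module.Basis.mk (linearIndependent_of_lower h3) (span_eq_top_of_lower h3), fun i => ?_,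
    fun G hG => ?_⟩
  · rw [Module.Basis.mk_apply]
    exact ⟨h1 i, h2 i⟩
  · apply Module.Basis.eq_of_apply_eq
    intro i
    rw [Module.Basis.mk_apply]
    refine h.eq_of_invariant ε (hG i).1 (h1 i) fun j => ?_
    obtain ⟨p, hp⟩ := (hG i).2 j
    obtain ⟨p', hp'⟩ := h2 i j
    refine ⟨p - p', ?_⟩
    rw [map_sub, mul_sub, ← hp, ← hp']
    simp only [Finsupp.sub_apply]
    ring

end IsBarMatrix

/-! ### Operators acting on some of the coordinates -/

/-- The operator on `⨁_x ℚ(q) e_x` that applies `F` to the coordinates `π x` of `x` and leaves the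
others alone; `u x p` is `x` with these coordinates replaced by `p`. -/
def localOp {X P : Type*} (u : X → P → X) (π : X → P) (F : P → P →₀ Kq) :
    Module.End Kq (X →₀ Kq) :=
  Finsupp.linearCombination Kq fun x => (F (π x)).mapDomain (u x)

theorem localOp_single {X P : Type*} (u : X → P → X) (π : X → P) (F : P → P →₀ Kq) (x : X) :
    localOp u π F (Finsupp.single x 1) = (F (π x)).mapDomain (u x) := by
  rw [localOp, Finsupp.linearCombination_single, one_smul]

theorem linearMap_ext_single {X M : Type*} [AddCommGroup M] [Module Kq M]
    {f g : (X →₀ Kq) →ₗ[Kq] M}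
    (h : ∀ x, f (Finsupp.single x 1) = g (Finsupp.single x 1)) : f = g :=
  Finsupp.lhom_ext' fun x => LinearMap.ext_ring (h x)

theorem localOp_mapDomain {X X' P : Type*} {u : X → P → X} {π : X → P} {u' : X' → P → X'}
    {π' : X' → P} (F : P → P →₀ Kq) (g : X' → X) (hπ : ∀ t, π (g t) = π' t)
    (hu : ∀ t p, u (g t) p = g (u' t p)) (z : X' →₀ Kq) :
    localOp u π F (z.mapDomain g) = (localOp u' π' F z).mapDomain g := by
  have : localOp u π F ∘ₗ Finsupp.lmapDomain Kq Kq g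
      = Finsupp.lmapDomain Kq Kq g ∘ₗ localOp u' π' F := by
    apply linearMap_ext_single
    intro t
    simp only [LinearMap.comp_apply, Finsupp.lmapDomain_apply, Finsupp.mapDomain_single,
      localOp_single, hπ, ← Finsupp.mapDomain_comp]
    congr 1
    funext p
    exact hu t p
  exact LinearMap.congr_fun this z

/-- Operators acting on disjoint sets of coordinates commute. -/
theorem localOp_commute {X P Q : Type*} {u : X → P → X} {π : X → P} {v : X → Q → X} {ρ : X → Q}
    (F : P → P →₀ Kq) (G : Q → Q →₀ Kq) (h1 : ∀ x p, π (v x p) = π x)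
    (h2 : ∀ x p, ρ (u x p) = ρ x) (h3 : ∀ x p p', u (v x p') p = v (u x p) p') :
    Commute (localOp u π F) (localOp v ρ G) := by
  apply linearMap_ext_single
  intro x
  simp only [Module.End.mul_apply, localOp_single]
  generalize hz : F (π x) = z
  generalize hw : G (ρ x) = w
  have e1 : ∀ w : Q →₀ Kq, localOp u π F (w.mapDomain (v x))
      = w.sum fun p b => b • z.mapDomain fun t => u (v x p) t := by
    intro w
    rw [Finsupp.mapDomain, Finsupp.sum, map_sum]
    refine Finset.sum_congr rfl fun p _ => ?_
    rw [← mul_one (w p), ← smul_eq_mul, ← Finsupp.smul_single, map_smul, localOp_single, h1, hz,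
      smul_eq_mul, mul_one]
  have e2 : ∀ z : P →₀ Kq, localOp v ρ G (z.mapDomain (u x))
      = z.sum fun p b => b • w.mapDomain fun t => v (u x p) t := by
    intro w
    rw [Finsupp.mapDomain, Finsupp.sum, map_sum]
    refine Finset.sum_congr rfl fun p _ => ?_
    rw [← mul_one (w p), ← smul_eq_mul, ← Finsupp.smul_single, map_smul, localOp_single, h2, hw,
      smul_eq_mul, mul_one]
  rw [e1, e2]
  simp only [Finsupp.mapDomain, Finsupp.sum, Finset.smul_sum]
  rw [Finset.sum_comm]
  refine Finset.sum_congr rfl fun p _ => Finset.sum_congr rfl fun p' _ => ?_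
  rw [h3, Finsupp.smul_single, Finsupp.smul_single, smul_eq_mul, smul_eq_mul, mul_comm]

/-- The coordinates `π` can be read off and replaced freely. -/
structure IsLens {X P : Type*} (u : X → P → X) (π : X → P) : Prop where
  get_set : ∀ x p, π (u x p) = p
  set_set : ∀ x p p', u (u x p) p' = u x p'
  set_get : ∀ x, u x (π x) = x

/-- `F` as an operator on `⨁_p ℚ(q) e_p`. -/
abbrev selfOp {P : Type*} (F : P → P →₀ Kq) : Module.End Kq (P →₀ Kq) :=
  localOp (fun _ p => p) id F

theorem IsLens.localOp_mapDomain {X P : Type*} {u : X → P → X} {π : X → P} (h : IsLens u π)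
    (F : P → P →₀ Kq) (x : X) (z : P →₀ Kq) :
    localOp u π F (z.mapDomain (u x)) = (selfOp F z).mapDomain (u x) :=
  FockSpace.localOp_mapDomain F (u x) (h.get_set x) (h.set_set x) z

theorem IsLens.single_eq {X P : Type*} {u : X → P → X} {π : X → P} (h : IsLens u π) (x : X) :
    Finsupp.single x (1 : Kq) = (Finsupp.single (π x) 1).mapDomain (u x) := by
  rw [Finsupp.mapDomain_single, h.set_get]

/-- `q - q⁻¹`. -/
def hq : Kq := q - q⁻¹

theorem IsLens.localOp_sq {X P : Type*} {u : X → P → X} {π : X → P} (h : IsLens u π)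
    {F : P → P →₀ Kq} (hF : selfOp F * selfOp F = hq • selfOp F + 1) :
    localOp u π F * localOp u π F = hq • localOp u π F + 1 := by
  apply linearMap_ext_single
  intro x
  rw [h.single_eq x]
  simp only [Module.End.mul_apply, LinearMap.add_apply, LinearMap.smul_apply, Module.End.one_apply,
    h.localOp_mapDomain]
  rw [← Module.End.mul_apply, hF]
  simp only [LinearMap.add_apply, LinearMap.smul_apply, Module.End.one_apply,
    Finsupp.mapDomain_add, Finsupp.mapDomain_smul]

/-! ### The braid relation on three sites -/

/-- `F` acting on the first two of three sites. -/
abbrev op12 {α : Type*} (F : α × α → α × α →₀ Kq) :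
    Module.End Kq (α × α × α →₀ Kq) :=
  localOp (fun t p => (p.1, p.2, t.2.2)) (fun t => (t.1, t.2.1)) F

/-- `F` acting on the last two of three sites. -/
abbrev op23 {α : Type*} (F : α × α → α × α →₀ Kq) :
    Module.End Kq (α × α × α →₀ Kq) :=
  localOp (fun t p => (t.1, p)) (fun t => t.2) F

/-- The braid relation for an operator on two sites. -/
def IsBraided {α : Type*} (F : α × α → α × α →₀ Kq) : Prop :=
  op12 F * op23 F * op12 F = op23 F * op12 F * op23 F

/-- The braid relation on three sites implies the one for any three coordinates. -/
theorem IsBraided.localOp {X α : Type*} {F : α × α → α × α →₀ Kq} (hF : IsBraided F)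
    {u v : X → α × α → X} {π ρ : X → α × α} {w : X → α × α × α → X} {σ : X → α × α × α}
    (hw : ∀ x, w x (σ x) = x)
    (h1 : ∀ x t, π (w x t) = (t.1, t.2.1)) (h2 : ∀ x t, ρ (w x t) = t.2)
    (h3 : ∀ x t p, u (w x t) p = w x (p.1, p.2, t.2.2))
    (h4 : ∀ x t p, v (w x t) p = w x (t.1, p)) :
    localOp u π F * localOp v ρ F * localOp u π F
      = localOp v ρ F * localOp u π F * localOp v ρ F := by
  apply linearMap_ext_single
  intro x
  have e : Finsupp.single x (1 : Kq) = (Finsupp.single (σ x) 1).mapDomain (w x) := by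
    rw [Finsupp.mapDomain_single, hw]
  have e1 : ∀ z, FockSpace.localOp u π F (z.mapDomain (w x)) = (op12 F z).mapDomain (w x) := fun z =>
    FockSpace.localOp_mapDomain F (w x) (h1 x) (h3 x) z
  have e2 : ∀ z, FockSpace.localOp v ρ F (z.mapDomain (w x)) = (op23 F z).mapDomain (w x) := fun z =>
    FockSpace.localOp_mapDomain F (w x) (h2 x) (h4 x) z
  rw [e]
  simp only [Module.End.mul_apply, e1, e2]
  simp only [← Module.End.mul_apply]
  rw [← mul_assoc, ← mul_assoc, hF]

/-! ### The action of the Hecke algebra on tensor powers of a vector space with ordered basis -/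

/-- Jimbo's operator on two sites, with eigenvalue `t` on `e_a ⊗ e_a`. -/
def jimbo (t : Kq) (p : ℤ × ℤ) : ℤ × ℤ →₀ Kq :=
  (if p.1 = p.2 then t else 1 : Kq) • Finsupp.single (p.2, p.1) 1 +
    (if p.1 < p.2 then hq else 0 : Kq) • Finsupp.single p 1

theorem jimbo_self (t : Kq) (a : ℤ) : jimbo t (a, a) = t • Finsupp.single (a, a) 1 := by
  simp [jimbo]

theorem jimbo_lt (t : Kq) {a b : ℤ} (h : a < b) :
    jimbo t (a, b) = Finsupp.single (b, a) 1 + hq • Finsupp.single (a, b) 1 := by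
  rw [jimbo, if_neg (by simpa using h.ne), if_pos (by simpa using h), one_smul]

theorem jimbo_gt (t : Kq) {a b : ℤ} (h : b < a) :
    jimbo t (a, b) = Finsupp.single (b, a) 1 := by
  rw [jimbo, if_neg (by simpa using h.ne'), if_neg (by simpa using h.le), one_smul, zero_smul,
    add_zero]

theorem jimbo_sq {t : Kq} (ht : t * t = hq * t + 1) :
    selfOp (jimbo t) * selfOp (jimbo t) = hq • selfOp (jimbo t) + 1 := by
  apply linearMap_ext_single
  rintro ⟨a, b⟩
  have hid : (fun p : ℤ × ℤ => p) = id := rfl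
  simp only [Module.End.mul_apply, LinearMap.add_apply, LinearMap.smul_apply, Module.End.one_apply,
    localOp_single, id, hid, Finsupp.mapDomain_id]
  ext x
  rcases lt_trichotomy a b with h | rfl | h
  · simp only [jimbo_lt _ h, jimbo_gt _ h, map_add, map_smul, localOp_single, id, hid,
      Finsupp.mapDomain_id, Finsupp.add_apply, Finsupp.smul_apply, smul_eq_mul]
    ring
  · simp only [jimbo_self, map_smul, localOp_single, id, hid, Finsupp.mapDomain_id,
      Finsupp.add_apply, Finsupp.smul_apply, smul_eq_mul]
    linear_combination Finsupp.single (a, a) (1 : Kq) x * ht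
  · simp only [jimbo_lt _ h, jimbo_gt _ h, localOp_single, id, hid,
      Finsupp.mapDomain_id, Finsupp.add_apply, Finsupp.smul_apply, smul_eq_mul]
    ring

theorem isBraided_jimbo {t : Kq} (ht : t * t = hq * t + 1) : IsBraided (jimbo t) := by
  apply linearMap_ext_single
  rintro ⟨a, b, c⟩
  simp only [Module.End.mul_apply, localOp_single]
  ext x
  obtain h | h | h := lt_trichotomy a b <;> obtain h' | h' | h' := lt_trichotomy b c <;>
    obtain h'' | h'' | h'' := lt_trichotomy a c <;>
    first
    | (exfalso; omega)
    | subst_vars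
      simp only [jimbo_self, *, jimbo_lt, jimbo_gt, map_add, map_smul, localOp_single,
        Finsupp.mapDomain_add, Finsupp.mapDomain_smul, Finsupp.mapDomain_single, smul_add,
        Finsupp.add_apply, Finsupp.smul_apply, smul_eq_mul]
      all_goals first
      | ring1
      | linear_combination hq * Finsupp.single (b, b, c) (1 : Kq) x * ht
      | linear_combination -hq * Finsupp.single (a, c, c) (1 : Kq) x * ht

/-! ### The affine Hecke algebra: Demazure–Lusztig operators -/

/-- The sum of `g i` over `p < i ≤ m`, counted negatively if `m < p`. -/
def signedSum {M : Type*} [AddCommGroup M] (g : ℤ → M) (p m : ℤ) : M :=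
  ∑ i ∈ Finset.Ioc p m, g i - ∑ i ∈ Finset.Ioc m p, g i

section signedSum

variable {M N : Type*} [AddCommGroup M] [AddCommGroup N]

theorem signedSum_self (g : ℤ → M) (p : ℤ) : signedSum g p p = 0 := sub_self _

theorem signedSum_neg (g : ℤ → M) (p m : ℤ) : signedSum g p m = -signedSum g m p :=
  (neg_sub _ _).symm

theorem signedSum_succ (g : ℤ → M) (p m : ℤ) :
    signedSum g p (m + 1) = signedSum g p m + g (m + 1) := by
  unfold signedSum
  rcases le_or_gt p m with h | h
  · have e1 : Finset.Ioc p (m + 1) = insert (m + 1) (Finset.Ioc p m) := by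
      ext i; simp only [Finset.mem_Ioc, Finset.mem_insert]; omega
    rw [e1, Finset.sum_insert (by simp), Finset.Ioc_eq_empty (by omega : ¬ m + 1 < p),
      Finset.Ioc_eq_empty (by omega : ¬ m < p)]
    simp only [Finset.sum_empty]
    abel
  · have e1 : Finset.Ioc m p = insert (m + 1) (Finset.Ioc (m + 1) p) := by
      ext i; simp only [Finset.mem_Ioc, Finset.mem_insert]; omega
    rw [e1, Finset.sum_insert (by simp), Finset.Ioc_eq_empty (by omega : ¬ p < m + 1),
      Finset.Ioc_eq_empty (by omega : ¬ p < m)]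
    simp only [Finset.sum_empty]
    abel

theorem signedSum_eq_sub {g : ℤ → M} {F : ℤ → M} (h : ∀ m, F (m + 1) = F m + g (m + 1))
    (p m : ℤ) : signedSum g p m = F m - F p := by
  induction m using Int.inductionOn' (b := p) with
  | zero => rw [signedSum_self, sub_self]
  | succ k _ ih => rw [signedSum_succ, ih, h]; abel
  | pred k _ ih =>
    have h1 := signedSum_succ g p (k - 1)
    have h2 := h (k - 1)
    rw [sub_add_cancel] at h1 h2
    rw [ih, h2] at h1
    rw [← sub_eq_iff_eq_add.mpr h1]
    abel

theorem signedSum_succ_left (g : ℤ → M) (p m : ℤ) :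
    signedSum g (p + 1) m = signedSum g p m - g (p + 1) := by
  rw [signedSum_neg, signedSum_succ, signedSum_neg g m p]; abel

theorem signedSum_shift (g : ℤ → M) (p m : ℤ) :
    signedSum (fun i => g (i + 1)) p m = signedSum g (p + 1) (m + 1) := by
  rw [signedSum_eq_sub (g := g) (F := fun m => signedSum g 0 m) (fun m => signedSum_succ g 0 m)]
  exact signedSum_eq_sub (F := fun m => signedSum g 0 (m + 1))
    (fun m => signedSum_succ g 0 (m + 1)) p m

/-- The substitution `i ↦ c - i`. -/
theorem signedSum_reflect (g : ℤ → M) (c p m : ℤ) :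
    signedSum (fun i => g (c - i)) p m = signedSum g (c - m - 1) (c - p - 1) := by
  rw [signedSum_eq_sub (g := g) (F := fun m => signedSum g 0 m) (fun m => signedSum_succ g 0 m),
    signedSum_eq_sub (F := fun m => -signedSum g 0 (c - m - 1))]
  · abel
  · intro m
    have := signedSum_succ g 0 (c - (m + 1) - 1)
    rw [show c - (m + 1) - 1 + 1 = c - m - 1 by ring] at this
    rw [this, show c - (m + 1) = c - m - 1 by ring]
    abel

theorem map_signedSum {F : Type*} [FunLike F M N] [AddMonoidHomClass F M N] (f : F) (g : ℤ → M)
    (p m : ℤ) : f (signedSum g p m) = signedSum (fun i => f (g i)) p m := by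
  simp only [signedSum, map_sub, map_sum]

theorem mapDomain_signedSum {X Y : Type*} (f : X → Y) (g : ℤ → X →₀ Kq) (p m : ℤ) :
    Finsupp.mapDomain f (signedSum g p m) = signedSum (fun i => Finsupp.mapDomain f (g i)) p m :=
  map_signedSum (Finsupp.mapDomain.addMonoidHom f) g p m

end signedSum

/-- The action of the Hecke algebra generator on `V[z^±]^{⊗ 2}`, where `V` has the basis `e_c` and
`(c, m)` stands for `e_c z^m`. -/
def demazureLusztig (t : (ℤ × ℤ) × (ℤ × ℤ)) : (ℤ × ℤ) × (ℤ × ℤ) →₀ Kq :=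
  (if t.1.1 = t.2.1 then q else 1 : Kq) • Finsupp.single (t.2, t.1) 1 +
    (if t.1.1 < t.2.1 then hq else 0 : Kq) •
      Finsupp.single ((t.1.1, t.2.2), (t.2.1, t.1.2)) 1 +
    hq • signedSum (fun i => Finsupp.single ((t.1.1, i), (t.2.1, t.1.2 + t.2.2 - i)) (1 : Kq))
      t.2.2 t.1.2

theorem q_sq : q * q = hq * q + 1 := by
  have := q_ne_zero
  rw [hq]; field_simp; ring

theorem neg_qInv_sq : -q⁻¹ * -q⁻¹ = hq * -q⁻¹ + 1 := by
  have := q_ne_zero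
  rw [hq]; field_simp; ring

/-- Multiplication of one factor `(c, m)` by `z`. -/
def shift (x : ℤ × ℤ) : ℤ × ℤ := (x.1, x.2 + 1)

theorem shift_injective : Function.Injective shift := by
  rintro ⟨a, b⟩ ⟨c, d⟩ h
  simp only [shift, Prod.mk.injEq] at h
  exact Prod.ext h.1 (by simpa using h.2)

/-- Multiplication by `z` in the first of two factors. -/
abbrev zMul₁ : Module.End Kq ((ℤ × ℤ) × (ℤ × ℤ) →₀ Kq) :=
  Finsupp.lmapDomain Kq Kq fun t => (shift t.1, t.2)

/-- Multiplication by `z` in the second of two factors. -/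
abbrev zMul₂ : Module.End Kq ((ℤ × ℤ) × (ℤ × ℤ) →₀ Kq) :=
  Finsupp.lmapDomain Kq Kq fun t => (t.1, shift t.2)

theorem selfOp_single {P : Type*} (F : P → P →₀ Kq) (p : P) :
    selfOp F (Finsupp.single p 1) = F p := by
  rw [localOp_single]
  exact Finsupp.mapDomain_id

/-- The Bernstein relation for the first factor. -/
theorem demazureLusztig_zMul₁ :
    selfOp demazureLusztig * zMul₁ = zMul₂ * selfOp demazureLusztig + hq • zMul₁ := by
  apply linearMap_ext_single
  rintro ⟨⟨a, m⟩, ⟨b, p⟩⟩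
  simp only [Module.End.mul_apply, LinearMap.add_apply, LinearMap.smul_apply,
    Finsupp.lmapDomain_apply, Finsupp.mapDomain_single, selfOp_single, demazureLusztig,
    shift, Finsupp.mapDomain_add, Finsupp.mapDomain_smul, mapDomain_signedSum, signedSum_succ,
    smul_add]
  have e : ∀ i, m + 1 + p - i = m + p - i + 1 := fun i => by ring
  simp only [e, show m + p - (m + 1) + 1 = p by ring]
  abel

/-- The Bernstein relation for the second factor. -/
theorem demazureLusztig_zMul₂ :
    selfOp demazureLusztig * zMul₂ = zMul₁ * selfOp demazureLusztig - hq • zMul₁ := by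
  apply linearMap_ext_single
  rintro ⟨⟨a, m⟩, ⟨b, p⟩⟩
  simp only [Module.End.mul_apply, LinearMap.sub_apply, LinearMap.smul_apply,
    Finsupp.lmapDomain_apply, Finsupp.mapDomain_single, selfOp_single, demazureLusztig,
    shift, Finsupp.mapDomain_add, Finsupp.mapDomain_smul, mapDomain_signedSum]
  have e : ∀ i, (Finsupp.single ((a, i + 1), (b, m + p - i)) (1 : Kq))
      = (fun i => Finsupp.single ((a, i), (b, m + (p + 1) - i)) 1) (i + 1) := fun i => by
    simp only [show m + (p + 1) - (i + 1) = m + p - i by ring]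
  simp only [e]
  rw [signedSum_shift (fun i => Finsupp.single ((a, i), (b, m + (p + 1) - i)) (1 : Kq)) p m,
    signedSum_succ]
  simp only [smul_add, show m + (p + 1) - (m + 1) = p by ring]
  abel

/-- Operators commuting past invertible shifts are determined by their values on the shift-free
basis vectors. -/
theorem eq_zero_of_shift {X : Type*} {M : Type*} [AddCommGroup M] [Module Kq M]
    (D : (X →₀ Kq) →ₗ[Kq] M) (σ : X → X)
    (h : ∀ z, D (Finsupp.mapDomain σ z) = 0 ↔ D z = 0) (φ : ℤ → X) (hφ : ∀ m, φ (m + 1) = σ (φ m))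
    (h0 : D (Finsupp.single (φ 0) 1) = 0) (m : ℤ) : D (Finsupp.single (φ m) 1) = 0 := by
  have step : ∀ m, D (Finsupp.single (φ (m + 1)) 1) = 0 ↔ D (Finsupp.single (φ m) 1) = 0 := by
    intro m
    rw [hφ, ← Finsupp.mapDomain_single, h]
  induction m using Int.induction_on with
  | zero => exact h0
  | succ i ih => exact (step _).mpr ih
  | pred i ih =>
    rw [← sub_add_cancel (-(i : ℤ)) 1] at ih
    exact (step _).mp ih

theorem lmapDomain_eq_zero_iff {X : Type*} {σ : X → X} (hσ : Function.Injective σ) (z : X →₀ Kq) :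
    Finsupp.lmapDomain Kq Kq σ z = 0 ↔ z = 0 :=
  map_eq_zero_iff _ (Finsupp.mapDomain_injective hσ)

theorem demazureLusztig_zero (a b : ℤ) :
    demazureLusztig ((a, 0), (b, 0)) = (jimbo q (a, b)).mapDomain fun p => ((p.1, 0), (p.2, 0)) := by
  simp only [demazureLusztig, jimbo, signedSum_self, smul_zero, add_zero, Finsupp.mapDomain_add,
    Finsupp.mapDomain_smul, Finsupp.mapDomain_single]

/-- By the Bernstein relations, the defect of the quadratic relation commutes with the shifts. -/
theorem hecke_shift_sq {k R : Type*} [CommRing k] [Ring R] [Algebra k R] {h : k} {A X Y : R}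
    (a1 : A * X = Y * A + h • X) (a2 : A * Y = X * A - h • X) :
    (A * A - (h • A + 1)) * X = X * (A * A - (h • A + 1)) ∧
      (A * A - (h • A + 1)) * Y = Y * (A * A - (h • A + 1)) := by
  have a1' : ∀ Z, A * (X * Z) = Y * (A * Z) + h • (X * Z) := fun Z => by
    rw [← mul_assoc, a1, add_mul, mul_assoc, smul_mul_assoc]
  have a2' : ∀ Z, A * (Y * Z) = X * (A * Z) - h • (X * Z) := fun Z => by
    rw [← mul_assoc, a2, sub_mul, mul_assoc, smul_mul_assoc]
  constructor <;>
  · simp only [mul_assoc, sub_mul, mul_sub, add_mul, mul_add, smul_mul_assoc, mul_smul_comm, a1, a2,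
      a1', a2', one_mul, mul_one]
    module

/-- The defect of the quadratic relation commutes with the shifts, so that it can be computed on the
`e_a ⊗ e_b`, where the operator is Jimbo's. -/
theorem demazureLusztig_sq : selfOp demazureLusztig * selfOp demazureLusztig
    = hq • selfOp demazureLusztig + 1 := by
  obtain ⟨h1, h2⟩ :=
    hecke_shift_sq (k := Kq) (R := Module.End Kq ((ℤ × ℤ) × (ℤ × ℤ) →₀ Kq)) demazureLusztig_zMul₁ demazureLusztig_zMul₂
  rw [← sub_eq_zero]
  set D := selfOp demazureLusztig * selfOp demazureLusztig - (hq • selfOp demazureLusztig + 1)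
    with hD
  have i1 : Function.Injective fun t : (ℤ × ℤ) × (ℤ × ℤ) => (shift t.1, t.2) :=
    Function.Injective.prodMap shift_injective Function.injective_id
  have i2 : Function.Injective fun t : (ℤ × ℤ) × (ℤ × ℤ) => (t.1, shift t.2) :=
    Function.Injective.prodMap Function.injective_id shift_injective
  apply linearMap_ext_single
  rintro ⟨⟨a, m⟩, ⟨b, p⟩⟩
  rw [LinearMap.zero_apply]
  refine eq_zero_of_shift D (fun t => (shift t.1, t.2)) (fun z => ?_) (fun m => ((a, m), (b, p)))
    (fun m => rfl) ?_ m
  · have := LinearMap.congr_fun h1 z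
    simp only [Module.End.mul_apply] at this
    rw [← Finsupp.lmapDomain_apply (M := Kq) (R := Kq), this, lmapDomain_eq_zero_iff i1]
  refine eq_zero_of_shift D (fun t => (t.1, shift t.2)) (fun z => ?_) (fun m => ((a, 0), (b, m)))
    (fun m => rfl) ?_ p
  · have := LinearMap.congr_fun h2 z
    simp only [Module.End.mul_apply] at this
    rw [← Finsupp.lmapDomain_apply (M := Kq) (R := Kq), this, lmapDomain_eq_zero_iff i2]
  have e : ∀ z : ℤ × ℤ →₀ Kq, selfOp demazureLusztig (z.mapDomain fun p => ((p.1, 0), (p.2, 0)))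
      = (selfOp (jimbo q) z).mapDomain fun p => ((p.1, 0), (p.2, 0)) := by
    intro z
    have : selfOp demazureLusztig ∘ₗ Finsupp.lmapDomain Kq Kq (fun p => ((p.1, 0), (p.2, 0)))
        = Finsupp.lmapDomain Kq Kq (fun p => ((p.1, 0), (p.2, 0))) ∘ₗ selfOp (jimbo q) := by
      apply linearMap_ext_single
      rintro ⟨a, b⟩
      simp only [LinearMap.comp_apply, Finsupp.lmapDomain_apply, Finsupp.mapDomain_single,
        selfOp_single, demazureLusztig_zero]
    exact LinearMap.congr_fun this z
  have e0 : Finsupp.single ((a, (0 : ℤ)), (b, (0 : ℤ))) (1 : Kq)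
      = (Finsupp.single (a, b) 1).mapDomain fun p => ((p.1, 0), (p.2, 0)) := by
    rw [Finsupp.mapDomain_single]
  have hj := LinearMap.congr_fun (jimbo_sq q_sq) (Finsupp.single (a, b) 1)
  simp only [Module.End.mul_apply, LinearMap.add_apply, LinearMap.smul_apply,
    Module.End.one_apply] at hj
  rw [hD, LinearMap.sub_apply, LinearMap.add_apply, Module.End.mul_apply, LinearMap.smul_apply,
    Module.End.one_apply, e0, e, e, hj, Finsupp.mapDomain_add, Finsupp.mapDomain_smul]
  abel

/-- By the Bernstein relations, the defect of the braid relation intertwines the shifts. -/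
theorem hecke_shift_braid {k R : Type*} [CommRing k] [Ring R] [Algebra k R] {h : k}
    {A B X Y Z : R} (ha : A * A = h • A + 1) (hb : B * B = h • B + 1)
    (a1 : A * X = Y * A + h • X) (a2 : A * Y = X * A - h • X) (a3 : A * Z = Z * A)
    (b1 : B * X = X * B) (b2 : B * Y = Z * B + h • Y) (b3 : B * Z = Y * B - h • Y) :
    (A * B * A - B * A * B) * X = Z * (A * B * A - B * A * B) ∧
      (A * B * A - B * A * B) * Y = Y * (A * B * A - B * A * B) ∧
      (A * B * A - B * A * B) * Z = X * (A * B * A - B * A * B) := by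
  have assoc2 : ∀ {P Q S : R}, P * Q = S → ∀ W, P * (Q * W) = S * W := fun h W => by
    rw [← mul_assoc, h]
  have a1' := assoc2 a1
  have a2' := assoc2 a2
  have a3' := assoc2 a3
  have b1' := assoc2 b1
  have b2' := assoc2 b2
  have b3' := assoc2 b3
  refine ⟨?_, ?_, ?_⟩ <;>
  · simp only [mul_assoc, sub_mul, mul_sub, add_mul, mul_add, smul_mul_assoc, mul_smul_comm,
      a1, a2, a3, b1, b2, b3, a1', a2', a3', b1', b2', b3', ha, hb, mul_one]
    module

theorem isBraided_demazureLusztig : IsBraided demazureLusztig := by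
  set X₁ : Module.End Kq ((ℤ × ℤ) × (ℤ × ℤ) × (ℤ × ℤ) →₀ Kq) :=
    Finsupp.lmapDomain Kq Kq (fun t => (shift t.1, t.2)) with hX₁
  set X₂ : Module.End Kq ((ℤ × ℤ) × (ℤ × ℤ) × (ℤ × ℤ) →₀ Kq) :=
    Finsupp.lmapDomain Kq Kq (fun t => (t.1, shift t.2.1, t.2.2)) with hX₂
  set X₃ : Module.End Kq ((ℤ × ℤ) × (ℤ × ℤ) × (ℤ × ℤ) →₀ Kq) :=
    Finsupp.lmapDomain Kq Kq (fun t => (t.1, t.2.1, shift t.2.2)) with hX₃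
  set F := selfOp demazureLusztig
  have l12 : IsLens (fun (t : (ℤ × ℤ) × (ℤ × ℤ) × (ℤ × ℤ)) p => (p.1, p.2, t.2.2))
      (fun t => (t.1, t.2.1)) := ⟨fun _ _ => rfl, fun _ _ _ => rfl, fun _ => rfl⟩
  have l23 : IsLens (fun (t : (ℤ × ℤ) × (ℤ × ℤ) × (ℤ × ℤ)) p => (t.1, p))
      (fun t => t.2) := ⟨fun _ _ => rfl, fun _ _ _ => rfl, fun _ => rfl⟩
  have k12 := fun z => l12.localOp_mapDomain demazureLusztig z
  have k23 := fun z => l23.localOp_mapDomain demazureLusztig z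
  have f1 := fun z => LinearMap.congr_fun demazureLusztig_zMul₁ z
  have f2 := fun z => LinearMap.congr_fun demazureLusztig_zMul₂ z
  simp only [Module.End.mul_apply, LinearMap.add_apply, LinearMap.sub_apply, LinearMap.smul_apply,
    Finsupp.lmapDomain_apply] at f1 f2
  have a1 : op12 demazureLusztig * X₁ = X₂ * op12 demazureLusztig + hq • X₁ := by
    apply linearMap_ext_single
    intro t
    rw [l12.single_eq t]
    simp only [Module.End.mul_apply, LinearMap.add_apply, LinearMap.smul_apply, hX₁, hX₂,
      Finsupp.lmapDomain_apply, k12, ← Finsupp.mapDomain_comp]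
    have := congrArg (Finsupp.mapDomain fun p => (p.1, p.2, t.2.2)) (f1 (Finsupp.single (t.1, t.2.1) 1))
    rw [← k12 t, ← Finsupp.mapDomain_comp, Finsupp.mapDomain_add, Finsupp.mapDomain_smul,
      ← Finsupp.mapDomain_comp, ← Finsupp.mapDomain_comp] at this
    exact this
  have a2 : op12 demazureLusztig * X₂ = X₁ * op12 demazureLusztig - hq • X₁ := by
    apply linearMap_ext_single
    intro t
    rw [l12.single_eq t]
    simp only [Module.End.mul_apply, LinearMap.sub_apply, LinearMap.smul_apply, hX₁, hX₂,
      Finsupp.lmapDomain_apply, k12, ← Finsupp.mapDomain_comp]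
    have := congrArg (Finsupp.lmapDomain Kq Kq fun p => (p.1, p.2, t.2.2)) (f2 (Finsupp.single (t.1, t.2.1) 1))
    rw [map_sub, map_smul] at this
    simp only [Finsupp.lmapDomain_apply] at this
    rw [← k12 t, ← Finsupp.mapDomain_comp, 
      ← Finsupp.mapDomain_comp, ← Finsupp.mapDomain_comp] at this
    exact this
  have b2 : op23 demazureLusztig * X₂ = X₃ * op23 demazureLusztig + hq • X₂ := by
    apply linearMap_ext_single
    intro t
    rw [l23.single_eq t]
    simp only [Module.End.mul_apply, LinearMap.add_apply, LinearMap.smul_apply, hX₃, hX₂,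
      Finsupp.lmapDomain_apply, k23, ← Finsupp.mapDomain_comp]
    have := congrArg (Finsupp.mapDomain fun p => (t.1, p)) (f1 (Finsupp.single t.2 1))
    rw [← k23 t, ← Finsupp.mapDomain_comp, Finsupp.mapDomain_add, Finsupp.mapDomain_smul,
      ← Finsupp.mapDomain_comp, ← Finsupp.mapDomain_comp] at this
    exact this
  have b3 : op23 demazureLusztig * X₃ = X₂ * op23 demazureLusztig - hq • X₂ := by
    apply linearMap_ext_single
    intro t
    rw [l23.single_eq t]
    simp only [Module.End.mul_apply, LinearMap.sub_apply, LinearMap.smul_apply, hX₃, hX₂,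
      Finsupp.lmapDomain_apply, k23, ← Finsupp.mapDomain_comp]
    have := congrArg (Finsupp.lmapDomain Kq Kq fun p => (t.1, p)) (f2 (Finsupp.single t.2 1))
    rw [map_sub, map_smul] at this
    simp only [Finsupp.lmapDomain_apply] at this
    rw [← k23 t, ← Finsupp.mapDomain_comp,
      ← Finsupp.mapDomain_comp, ← Finsupp.mapDomain_comp] at this
    exact this
  have a3 : op12 demazureLusztig * X₃ = X₃ * op12 demazureLusztig :=
    LinearMap.ext fun z => localOp_mapDomain demazureLusztig _ (fun _ => rfl) (fun _ _ => rfl) z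
  have b1 : op23 demazureLusztig * X₁ = X₁ * op23 demazureLusztig :=
    LinearMap.ext fun z => localOp_mapDomain demazureLusztig _ (fun _ => rfl) (fun _ _ => rfl) z
  obtain ⟨d1, d2, d3⟩ :=
    hecke_shift_braid (k := Kq) (R := Module.End Kq ((ℤ × ℤ) × (ℤ × ℤ) × (ℤ × ℤ) →₀ Kq)) (l12.localOp_sq demazureLusztig_sq)
    (l23.localOp_sq demazureLusztig_sq) a1 a2 a3 b1 b2 b3
  rw [IsBraided, ← sub_eq_zero]
  set D := op12 demazureLusztig * op23 demazureLusztig * op12 demazureLusztig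
    - op23 demazureLusztig * op12 demazureLusztig * op23 demazureLusztig with hD
  have i1 : Function.Injective fun t : (ℤ × ℤ) × (ℤ × ℤ) × (ℤ × ℤ) => (shift t.1, t.2) :=
    Function.Injective.prodMap shift_injective Function.injective_id
  have i2 : Function.Injective fun t : (ℤ × ℤ) × (ℤ × ℤ) × (ℤ × ℤ) => (t.1, shift t.2.1, t.2.2) :=
    Function.Injective.prodMap Function.injective_id
      (Function.Injective.prodMap shift_injective Function.injective_id)
  have i3 : Function.Injective fun t : (ℤ × ℤ) × (ℤ × ℤ) × (ℤ × ℤ) => (t.1, t.2.1, shift t.2.2) :=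
    Function.Injective.prodMap Function.injective_id
      (Function.Injective.prodMap Function.injective_id shift_injective)
  apply linearMap_ext_single
  rintro ⟨⟨a, m⟩, ⟨b, p⟩, ⟨c, r⟩⟩
  rw [LinearMap.zero_apply]
  refine eq_zero_of_shift D (fun t => (shift t.1, t.2)) (fun z => ?_)
    (fun m => ((a, m), (b, p), (c, r))) (fun m => rfl) ?_ m
  · have := LinearMap.congr_fun d1 z
    simp only [Module.End.mul_apply] at this
    rw [← Finsupp.lmapDomain_apply (M := Kq) (R := Kq), this, lmapDomain_eq_zero_iff i3]
  refine eq_zero_of_shift D (fun t => (t.1, shift t.2.1, t.2.2)) (fun z => ?_)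
    (fun m => ((a, 0), (b, m), (c, r))) (fun m => rfl) ?_ p
  · have := LinearMap.congr_fun d2 z
    simp only [Module.End.mul_apply] at this
    rw [← Finsupp.lmapDomain_apply (M := Kq) (R := Kq), this, lmapDomain_eq_zero_iff i2]
  refine eq_zero_of_shift D (fun t => (t.1, t.2.1, shift t.2.2)) (fun z => ?_)
    (fun m => ((a, 0), (b, 0), (c, m))) (fun m => rfl) ?_ r
  · have := LinearMap.congr_fun d3 z
    simp only [Module.End.mul_apply] at this
    rw [← Finsupp.lmapDomain_apply (M := Kq) (R := Kq), this, lmapDomain_eq_zero_iff i1]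
  let ι : ℤ × ℤ × ℤ → (ℤ × ℤ) × (ℤ × ℤ) × (ℤ × ℤ) := fun t => ((t.1, 0), (t.2.1, 0), (t.2.2, 0))
  have e12 : ∀ z, op12 demazureLusztig (z.mapDomain ι) = (op12 (jimbo q) z).mapDomain ι := by
    intro z
    have : op12 demazureLusztig ∘ₗ Finsupp.lmapDomain Kq Kq ι
        = Finsupp.lmapDomain Kq Kq ι ∘ₗ op12 (jimbo q) := by
      apply linearMap_ext_single
      rintro ⟨a, b, c⟩
      simp only [LinearMap.comp_apply, Finsupp.lmapDomain_apply, Finsupp.mapDomain_single,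
        localOp_single, ι, demazureLusztig_zero, ← Finsupp.mapDomain_comp]
      rfl
    exact LinearMap.congr_fun this z
  have e23 : ∀ z, op23 demazureLusztig (z.mapDomain ι) = (op23 (jimbo q) z).mapDomain ι := by
    intro z
    have : op23 demazureLusztig ∘ₗ Finsupp.lmapDomain Kq Kq ι
        = Finsupp.lmapDomain Kq Kq ι ∘ₗ op23 (jimbo q) := by
      apply linearMap_ext_single
      rintro ⟨a, b, c⟩
      simp only [LinearMap.comp_apply, Finsupp.lmapDomain_apply, Finsupp.mapDomain_single,
        localOp_single, ι, demazureLusztig_zero, ← Finsupp.mapDomain_comp]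
      rfl
    exact LinearMap.congr_fun this z
  have e0 : Finsupp.single ((a, (0 : ℤ)), (b, (0 : ℤ)), (c, (0 : ℤ))) (1 : Kq)
      = (Finsupp.single (a, b, c) 1).mapDomain ι := by
    rw [Finsupp.mapDomain_single]
  have hj := LinearMap.congr_fun (isBraided_jimbo q_sq) (Finsupp.single (a, b, c) 1)
  simp only [Module.End.mul_apply] at hj
  rw [hD, LinearMap.sub_apply]
  simp only [Module.End.mul_apply]
  rw [e0]
  simp only [e12, e23]
  rw [hj, sub_self]

theorem linearMap_apply_eq_sum {X M : Type*} [AddCommGroup M] [Module Kq M]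
    (f : (X →₀ Kq) →ₗ[Kq] M) (z : X →₀ Kq) :
    f z = z.sum fun x c => c • f (Finsupp.single x 1) := by
  conv_lhs => rw [← Finsupp.sum_single z, Finsupp.sum, map_sum]
  refine Finset.sum_congr rfl fun x _ => ?_
  change f _ = z x • f _
  rw [← map_smul, Finsupp.smul_single, smul_eq_mul, mul_one]

/-! ### Two commuting Hecke actions on sequences -/

/-- Replace the entries number `i`, `i + 1`. -/
def setTwo {α : Type*} (x : ℕ → α) (i : ℕ) (p : α × α) : ℕ → α :=
  fun j => if j = i then p.1 else if j = i + 1 then p.2 else x j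

/-- The entries number `i`, `i + 1`. -/
def getTwo {α : Type*} (x : ℕ → α) (i : ℕ) : α × α := (x i, x (i + 1))

theorem setTwo_getTwo {α : Type*} (x : ℕ → α) (i : ℕ) : setTwo x i (getTwo x i) = x := by
  funext j
  simp only [setTwo, getTwo]
  split_ifs with h1 h2
  · rw [h1]
  · rw [h2]
  · rfl

theorem getTwo_setTwo {α : Type*} (x : ℕ → α) (i : ℕ) (p : α × α) :
    getTwo (setTwo x i p) i = p := by
  simp [setTwo, getTwo]

theorem setTwo_setTwo {α : Type*} (x : ℕ → α) (i : ℕ) (p p' : α × α) :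
    setTwo (setTwo x i p) i p' = setTwo x i p' := by
  funext j
  simp only [setTwo]
  split_ifs <;> rfl

theorem setTwo_comm {α : Type*} (x : ℕ → α) {i j : ℕ} (h : i + 1 < j) (p p' : α × α) :
    setTwo (setTwo x i p) j p' = setTwo (setTwo x j p') i p := by
  funext t
  simp only [setTwo]
  split_ifs <;> first | rfl | omega

theorem getTwo_setTwo_left {α : Type*} (x : ℕ → α) {i j : ℕ} (h : i + 1 < j) (p : α × α) :
    getTwo (setTwo x j p) i = getTwo x i := by
  simp only [setTwo, getTwo]
  rw [if_neg (by omega), if_neg (by omega), if_neg (by omega), if_neg (by omega)]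

theorem getTwo_setTwo_right {α : Type*} (x : ℕ → α) {i j : ℕ} (h : i + 1 < j) (p : α × α) :
    getTwo (setTwo x i p) j = getTwo x j := by
  simp only [setTwo, getTwo]
  rw [if_neg (by omega), if_neg (by omega), if_neg (by omega), if_neg (by omega)]

/-- Replace the entries number `i`, `i + 1`, `i + 2`. -/
def setThree {α : Type*} (x : ℕ → α) (i : ℕ) (p : α × α × α) : ℕ → α :=
  fun j => if j = i then p.1 else if j = i + 1 then p.2.1 else if j = i + 2 then p.2.2 else x j

theorem setThree_self {α : Type*} (x : ℕ → α) (i : ℕ) :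
    setThree x i (x i, x (i + 1), x (i + 2)) = x := by
  funext j
  simp only [setThree]
  split_ifs with h1 h2 h3
  · rw [h1]
  · rw [h2]
  · rw [h3]
  · rfl

theorem setTwo_setThree_left {α : Type*} (x : ℕ → α) (i : ℕ) (t : α × α × α) (p : α × α) :
    setTwo (setThree x i t) i p = setThree x i (p.1, p.2, t.2.2) := by
  funext j
  simp only [setThree, setTwo]
  split_ifs <;> rfl

theorem setTwo_setThree_right {α : Type*} (x : ℕ → α) (i : ℕ) (t : α × α × α) (p : α × α) :
    setTwo (setThree x i t) (i + 1) p = setThree x i (t.1, p) := by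
  funext j
  simp only [setThree, setTwo]
  split_ifs <;> first | rfl | omega

theorem getTwo_setThree_left {α : Type*} (x : ℕ → α) (i : ℕ) (t : α × α × α) :
    getTwo (setThree x i t) i = (t.1, t.2.1) := by
  simp [getTwo, setThree]

theorem getTwo_setThree_right {α : Type*} (x : ℕ → α) (i : ℕ) (t : α × α × α) :
    getTwo (setThree x i t) (i + 1) = t.2 := by
  simp only [getTwo, setThree]
  refine Prod.ext ?_ ?_ <;> dsimp only <;> split_ifs <;> first | rfl | omega

/-- Sequences of triples `(c, m, d)`, stored as a sequence of pairs `(c, m)` and a sequence of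
the `d`. -/
abbrev Triples : Type := (ℕ → ℤ × ℤ) × (ℕ → ℤ)

/-- The Hecke generator acting on the `(c, m)` of the entries `i`, `i + 1`. -/
def opA (i : ℕ) : Module.End Kq (Triples →₀ Kq) :=
  localOp (fun z p => (setTwo z.1 i p, z.2)) (fun z => getTwo z.1 i) demazureLusztig

/-- The Hecke generator acting on the `d` of the entries `i`, `i + 1`. -/
def opB (i : ℕ) : Module.End Kq (Triples →₀ Kq) :=
  localOp (fun z p => (z.1, setTwo z.2 i p)) (fun z => getTwo z.2 i) (jimbo (-q⁻¹))

theorem isLens_opA (i : ℕ) :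
    IsLens (fun (z : Triples) p => (setTwo z.1 i p, z.2)) (fun z => getTwo z.1 i) :=
  ⟨fun x => getTwo_setTwo x.1 i, fun x p p' => Prod.ext (setTwo_setTwo x.1 i p p') rfl,
    fun x => Prod.ext (setTwo_getTwo x.1 i) rfl⟩

theorem isLens_opB (i : ℕ) :
    IsLens (fun (z : Triples) p => (z.1, setTwo z.2 i p)) (fun z => getTwo z.2 i) :=
  ⟨fun x => getTwo_setTwo x.2 i, fun x p p' => Prod.ext rfl (setTwo_setTwo x.2 i p p'),
    fun x => Prod.ext rfl (setTwo_getTwo x.2 i)⟩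

theorem opA_sq (i : ℕ) : opA i * opA i = hq • opA i + 1 :=
  (isLens_opA i).localOp_sq demazureLusztig_sq

theorem opB_sq (i : ℕ) : opB i * opB i = hq • opB i + 1 :=
  (isLens_opB i).localOp_sq (jimbo_sq neg_qInv_sq)

theorem commute_opA_opB (i j : ℕ) : Commute (opA i) (opB j) :=
  localOp_commute _ _ (fun _ _ => rfl) (fun _ _ => rfl) (fun _ _ _ => rfl)

theorem commute_opA {i j : ℕ} (h : i + 1 < j) : Commute (opA i) (opA j) :=
  localOp_commute _ _ (fun x p => getTwo_setTwo_left x.1 h p)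
    (fun x p => getTwo_setTwo_right x.1 h p)
    (fun x p p' => Prod.ext (setTwo_comm x.1 h p p').symm rfl)

theorem commute_opB {i j : ℕ} (h : i + 1 < j) : Commute (opB i) (opB j) :=
  localOp_commute _ _ (fun x p => getTwo_setTwo_left x.2 h p)
    (fun x p => getTwo_setTwo_right x.2 h p)
    (fun x p p' => Prod.ext rfl (setTwo_comm x.2 h p p').symm)

theorem braid_opA (i : ℕ) : opA i * opA (i + 1) * opA i = opA (i + 1) * opA i * opA (i + 1) :=
  isBraided_demazureLusztig.localOp (w := fun (x : Triples) t => (setThree x.1 i t, x.2))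
    (σ := fun x => (x.1 i, x.1 (i + 1), x.1 (i + 2)))
    (fun x => Prod.ext (setThree_self x.1 i) rfl) (fun x t => getTwo_setThree_left x.1 i t)
    (fun x t => getTwo_setThree_right x.1 i t)
    (fun x t p => Prod.ext (setTwo_setThree_left x.1 i t p) rfl)
    (fun x t p => Prod.ext (setTwo_setThree_right x.1 i t p) rfl)

theorem braid_opB (i : ℕ) : opB i * opB (i + 1) * opB i = opB (i + 1) * opB i * opB (i + 1) :=
  (isBraided_jimbo neg_qInv_sq).localOp (w := fun (x : Triples) t => (x.1, setThree x.2 i t))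
    (σ := fun x => (x.2 i, x.2 (i + 1), x.2 (i + 2)))
    (fun x => Prod.ext rfl (setThree_self x.2 i)) (fun x t => getTwo_setThree_left x.2 i t)
    (fun x t => getTwo_setThree_right x.2 i t)
    (fun x t p => Prod.ext rfl (setTwo_setThree_left x.2 i t p))
    (fun x t p => Prod.ext rfl (setTwo_setThree_right x.2 i t p))

/-- The braiding of the entries `i`, `i + 1`. -/
def opC (i : ℕ) : Module.End Kq (Triples →₀ Kq) := opA i * opB i

theorem opC_mul (i j k : ℕ) :
    opC i * opC j * opC k = (opA i * opA j * opA k) * (opB i * opB j * opB k) := by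
  have h1 := (commute_opA_opB j i).eq
  have h2 := (commute_opA_opB k i).eq
  have h3 := (commute_opA_opB k j).eq
  simp only [opC, mul_assoc]
  rw [← mul_assoc (opB i) (opA j), ← h1, mul_assoc, ← mul_assoc (opB j) (opA k), ← h3,
    mul_assoc, ← mul_assoc (opB i) (opA k), ← h2, mul_assoc]

theorem braid_opC (i : ℕ) : opC i * opC (i + 1) * opC i = opC (i + 1) * opC i * opC (i + 1) := by
  rw [opC_mul, opC_mul, braid_opA, braid_opB]

theorem commute_opC {i j : ℕ} (h : i + 1 < j) : Commute (opC i) (opC j) :=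
  Commute.mul_left
    (Commute.mul_right (commute_opA h) (commute_opA_opB i j))
    (Commute.mul_right (commute_opA_opB j i).symm (commute_opB h))

/-- The product is `A - B + A ^ 2 B - A B ^ 2`, and the quadratic relations turn this into `0`. -/
theorem hecke_casimir {k R : Type*} [CommRing k] [Ring R] [Algebra k R] {h : k} {A B : R}
    (ha : A * A = h • A + 1) (hb : B * B = h • B + 1) (hab : A * B = B * A) :
    (1 + A * B) * (A - B) = 0 := by
  have e : (1 + A * B) * (A - B) = A - B + (A * B) * A - A * (B * B) := by noncomm_ring
  rw [e, hab, mul_assoc, ha, hb]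
  simp only [mul_add, mul_smul_comm, mul_one, hab]
  module

theorem one_add_opC_mul (i : ℕ) : (1 + opC i) * (opA i - opB i) = 0 :=
  hecke_casimir (k := Kq) (R := Module.End Kq (Triples →₀ Kq)) (opA_sq i) (opB_sq i)
    (commute_opA_opB i i).eq

/-! ### The quantum antisymmetrizer -/

section Symmetrizer

variable {R : Type*} [Ring R]

/-- `1 + C_{m-1} + C_{m-2} C_{m-1} + ⋯ + C_0 ⋯ C_{m-1}`. -/
def shuffle (C : ℕ → R) : ℕ → R
  | 0 => 1
  | m + 1 => 1 + shuffle C m * C m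

/-- The sum of the lifts to the braid monoid of all permutations of the entries `0, …, m`. -/
def symmetrizer (C : ℕ → R) : ℕ → R
  | 0 => 1
  | m + 1 => shuffle C (m + 1) * symmetrizer C m

variable {C : ℕ → R}

theorem commute_shuffle (far : ∀ i j, i + 1 < j → Commute (C i) (C j)) {m j : ℕ} (h : m < j) :
    Commute (shuffle C m) (C j) := by
  induction m with
  | zero => exact Commute.one_left _
  | succ m ih =>
    exact Commute.add_left (Commute.one_left _) (Commute.mul_left (ih (by omega)) (far m j h))

theorem commute_symmetrizer (far : ∀ i j, i + 1 < j → Commute (C i) (C j)) {m j : ℕ}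
    (h : m < j) : Commute (symmetrizer C m) (C j) := by
  induction m with
  | zero => exact Commute.one_left _
  | succ m ih => exact Commute.mul_left (commute_shuffle far h) (ih (by omega))

/-- In terms of permutations: the minimal representatives of the cosets of `S_m × S_1 × S_1` in
`S_{m+2}` come in pairs, the members of which differ by the last transposition. -/
theorem shuffle_mul_shuffle (braid : ∀ i, C i * C (i + 1) * C i = C (i + 1) * C i * C (i + 1))
    (far : ∀ i j, i + 1 < j → Commute (C i) (C j)) (m : ℕ) :
    ∃ Q, shuffle C (m + 1) * shuffle C m = Q * (1 + C m) := by
  induction m with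
  | zero => exact ⟨1, by simp [shuffle]⟩
  | succ m ih =>
    obtain ⟨Q, hQ⟩ := ih
    refine ⟨shuffle C (m + 1) + Q * C (m + 1) * C m, ?_⟩
    have hc := (commute_shuffle far (Nat.lt_succ_self m)).eq
    calc shuffle C (m + 2) * shuffle C (m + 1)
        = shuffle C (m + 1) + shuffle C (m + 1) * C (m + 1) * shuffle C (m + 1) := by
          rw [shuffle, add_mul, one_mul]
      _ = shuffle C (m + 1) + shuffle C (m + 1) * C (m + 1) * (1 + shuffle C m * C m) := by
          nth_rewrite 3 [shuffle]; rfl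
      _ = shuffle C (m + 1) * (1 + C (m + 1))
          + shuffle C (m + 1) * (C (m + 1) * shuffle C m) * C m := by noncomm_ring
      _ = shuffle C (m + 1) * (1 + C (m + 1))
          + (shuffle C (m + 1) * shuffle C m) * C (m + 1) * C m := by
          rw [← Nat.succ_eq_add_one, ← hc]; noncomm_ring
      _ = shuffle C (m + 1) * (1 + C (m + 1))
          + (Q * C (m + 1) * C m + Q * (C m * C (m + 1) * C m)) := by
          rw [hQ]; noncomm_ring
      _ = _ := by rw [braid]; noncomm_ring

/-- The permutations come in pairs that differ by the transposition of `i`, `i + 1`. -/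
theorem symmetrizer_eq_mul (braid : ∀ i, C i * C (i + 1) * C i = C (i + 1) * C i * C (i + 1))
    (far : ∀ i j, i + 1 < j → Commute (C i) (C j)) (m i : ℕ) (h : i < m) :
    ∃ Q, symmetrizer C m = Q * (1 + C i) := by
  induction m with
  | zero => omega
  | succ m ih =>
    rcases Nat.lt_succ_iff_lt_or_eq.mp h with h | rfl
    · obtain ⟨Q, hQ⟩ := ih h
      exact ⟨shuffle C (m + 1) * Q, by rw [symmetrizer, hQ, mul_assoc]⟩
    · cases i with
      | zero => exact ⟨1, by simp [symmetrizer, shuffle]⟩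
      | succ i =>
        obtain ⟨Q, hQ⟩ := shuffle_mul_shuffle braid far (i + 1)
        refine ⟨Q * symmetrizer C i, ?_⟩
        have hc : Commute (symmetrizer C i) (1 + C (i + 1)) :=
          Commute.add_right (Commute.one_right _) (commute_symmetrizer far (Nat.lt_succ_self i))
        rw [symmetrizer, symmetrizer, ← mul_assoc, hQ, mul_assoc, ← hc.eq, mul_assoc]

end Symmetrizer

theorem symmetrizer_opC_mul {m i : ℕ} (h : i < m) :
    symmetrizer opC m * (opA i - opB i) = 0 := by
  obtain ⟨Q, hQ⟩ := symmetrizer_eq_mul (R := Module.End Kq (Triples →₀ Kq)) braid_opC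
    (fun i j h => commute_opC h) m i h
  rw [hQ, mul_assoc, one_add_opC_mul, mul_zero]

/-! ### Specialisation at `q = 1` -/

/-- The vectors with coefficients in `ℚ[q, q⁻¹]`, those at the indices in `S` being divisible
by `q - 1`. -/
def vanishing {X : Type*} (S : Set X) : Submodule laurent (X →₀ Kq) where
  carrier := {z | (∀ x, z x ∈ laurent) ∧ ∀ x ∈ S, ∃ y ∈ laurent, z x = (q - 1) * y}
  zero_mem' := ⟨fun _ => zero_mem _, fun _ _ => ⟨0, zero_mem _, by simp⟩⟩
  add_mem' := by
    rintro a b ⟨h1, h2⟩ ⟨h3, h4⟩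
    refine ⟨fun x => add_mem (h1 x) (h3 x), fun x hx => ?_⟩
    obtain ⟨y, hy, e⟩ := h2 x hx
    obtain ⟨y', hy', e'⟩ := h4 x hx
    exact ⟨y + y', add_mem hy hy', by rw [Finsupp.add_apply, e, e']; ring⟩
  smul_mem' := by
    rintro ⟨c, hc⟩ a ⟨h1, h2⟩
    refine ⟨fun x => mul_mem hc (h1 x), fun x hx => ?_⟩
    obtain ⟨y, hy, e⟩ := h2 x hx
    refine ⟨c * y, mul_mem hc hy, ?_⟩
    change c * a x = _
    rw [e]; ring

theorem vanishing_anti {X : Type*} {S T : Set X} (h : S ⊆ T) :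
    (vanishing T : Submodule laurent (X →₀ Kq)) ≤ vanishing S :=
  fun _ hz => ⟨hz.1, fun x hx => hz.2 x (h hx)⟩

theorem single_mem_vanishing {X : Type*} {S : Set X} {x : X} (hx : x ∉ S) :
    Finsupp.single x (1 : Kq) ∈ vanishing S := by
  classical
  refine ⟨fun y => ?_, fun y hy => ⟨0, zero_mem _, ?_⟩⟩
  · rw [Finsupp.single_apply]
    split_ifs
    · exact one_mem _
    · exact zero_mem _
  · rw [Finsupp.single_eq_of_ne (by rintro rfl; exact hx hy), mul_zero]

/-- A linear map that restricts to the identity modulo `q - 1` on the span of the `e_x`, `x ∈ S`,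
is injective there. -/
theorem eq_zero_of_specialize {X : Type*} {S : Set X} (Ω : Module.End Kq (X →₀ Kq))
    (hΩ : ∀ x ∈ S, Ω (Finsupp.single x 1) - Finsupp.single x 1 ∈ vanishing S) {z : X →₀ Kq}
    (hz : ∀ x, z x ≠ 0 → x ∈ S) (h0 : Ω z = 0) : z = 0 := by
  classical
  have hS : ∀ x : z.support, (x : X) ∈ S := fun x => hz x (Finsupp.mem_support_iff.mp x.2)
  have hmem : ∀ (x' x : z.support),
      Ω (Finsupp.single (x : X) 1) x' ∈ laurent := by
    intro x' x
    have h1 := (hΩ x (hS x)).1 x'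
    rw [Finsupp.sub_apply] at h1
    have h2 : Finsupp.single (x : X) (1 : Kq) x' ∈ laurent := by
      rw [Finsupp.single_apply]
      split_ifs
      · exact one_mem _
      · exact zero_mem _
    simpa using add_mem h1 h2
  let N : Matrix z.support z.support laurent := fun x' x => ⟨Ω (Finsupp.single (x : X) 1) x', hmem x' x⟩
  let t : laurent := ⟨q - 1, sub_mem q_mem_laurent (one_mem _)⟩
  have hN : N.map (Ideal.Quotient.mk (Ideal.span {t})) = 1 := by
    ext x' x
    rw [Matrix.map_apply, Matrix.one_apply]
    obtain ⟨y, hy, e⟩ := (hΩ x (hS x)).2 x' (hS x')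
    rw [Finsupp.sub_apply] at e
    have : N x' x - (if x' = x then 1 else 0) ∈ Ideal.span {t} := by
      rw [Ideal.mem_span_singleton]
      refine ⟨⟨y, hy⟩, Subtype.ext ?_⟩
      change Ω (Finsupp.single (x : X) 1) x' - ((if x' = x then 1 else 0 : laurent) : Kq)
        = (q - 1) * y
      rw [← e, Finsupp.single_apply]
      congr 1
      simp only [Subtype.ext_iff, eq_comm]
      split_ifs <;> rfl
    rw [← Ideal.Quotient.eq] at this
    rw [this]
    split_ifs <;> simp
  have hdet : N.det ≠ 0 := by
    intro h
    have h1 : Ideal.Quotient.mk (Ideal.span {t}) N.det = 1 := by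
      rw [RingHom.map_det, RingHom.mapMatrix_apply, hN, Matrix.det_one]
    rw [h, map_zero, ← map_one (Ideal.Quotient.mk (Ideal.span {t})), eq_comm,
      Ideal.Quotient.eq_zero_iff_mem, Ideal.mem_span_singleton] at h1
    obtain ⟨y, hy⟩ := h1
    exact sub_one_mul_ne_one y.2 (congrArg Subtype.val hy).symm
  have hdet' : (N.map laurent.subtype).det ≠ 0 := by
    intro h
    apply hdet
    have := RingHom.map_det laurent.subtype N
    rw [RingHom.mapMatrix_apply, h] at this
    exact Subtype.ext this
  have hmul : (N.map laurent.subtype).mulVec (fun x => z x) = 0 := by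
    funext x'
    rw [Matrix.mulVec, dotProduct, Pi.zero_apply]
    have := DFunLike.congr_fun h0 (x' : X)
    rw [linearMap_apply_eq_sum Ω, Finsupp.sum, Finsupp.finsetSum_apply,
      ← Finset.sum_coe_sort z.support, Finsupp.zero_apply] at this
    rw [← this]
    refine Finset.sum_congr rfl fun x _ => ?_
    rw [Finsupp.smul_apply, smul_eq_mul, mul_comm]
    rfl
  have hv := Matrix.eq_zero_of_mulVec_eq_zero hdet' hmul
  ext x
  by_contra hx
  exact hx (congrFun hv ⟨x, Finsupp.mem_support_iff.mpr hx⟩)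

section Vanishing

variable {X Y : Type*}

theorem single_mem_integral (x : X) :
    Finsupp.single x (1 : Kq) ∈ (vanishing ∅ : Submodule laurent (X →₀ Kq)) :=
  single_mem_vanishing (Set.notMem_empty x)

theorem smul_mem_vanishing {S : Set X} {c : Kq} (hc : c ∈ laurent) {z : X →₀ Kq}
    (hz : z ∈ vanishing S) : c • z ∈ vanishing S :=
  (vanishing S).smul_mem (⟨c, hc⟩ : laurent) hz

theorem sub_one_smul_mem_vanishing {c : Kq} (hc : c ∈ laurent) {z : X →₀ Kq}
    (hz : z ∈ (vanishing ∅ : Submodule laurent (X →₀ Kq))) :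
    ((q - 1) * c) • z ∈ vanishing Set.univ := by
  refine ⟨fun x => mul_mem (mul_mem (sub_mem q_mem_laurent (one_mem _)) hc) (hz.1 x),
    fun x _ => ⟨c * z x, mul_mem hc (hz.1 x), ?_⟩⟩
  rw [Finsupp.smul_apply, smul_eq_mul, mul_assoc]

theorem sum_mem_vanishing {z : X →₀ Kq} (hz : z ∈ vanishing Set.univ) {w : X → Y →₀ Kq}
    (hw : ∀ x, w x ∈ (vanishing ∅ : Submodule laurent (Y →₀ Kq))) :
    (z.sum fun x c => c • w x) ∈ vanishing Set.univ := by
  refine sum_mem fun x _ => ?_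
  obtain ⟨y, hy, e⟩ := hz.2 x (Set.mem_univ x)
  simp only [e]
  exact sub_one_smul_mem_vanishing hy (hw x)

theorem mapDomain_mem_vanishing (f : X → Y) {z : X →₀ Kq} (hz : z ∈ vanishing Set.univ) :
    z.mapDomain f ∈ vanishing Set.univ := by
  have := sum_mem_vanishing hz fun x => single_mem_integral (f x)
  simpa only [Finsupp.mapDomain, Finsupp.smul_single, smul_eq_mul, mul_one] using this

theorem map_mem_vanishing {Ω : (X →₀ Kq) →ₗ[Kq] (Y →₀ Kq)}
    (hΩ : ∀ x, Ω (Finsupp.single x 1) ∈ (vanishing ∅ : Submodule laurent (Y →₀ Kq)))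
    {z : X →₀ Kq} (hz : z ∈ vanishing Set.univ) : Ω z ∈ vanishing Set.univ := by
  rw [linearMap_apply_eq_sum]
  exact sum_mem_vanishing hz hΩ

theorem hq_eq : hq = (q - 1) * (1 + q⁻¹) := by
  have := q_ne_zero
  rw [hq]; field_simp; ring

theorem one_add_qInv_mem : 1 + q⁻¹ ∈ laurent := add_mem (one_mem _) qInv_mem_laurent

theorem demazureLusztig_specialize (t : (ℤ × ℤ) × (ℤ × ℤ)) :
    demazureLusztig t - Finsupp.single t.swap 1 ∈ vanishing Set.univ := by
  have e : demazureLusztig t - Finsupp.single t.swap 1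
      = ((q - 1) * (if t.1.1 = t.2.1 then 1 else 0)) • Finsupp.single t.swap (1 : Kq)
      + ((q - 1) * (if t.1.1 < t.2.1 then 1 + q⁻¹ else 0)) •
          Finsupp.single ((t.1.1, t.2.2), (t.2.1, t.1.2)) (1 : Kq)
      + ((q - 1) * (1 + q⁻¹)) • signedSum (fun i =>
          Finsupp.single ((t.1.1, i), (t.2.1, t.1.2 + t.2.2 - i)) (1 : Kq)) t.2.2 t.1.2 := by
    rw [demazureLusztig, ← hq_eq, mul_ite, mul_ite, ← hq_eq, mul_zero, mul_one]
    change _ - Finsupp.single (t.2, t.1) 1 = _ • Finsupp.single (t.2, t.1) 1 + _ + _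
    split_ifs
    all_goals simp only [sub_smul, one_smul, zero_smul]; abel
  rw [e]
  refine add_mem (add_mem ?_ ?_) ?_ <;> refine sub_one_smul_mem_vanishing ?_ ?_
  · split_ifs
    · exact one_mem _
    · exact zero_mem _
  · exact single_mem_integral _
  · split_ifs
    · exact one_add_qInv_mem
    · exact zero_mem _
  · exact single_mem_integral _
  · exact one_add_qInv_mem
  · exact sub_mem (sum_mem fun _ _ => single_mem_integral _)
      (sum_mem fun _ _ => single_mem_integral _)

theorem jimbo_specialize (p : ℤ × ℤ) : ∃ ε ∈ laurent,
    jimbo (-q⁻¹) p - ε • Finsupp.single p.swap 1 ∈ vanishing Set.univ := by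
  obtain ⟨a, b⟩ := p
  rcases lt_trichotomy a b with h | rfl | h
  · refine ⟨1, one_mem _, ?_⟩
    rw [jimbo_lt _ h, hq_eq, one_smul, Prod.swap_prod_mk, add_sub_cancel_left]
    exact sub_one_smul_mem_vanishing one_add_qInv_mem (single_mem_integral _)
  · refine ⟨-1, neg_mem (one_mem _), ?_⟩
    rw [jimbo_self, Prod.swap_prod_mk, ← sub_smul]
    have e : -q⁻¹ - -1 = (q - 1) * q⁻¹ := by
      have := q_ne_zero
      field_simp; ring
    rw [e]
    exact sub_one_smul_mem_vanishing qInv_mem_laurent (single_mem_integral _)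
  · refine ⟨1, one_mem _, ?_⟩
    rw [jimbo_gt _ h, one_smul, Prod.swap_prod_mk, sub_self]
    exact zero_mem _

end Vanishing

/-! ### The quantum antisymmetrizer at `q = 1` -/

/-- The entry number `a`. -/
def entry (κ : Triples) (a : ℕ) : (ℤ × ℤ) × ℤ := (κ.1 a, κ.2 a)

/-- Exchange the entries `i`, `i + 1`. -/
def swapEntries (i : ℕ) (κ : Triples) : Triples :=
  (setTwo κ.1 i (getTwo κ.1 i).swap, setTwo κ.2 i (getTwo κ.2 i).swap)

theorem entry_swapEntries (i : ℕ) (κ : Triples) (a : ℕ) :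
    entry (swapEntries i κ) a
      = if a = i then entry κ (i + 1) else if a = i + 1 then entry κ i else entry κ a := by
  simp only [entry, swapEntries, setTwo, getTwo, Prod.swap]
  split_ifs <;> rfl

theorem opA_specialize (i : ℕ) (κ : Triples) :
    opA i (Finsupp.single κ 1) - Finsupp.single (setTwo κ.1 i (getTwo κ.1 i).swap, κ.2) 1
      ∈ vanishing Set.univ := by
  have := mapDomain_mem_vanishing (fun p => ((setTwo κ.1 i p, κ.2) : Triples))
    (demazureLusztig_specialize (getTwo κ.1 i))
  rw [← Finsupp.lmapDomain_apply (M := Kq) (R := Kq), map_sub] at this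
  rw [opA, localOp_single]
  rwa [Finsupp.lmapDomain_apply, Finsupp.lmapDomain_apply, Finsupp.mapDomain_single] at this

theorem opB_specialize (i : ℕ) (κ : Triples) : ∃ ε ∈ laurent,
    opB i (Finsupp.single κ 1) - ε • Finsupp.single (κ.1, setTwo κ.2 i (getTwo κ.2 i).swap) 1
      ∈ vanishing Set.univ := by
  obtain ⟨ε, hε, h⟩ := jimbo_specialize (getTwo κ.2 i)
  refine ⟨ε, hε, ?_⟩
  have := mapDomain_mem_vanishing (fun p => ((κ.1, setTwo κ.2 i p) : Triples)) h
  rw [← Finsupp.lmapDomain_apply (M := Kq) (R := Kq), map_sub, map_smul] at this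
  rw [opB, localOp_single]
  rwa [Finsupp.lmapDomain_apply, Finsupp.lmapDomain_apply, Finsupp.mapDomain_single] at this

theorem opA_integral (i : ℕ) (κ : Triples) :
    opA i (Finsupp.single κ 1) ∈ (vanishing ∅ : Submodule laurent (Triples →₀ Kq)) := by
  have := add_mem (vanishing_anti (Set.empty_subset _) (opA_specialize i κ))
    (single_mem_integral (setTwo κ.1 i (getTwo κ.1 i).swap, κ.2))
  rwa [sub_add_cancel] at this

/-- At `q = 1`, the braiding is a signed transposition of entries. -/
theorem opC_specialize (i : ℕ) (κ : Triples) : ∃ ε ∈ laurent,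
    opC i (Finsupp.single κ 1) - ε • Finsupp.single (swapEntries i κ) 1
      ∈ vanishing Set.univ := by
  obtain ⟨ε, hε, h⟩ := opB_specialize i κ
  refine ⟨ε, hε, ?_⟩
  have h1 := map_mem_vanishing (opA_integral i) h
  have h2 := smul_mem_vanishing hε
    (opA_specialize i (κ.1, setTwo κ.2 i (getTwo κ.2 i).swap))
  have := add_mem h1 h2
  rwa [map_sub, map_smul, smul_sub, sub_add_sub_cancel] at this

/-- `κ'` arises from `κ` by moving the entry number `m` to the left. -/
def MovesLeft (m : ℕ) (κ κ' : Triples) : Prop :=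
  (∃ j < m, entry κ' j = entry κ m) ∧ (∃ a < m, entry κ' m = entry κ a) ∧
    (∀ a ≤ m, ∃ b ≤ m, entry κ' a = entry κ b) ∧ ∀ a, m < a → entry κ' a = entry κ a

/-- Combinations of the `e_κ'`, `κ' ∈ S`, modulo `q - 1`. -/
def spanModulo (S : Set Triples) : Submodule laurent (Triples →₀ Kq) :=
  vanishing Set.univ ⊔ Submodule.span laurent ((fun κ => Finsupp.single κ (1 : Kq)) '' S)

theorem spanModulo_mono {S T : Set Triples} (h : S ⊆ T) : spanModulo S ≤ spanModulo T :=
  sup_le_sup le_rfl (Submodule.span_mono (Set.image_mono h))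

theorem vanishing_le_spanModulo (S : Set Triples) : vanishing Set.univ ≤ spanModulo S :=
  le_sup_left

theorem single_mem_spanModulo {S : Set Triples} {κ : Triples} (h : κ ∈ S) :
    Finsupp.single κ (1 : Kq) ∈ spanModulo S :=
  le_sup_right (a := vanishing Set.univ) (Submodule.subset_span ⟨κ, h, rfl⟩)

theorem spanModulo_le_integral (S : Set Triples) : spanModulo S ≤ vanishing ∅ :=
  sup_le (vanishing_anti (Set.empty_subset _)) (Submodule.span_le.mpr (by
    rintro _ ⟨κ, _, rfl⟩
    exact single_mem_integral κ))

theorem spanModulo_le_comap {S T : Set Triples} {Ω : Module.End Kq (Triples →₀ Kq)}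
    (hΩ : ∀ κ, Ω (Finsupp.single κ 1) ∈ (vanishing ∅ : Submodule laurent (Triples →₀ Kq)))
    (h : ∀ κ ∈ S, Ω (Finsupp.single κ 1) ∈ spanModulo T) {z : Triples →₀ Kq}
    (hz : z ∈ spanModulo S) : Ω z ∈ spanModulo T := by
  have : spanModulo S ≤ (spanModulo T).comap (Ω.restrictScalars laurent) := by
    refine sup_le ?_ (Submodule.span_le.mpr ?_)
    · intro z hz
      exact vanishing_le_spanModulo T (map_mem_vanishing hΩ hz)
    · rintro _ ⟨κ, hκ, rfl⟩
      exact h κ hκ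
  exact this hz

/-- At `q = 1`, the shuffle operator is `1` plus moves of the entry number `m` to the left. -/
theorem shuffle_opC (m : ℕ) (κ : Triples) :
    shuffle opC m (Finsupp.single κ 1) - Finsupp.single κ 1 ∈ spanModulo {κ' | MovesLeft m κ κ'} := by
  induction m generalizing κ with
  | zero =>
    rw [shuffle, Module.End.one_apply, sub_self]
    exact zero_mem _
  | succ m ih =>
    have hint : ∀ κ, shuffle opC m (Finsupp.single κ 1)
        ∈ (vanishing ∅ : Submodule laurent (Triples →₀ Kq)) := by
      intro κ
      have := add_mem (spanModulo_le_integral _ (ih κ)) (single_mem_integral κ)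
      rwa [sub_add_cancel] at this
    obtain ⟨ε, hε, h⟩ := opC_specialize m κ
    have h1 := vanishing_le_spanModulo {κ' | MovesLeft (m + 1) κ κ'} (map_mem_vanishing hint h)
    rw [map_sub, map_smul] at h1
    have hmv : MovesLeft (m + 1) κ (swapEntries m κ) := by
      refine ⟨⟨m, by omega, ?_⟩, ⟨m, by omega, ?_⟩, fun a ha => ?_, fun a ha => ?_⟩
      · rw [entry_swapEntries, if_pos rfl]
      · rw [entry_swapEntries, if_neg (by omega), if_pos rfl]
      · rw [entry_swapEntries]
        split_ifs
        · exact ⟨m + 1, le_rfl, rfl⟩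
        · exact ⟨m, by omega, rfl⟩
        · exact ⟨a, ha, rfl⟩
      · rw [entry_swapEntries, if_neg (by omega), if_neg (by omega)]
    have h2 : shuffle opC m (Finsupp.single (swapEntries m κ) 1)
        ∈ spanModulo {κ' | MovesLeft (m + 1) κ κ'} := by
      have h3 : spanModulo {κ' | MovesLeft m (swapEntries m κ) κ'}
          ≤ spanModulo {κ' | MovesLeft (m + 1) κ κ'} := by
        apply spanModulo_mono
        rintro κ' ⟨⟨j, hj, e1⟩, ⟨a, ha, e2⟩, e3, e4⟩
        refine ⟨⟨j, by omega, ?_⟩, ⟨m, by omega, ?_⟩, fun a ha => ?_, fun a ha => ?_⟩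
        · rw [e1, entry_swapEntries, if_pos rfl]
        · rw [e4 _ (by omega), entry_swapEntries, if_neg (by omega), if_pos rfl]
        · rcases Nat.lt_or_ge m a with h | h
          · rw [e4 a h, show a = m + 1 by omega, entry_swapEntries, if_neg (by omega), if_pos rfl]
            exact ⟨m, by omega, rfl⟩
          · obtain ⟨b, hb, e⟩ := e3 a h
            rw [e, entry_swapEntries]
            split_ifs
            · exact ⟨m + 1, le_rfl, rfl⟩
            · exact ⟨m, by omega, rfl⟩
            · exact ⟨b, by omega, rfl⟩
        · rw [e4 a (by omega), entry_swapEntries, if_neg (by omega), if_neg (by omega)]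
      have := add_mem (h3 (ih (swapEntries m κ))) (single_mem_spanModulo hmv)
      rwa [sub_add_cancel] at this
    have h4 := add_mem h1 (Submodule.smul_mem _ (⟨ε, hε⟩ : laurent) h2)
    have e : (⟨ε, hε⟩ : laurent) • shuffle opC m (Finsupp.single (swapEntries m κ) 1)
        = ε • shuffle opC m (Finsupp.single (swapEntries m κ) 1) := rfl
    rw [e, sub_add_cancel] at h4
    rw [shuffle, LinearMap.add_apply, Module.End.one_apply, add_sub_cancel_left]
    exact h4

theorem shuffle_opC_integral (m : ℕ) (κ : Triples) : shuffle opC m (Finsupp.single κ 1)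
    ∈ (vanishing ∅ : Submodule laurent (Triples →₀ Kq)) := by
  have := add_mem (spanModulo_le_integral _ (shuffle_opC m κ)) (single_mem_integral κ)
  rwa [sub_add_cancel] at this

/-- `κ'` arises from `κ` by permuting the entries `0, …, m`, and it has an ascent. -/
def HasAscent (lt : (ℤ × ℤ) × ℤ → (ℤ × ℤ) × ℤ → Prop) (m : ℕ) (κ κ' : Triples) : Prop :=
  (∃ a b, a < b ∧ b ≤ m ∧ lt (entry κ' a) (entry κ' b)) ∧
    (∀ a ≤ m, ∃ b ≤ m, entry κ' a = entry κ b) ∧ ∀ a, m < a → entry κ' a = entry κ a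

/-- The sequences whose entries `0, …, m` are strictly decreasing. -/
def decreasingSet (lt : (ℤ × ℤ) × ℤ → (ℤ × ℤ) × ℤ → Prop) (m : ℕ) : Set Triples :=
  {κ | ∀ a b, a < b → b ≤ m → lt (entry κ b) (entry κ a)}

/-- At `q = 1`, the symmetrizer takes a strictly decreasing sequence to itself plus proper
permutations of it, and these have ascents. -/
theorem symmetrizer_opC {lt : (ℤ × ℤ) × ℤ → (ℤ × ℤ) × ℤ → Prop} (m : ℕ) {κ : Triples}
    (hκ : κ ∈ decreasingSet lt m) :
    symmetrizer opC m (Finsupp.single κ 1) - Finsupp.single κ 1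
      ∈ spanModulo {κ' | HasAscent lt m κ κ'} := by
  induction m with
  | zero =>
    rw [symmetrizer, Module.End.one_apply, sub_self]
    exact zero_mem _
  | succ m ih =>
    have h1 := ih fun a b hab hb => hκ a b hab (by omega)
    have h2 : shuffle opC (m + 1) (symmetrizer opC m (Finsupp.single κ 1) - Finsupp.single κ 1)
        ∈ spanModulo {κ' | HasAscent lt (m + 1) κ κ'} := by
      refine spanModulo_le_comap (shuffle_opC_integral (m + 1)) ?_ h1
      rintro κ' ⟨⟨a, b, hab, hb, hlt⟩, h3, h4⟩
      have hκ' : HasAscent lt (m + 1) κ κ' := by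
        refine ⟨⟨a, b, hab, by omega, hlt⟩, fun c hc => ?_, fun c hc => h4 c (by omega)⟩
        rcases Nat.lt_or_ge m c with h | h
        · exact ⟨c, hc, h4 c h⟩
        · obtain ⟨d, hd, e⟩ := h3 c h
          exact ⟨d, by omega, e⟩
      have h5 : spanModulo {κ'' | MovesLeft (m + 1) κ' κ''}
          ≤ spanModulo {κ' | HasAscent lt (m + 1) κ κ'} := by
        apply spanModulo_mono
        rintro κ'' ⟨⟨j, hj, e1⟩, ⟨c, hc, e2⟩, e3, e4⟩
        refine ⟨⟨j, m + 1, hj, le_rfl, ?_⟩, fun d hd => ?_, fun d hd => ?_⟩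
        · obtain ⟨d, hd, e⟩ := h3 c (by omega)
          rw [e1, e2, e, h4 _ (by omega)]
          exact hκ d (m + 1) (by omega) le_rfl
        · obtain ⟨f, hf, e⟩ := e3 d hd
          obtain ⟨g, hg, e'⟩ := hκ'.2.1 f hf
          exact ⟨g, hg, e.trans e'⟩
        · rw [e4 d hd, hκ'.2.2 d hd]
      have := add_mem (h5 (shuffle_opC (m + 1) κ')) (single_mem_spanModulo hκ')
      rwa [sub_add_cancel] at this
    have h3 : shuffle opC (m + 1) (Finsupp.single κ 1) - Finsupp.single κ 1
        ∈ spanModulo {κ' | HasAscent lt (m + 1) κ κ'} := by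
      refine spanModulo_mono ?_ (shuffle_opC (m + 1) κ)
      rintro κ' ⟨⟨j, hj, e1⟩, ⟨c, hc, e2⟩, e3, e4⟩
      refine ⟨⟨j, m + 1, hj, le_rfl, ?_⟩, e3, e4⟩
      rw [e1, e2]
      exact hκ c (m + 1) hc le_rfl
    have := add_mem h2 h3
    rwa [map_sub, sub_add_sub_cancel] at this

/-- The quantum antisymmetrizer kills the images of all `A_i - B_i`, but no combination of strictly
decreasing sequences. -/
theorem eq_zero_of_mem_iSup_range {lt : (ℤ × ℤ) × ℤ → (ℤ × ℤ) × ℤ → Prop}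
    (asymm : ∀ x y, lt x y → ¬ lt y x) (m : ℕ) {z : Triples →₀ Kq}
    (hz : ∀ κ, z κ ≠ 0 → κ ∈ decreasingSet lt m)
    (h : z ∈ ⨆ i : Fin m, LinearMap.range (opA i - opB i)) : z = 0 := by
  refine eq_zero_of_specialize (S := decreasingSet lt m) (symmetrizer opC m) (fun κ hκ => ?_) hz ?_
  · have hle : spanModulo {κ' | HasAscent lt m κ κ'} ≤ vanishing (decreasingSet lt m) := by
      refine sup_le (vanishing_anti (Set.subset_univ _)) (Submodule.span_le.mpr ?_)
      rintro _ ⟨κ', ⟨⟨a, b, hab, hb, hlt⟩, -, -⟩, rfl⟩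
      exact single_mem_vanishing fun hd => asymm _ _ hlt (hd a b hab hb)
    exact hle (symmetrizer_opC m hκ)
  · have : ⨆ i : Fin m, LinearMap.range (opA i - opB i) ≤ LinearMap.ker (symmetrizer opC m) := by
      refine iSup_le fun i => ?_
      rintro _ ⟨w, rfl⟩
      rw [LinearMap.mem_ker, ← Module.End.mul_apply, symmetrizer_opC_mul i.2, LinearMap.zero_apply]
    exact LinearMap.mem_ker.mp (this h)

/-! ### Letters and their straightening -/

section Letters

variable (n l : ℕ)

/-- The integer `k` with given `c`, `d` and `m`. -/
def letter (c d m : ℤ) : ℤ := c + n * (d - 1) - n * l * m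

variable {n l}

theorem letter_parts [NeZero n] [NeZero l] {c d m : ℤ} (hc : 1 ≤ c) (hc' : c ≤ n) (hd : 1 ≤ d)
    (hd' : d ≤ l) : cPart n (letter n l c d m) = c ∧ dPart n l (letter n l c d m) = d ∧
      mPart n l (letter n l c d m) = m := by
  have hn : (0 : ℤ) < n := by exact_mod_cast Nat.pos_of_ne_zero (NeZero.ne n)
  have hl : (0 : ℤ) < l := by exact_mod_cast Nat.pos_of_ne_zero (NeZero.ne l)
  have e : letter n l c d m - 1 = (c - 1) + n * ((d - 1) + l * (-m)) := by rw [letter]; ring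
  have e1 : (letter n l c d m - 1) % n = c - 1 := by
    rw [e, Int.add_mul_emod_self_left, Int.emod_eq_of_lt (by omega) (by omega)]
  have e2 : (letter n l c d m - 1) / n = (d - 1) + l * (-m) := by
    rw [e, Int.add_mul_ediv_left _ _ hn.ne', Int.ediv_eq_zero_of_lt (by omega) (by omega), zero_add]
  have e3 : ((d - 1) + (l : ℤ) * (-m)) % l = d - 1 := by
    rw [Int.add_mul_emod_self_left, Int.emod_eq_of_lt (by omega) (by omega)]
  have e4 : ((d - 1) + (l : ℤ) * (-m)) / l = -m := by
    rw [Int.add_mul_ediv_left _ _ hl.ne', Int.ediv_eq_zero_of_lt (by omega) (by omega), zero_add]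
  refine ⟨?_, ?_, ?_⟩
  · rw [cPart, e1, sub_add_cancel]
  · rw [dPart, e2, e3, sub_add_cancel]
  · rw [mPart, e2, e4, neg_neg]

variable (n l)

theorem cPart_bounds [NeZero n] (k : ℤ) : 1 ≤ cPart n k ∧ cPart n k ≤ n := by
  obtain ⟨-, h1, h2, -, -⟩ := cdm_spec n 1 k
  exact ⟨h1, h2⟩

theorem dPart_bounds [NeZero n] [NeZero l] (k : ℤ) : 1 ≤ dPart n l k ∧ dPart n l k ≤ l := by
  obtain ⟨-, -, -, h3, h4⟩ := cdm_spec n l k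
  exact ⟨h3, h4⟩

theorem letter_eq [NeZero n] [NeZero l] (k : ℤ) :
    letter n l (cPart n k) (dPart n l k) (mPart n l k) = k := (cdm_spec n l k).1.symm

/-- The letter with the `c` of `a` and the `d` of `b`. -/
def cross (a b m : ℤ) : ℤ := letter n l (cPart n a) (dPart n l b) m

variable {n l}

theorem letter_lt_of_m {c d m c' d' m' : ℤ} (hc' : c ≤ n) (hd' : d ≤ l)
    (gc : 1 ≤ c') (gd : 1 ≤ d') (h : m' < m) :
    letter n l c d m < letter n l c' d' m' := by
  rw [letter, letter]
  have h1 : (n : ℤ) * (d - 1) ≤ n * (l - 1) := mul_le_mul_of_nonneg_left (by omega) (by positivity)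
  have h2 : (n : ℤ) * l * (m' + 1) ≤ n * l * m := mul_le_mul_of_nonneg_left (by omega) (by positivity)
  have h3 : 0 ≤ (n : ℤ) * (d' - 1) := mul_nonneg (by positivity) (by omega)
  linarith

theorem letter_lt_of_d {c d c' d' : ℤ} (m : ℤ) (hc' : c ≤ n) (gc : 1 ≤ c') (h : d < d') :
    letter n l c d m < letter n l c' d' m := by
  rw [letter, letter]
  have h1 : (n : ℤ) * (d + 1) ≤ n * d' := mul_le_mul_of_nonneg_left (by omega) (by positivity)
  linarith

theorem letter_lt_of_c {c c' : ℤ} (d m : ℤ) (h : c < c') :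
    letter n l c d m < letter n l c' d m := by
  rw [letter, letter]
  linarith

section

variable [NeZero n] [NeZero l]

theorem cPart_cross (a b m : ℤ) : cPart n (cross n l a b m) = cPart n a :=
  (letter_parts (cPart_bounds n a).1 (cPart_bounds n a).2 (dPart_bounds n l b).1
    (dPart_bounds n l b).2).1

theorem dPart_cross (a b m : ℤ) : dPart n l (cross n l a b m) = dPart n l b :=
  (letter_parts (cPart_bounds n a).1 (cPart_bounds n a).2 (dPart_bounds n l b).1
    (dPart_bounds n l b).2).2.1

theorem mPart_cross (a b m : ℤ) : mPart n l (cross n l a b m) = m :=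
  (letter_parts (cPart_bounds n a).1 (cPart_bounds n a).2 (dPart_bounds n l b).1
    (dPart_bounds n l b).2).2.2

/-- The order of the letters is lexicographic in `(-m, d, c)`. -/
theorem lt_iff_parts (a b : ℤ) : a < b ↔ mPart n l b < mPart n l a ∨ (mPart n l a = mPart n l b ∧
    (dPart n l a < dPart n l b ∨ (dPart n l a = dPart n l b ∧ cPart n a < cPart n b))) := by
  have ha := letter_eq n l a
  have hb := letter_eq n l b
  obtain ⟨a1, a2⟩ := cPart_bounds n a
  obtain ⟨a3, a4⟩ := dPart_bounds n l a
  obtain ⟨b1, b2⟩ := cPart_bounds n b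
  obtain ⟨b3, b4⟩ := dPart_bounds n l b
  generalize cPart n a = c at *
  generalize dPart n l a = d at *
  generalize mPart n l a = m at *
  generalize cPart n b = c' at *
  generalize dPart n l b = d' at *
  generalize mPart n l b = m' at *
  subst ha hb
  rcases lt_trichotomy m m' with h | rfl | h
  · have := letter_lt_of_m b2 b4 a1 a3 h
    omega
  · rcases lt_trichotomy d d' with h | rfl | h
    · have := letter_lt_of_d (l := l) m a2 b1 h
      omega
    · rcases lt_trichotomy c c' with h | rfl | h
      · have := letter_lt_of_c (n := n) (l := l) d m h
        omega
      · omega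
      · have := letter_lt_of_c (n := n) (l := l) d m h
        omega
    · have := letter_lt_of_d (l := l) m b2 a1 h
      omega
  · have := letter_lt_of_m a2 a4 b1 b3 h
    omega

theorem eq_of_parts {a b : ℤ} (h1 : cPart n a = cPart n b) (h2 : dPart n l a = dPart n l b)
    (h3 : mPart n l a = mPart n l b) : a = b := by
  rw [← letter_eq n l a, h1, h2, h3, letter_eq]

end

variable (n l)

/-- The two letters of the `j`-th correction term in the straightening of `u_a ∧ u_b`. -/
def corr (a b j : ℤ) : ℤ × ℤ :=
  (cross n l a b (mPart n l b + j), cross n l b a (mPart n l a - j))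

/-- The range of the index of the correction terms. -/
def corrRange (a b : ℤ) : Finset ℤ :=
  Finset.Icc (if cPart n b ≤ cPart n a then 1 else 0)
    (mPart n l a - mPart n l b - (if dPart n l b ≤ dPart n l a then 1 else 0))

/-- The factor `-q⁻¹` for letters with equal `d`. -/
def dFactor (a b : ℤ) : Kq := if dPart n l a = dPart n l b then -q⁻¹ else 1

/-- The coefficient in `u_a ∧ u_b = cf a b • u_b ∧ u_a + ⋯`. -/
def cf (a b : ℤ) : Kq := dFactor n l a b * if cPart n a = cPart n b then q else 1

/-- The right-hand side of the straightening rule for `u_a ∧ u_b`, `a ≤ b`. -/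
def straightenPair (a b : ℤ) : ℤ × ℤ →₀ Kq :=
  cf n l a b • Finsupp.single (b, a) 1 +
    (dFactor n l a b * hq) • ∑ j ∈ corrRange n l a b, Finsupp.single (corr n l a b j) 1

/-- The pair `p` occurs in the straightening of `u_a ∧ u_b`. -/
def PairStep (a b : ℤ) (p : ℤ × ℤ) : Prop := p = (b, a) ∨ ∃ j ∈ corrRange n l a b, p = corr n l a b j

variable {n l}

theorem dFactor_comm (a b : ℤ) : dFactor n l a b = dFactor n l b a := by
  simp only [dFactor, eq_comm]

theorem cf_comm (a b : ℤ) : cf n l a b = cf n l b a := by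
  rw [cf, cf, dFactor_comm]
  simp only [eq_comm]

theorem cf_ne_zero (a b : ℤ) : cf n l a b ≠ 0 := by
  have := q_ne_zero
  rw [cf, dFactor]
  split_ifs <;> simp [this]

theorem dFactor_mem_laurent (a b : ℤ) : dFactor n l a b ∈ laurent := by
  rw [dFactor]
  split_ifs
  · exact neg_mem qInv_mem_laurent
  · exact one_mem _

theorem cf_mem_laurent (a b : ℤ) : cf n l a b ∈ laurent := by
  rw [cf]
  refine mul_mem (dFactor_mem_laurent a b) ?_
  split_ifs
  · exact q_mem_laurent
  · exact one_mem _

theorem hq_mem_laurent : hq ∈ laurent := sub_mem q_mem_laurent qInv_mem_laurent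

theorem qBar_hq : qBar hq = -hq := by
  rw [hq, map_sub, qBar_q, qBar_qInv]; ring

theorem qBar_dFactor (a b : ℤ) : qBar (dFactor n l a b) = (dFactor n l a b)⁻¹ := by
  rw [dFactor]
  split_ifs
  · rw [map_neg, qBar_qInv, inv_neg, inv_inv]
  · rw [map_one, inv_one]

theorem qBar_cf (a b : ℤ) : qBar (cf n l a b) = (cf n l a b)⁻¹ := by
  rw [cf, map_mul, qBar_dFactor, mul_inv]
  congr 1
  split_ifs
  · exact qBar_q
  · rw [map_one, inv_one]

theorem corrRange_self (a : ℤ) : corrRange n l a a = ∅ := by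
  simp [corrRange]

section

variable [NeZero n] [NeZero l]

theorem corr_add {a b j : ℤ} : (corr n l a b j).1 + (corr n l a b j).2 = a + b := by
  have h1 := letter_eq n l a
  have h2 := letter_eq n l b
  simp only [corr, cross, letter] at *
  linarith

theorem lt_corr_fst {a b j : ℤ} (hj : j ∈ corrRange n l a b) :
    a < (corr n l a b j).1 := by
  rw [lt_iff_parts (n := n) (l := l), corr, mPart_cross, dPart_cross, cPart_cross]
  rw [corrRange, Finset.mem_Icc] at hj
  split_ifs at hj <;> omega

theorem corr_fst_lt {a b j : ℤ} (hj : j ∈ corrRange n l a b) :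
    (corr n l a b j).1 < b := by
  rw [lt_iff_parts (n := n) (l := l), corr, mPart_cross, dPart_cross, cPart_cross]
  rw [corrRange, Finset.mem_Icc] at hj
  split_ifs at hj <;> omega

theorem lt_corr_snd {a b j : ℤ} (hj : j ∈ corrRange n l a b) :
    a < (corr n l a b j).2 := by
  have := corr_fst_lt hj
  have := corr_add (n := n) (l := l) (a := a) (b := b) (j := j)
  omega

theorem corr_snd_lt {a b j : ℤ} (hj : j ∈ corrRange n l a b) :
    (corr n l a b j).2 < b := by
  have := lt_corr_fst hj
  have := corr_add (n := n) (l := l) (a := a) (b := b) (j := j)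
  omega

theorem corr_energy_lt {a b j : ℤ} (hj : j ∈ corrRange n l a b) :
    (corr n l a b j).1.natAbs ^ 2 + (corr n l a b j).2.natAbs ^ 2
      < a.natAbs ^ 2 + b.natAbs ^ 2 := by
  have h1 := lt_corr_fst hj
  have h2 := corr_fst_lt hj
  have h3 := corr_add (n := n) (l := l) (a := a) (b := b) (j := j)
  generalize corr n l a b j = p at *
  zify
  simp only [sq_abs]
  have e : p.2 = a + b - p.1 := by linarith
  rw [e]
  nlinarith [mul_pos (sub_pos.mpr h1) (sub_pos.mpr h2)]

end

end Letters

/-! ### Words -/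

section Words

variable (n l : ℕ)

/-- The straightening relation for the letters `a`, `b` between the words `u` and `v`. -/
def wordRelation (u v : List ℤ) (a b : ℤ) : List ℤ →₀ Kq :=
  Finsupp.single (u ++ a :: b :: v) 1 -
    (straightenPair n l a b).mapDomain fun p => u ++ p.1 :: p.2 :: v

/-- The span of the straightening relations between words. -/
def wordRelations : Submodule Kq (List ℤ →₀ Kq) :=
  Submodule.span Kq {x | ∃ u v a b, a ≤ b ∧ x = wordRelation n l u v a b}

/-- The space spanned by the finite `q`-wedge products. -/
abbrev FiniteWedge : Type := (List ℤ →₀ Kq) ⧸ wordRelations n l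

/-- The `q`-wedge product of the letters of a word. -/
def cls (w : List ℤ) : FiniteWedge n l := (wordRelations n l).mkQ (Finsupp.single w 1)

/-- The word `w'` occurs in the result of one straightening of `w`. -/
def Step (w w' : List ℤ) : Prop :=
  ∃ u v a b p, a < b ∧ PairStep n l a b p ∧ w = u ++ a :: b :: v ∧ w' = u ++ p.1 :: p.2 :: v

/-- The word `w'` can be obtained from `w` by straightening. -/
def Reach (w w' : List ℤ) : Prop := Relation.ReflTransGen (Step n l) w w'

variable {n l}

theorem wordRelation_eq (u v : List ℤ) (a b : ℤ) : wordRelation n l u v a b =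
    Finsupp.single (u ++ a :: b :: v) 1 - (cf n l a b • Finsupp.single (u ++ b :: a :: v) 1 +
      (dFactor n l a b * hq) • ∑ j ∈ corrRange n l a b, Finsupp.single
        (u ++ (corr n l a b j).1 :: (corr n l a b j).2 :: v) 1) := by
  rw [wordRelation, straightenPair, ← Finsupp.lmapDomain_apply (M := Kq) (R := Kq)]
  simp only [map_add, map_smul, map_sum, Finsupp.lmapDomain_apply, Finsupp.mapDomain_single]

theorem cls_straighten (u v : List ℤ) {a b : ℤ} (h : a ≤ b) : cls n l (u ++ a :: b :: v) =
    cf n l a b • cls n l (u ++ b :: a :: v) + (dFactor n l a b * hq) • ∑ j ∈ corrRange n l a b,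
      cls n l (u ++ (corr n l a b j).1 :: (corr n l a b j).2 :: v) := by
  have h0 : (wordRelations n l).mkQ (wordRelation n l u v a b) = 0 := by
    rw [Submodule.mkQ_apply, Submodule.Quotient.mk_eq_zero]
    exact Submodule.subset_span ⟨u, v, a, b, h, rfl⟩
  rw [wordRelation_eq, map_sub, sub_eq_zero] at h0
  simp only [map_add, map_smul, map_sum] at h0
  exact h0

/-- For equal letters the straightening rule reads `u_a ∧ u_a = -u_a ∧ u_a`. -/
theorem cls_repeat (u v : List ℤ) (a : ℤ) : cls n l (u ++ a :: a :: v) = 0 := by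
  have h := cls_straighten (n := n) (l := l) u v (le_refl a)
  rw [corrRange_self, Finset.sum_empty, smul_zero, add_zero] at h
  have e : cf n l a a = -1 := by
    have := q_ne_zero
    rw [cf, dFactor, if_pos rfl, if_pos rfl, neg_mul, inv_mul_cancel₀ this]
  rw [e, neg_one_smul, eq_neg_iff_add_eq_zero, ← two_smul Kq] at h
  exact (smul_eq_zero.mp h).resolve_left two_ne_zero

variable (n l)

/-- The product of `cf a b` over all pairs of letters `a < b` with `a` to the left of `b`. -/
def ascentFactor : List ℤ → Kq
  | [] => 1
  | a :: w => (w.map fun b => if a < b then cf n l a b else 1).prod * ascentFactor w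

/-- The number of pairs of letters `a < b` with `a` to the left of `b`. -/
def ascents : List ℤ → ℕ
  | [] => 0
  | a :: w => w.countP (fun b => a < b) + ascents w

/-- The sum of the squares of the letters. -/
def energy (w : List ℤ) : ℕ := (w.map fun k => k.natAbs ^ 2).sum

variable {n l}

theorem ascents_swap (u v : List ℤ) {a b : ℤ} (h : a < b) :
    ascents (u ++ a :: b :: v) = ascents (u ++ b :: a :: v) + 1 := by
  induction u with
  | nil =>
    simp only [List.nil_append, ascents, List.countP_cons, h, not_lt.mpr h.le, decide_true,
      decide_false, if_true]
    simp
    omega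
  | cons x u ih =>
    rw [List.cons_append, List.cons_append, ascents, ascents, ih]
    have : (u ++ a :: b :: v).Perm (u ++ b :: a :: v) := (List.Perm.swap b a v).append_left u
    rw [this.countP_eq]
    omega

theorem ascentFactor_swap (u v : List ℤ) {a b : ℤ} (h : a < b) :
    ascentFactor n l (u ++ a :: b :: v) = cf n l a b * ascentFactor n l (u ++ b :: a :: v) := by
  induction u with
  | nil =>
    simp only [List.nil_append, ascentFactor, List.map_cons, List.prod_cons, if_pos h,
      if_neg (not_lt.mpr h.le)]
    ring
  | cons x u ih =>
    rw [List.cons_append, List.cons_append, ascentFactor, ascentFactor, ih]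
    have : (u ++ a :: b :: v).Perm (u ++ b :: a :: v) := (List.Perm.swap b a v).append_left u
    rw [(this.map _).prod_eq]
    ring

theorem ascentFactor_of_pairwise {w : List ℤ} (h : w.Pairwise (· ≥ ·)) :
    ascentFactor n l w = 1 := by
  induction w with
  | nil => rfl
  | cons a w ih =>
    rw [List.pairwise_cons] at h
    rw [ascentFactor, ih h.2, mul_one]
    apply List.prod_eq_one
    intro x hx
    obtain ⟨b, hb, rfl⟩ := List.mem_map.mp hx
    rw [if_neg (not_lt.mpr (h.1 b hb))]

theorem ascentFactor_mem_laurent (w : List ℤ) : ascentFactor n l w ∈ laurent := by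
  induction w with
  | nil => exact one_mem _
  | cons a w ih =>
    refine mul_mem (list_prod_mem fun x hx => ?_) ih
    obtain ⟨b, _, rfl⟩ := List.mem_map.mp hx
    split_ifs
    · exact cf_mem_laurent a b
    · exact one_mem _

theorem energy_append (u v : List ℤ) : energy (u ++ v) = energy u + energy v := by
  simp [energy]

theorem energy_perm {w w' : List ℤ} (h : w.Perm w') : energy w = energy w' :=
  (h.map _).sum_eq

theorem energy_pair (u v : List ℤ) (a b : ℤ) :
    energy (u ++ a :: b :: v) = energy u + energy v + (a.natAbs ^ 2 + b.natAbs ^ 2) := by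
  simp only [energy, List.map_append, List.map_cons, List.sum_append, List.sum_cons]
  ring

theorem energy_corr [NeZero n] [NeZero l] (u v : List ℤ) {a b j : ℤ}
    (hj : j ∈ corrRange n l a b) :
    energy (u ++ (corr n l a b j).1 :: (corr n l a b j).2 :: v) < energy (u ++ a :: b :: v) := by
  rw [energy_pair, energy_pair]
  have := corr_energy_lt hj
  omega

theorem exists_ascent {w : List ℤ} (h : ¬ w.Pairwise (· ≥ ·)) :
    ∃ u v a b, a < b ∧ w = u ++ a :: b :: v := by
  rw [← List.isChain_iff_pairwise] at h
  induction w with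
  | nil => simp at h
  | cons a w ih =>
    cases w with
    | nil => simp at h
    | cons b v =>
      by_cases hab : a < b
      · exact ⟨[], v, a, b, hab, rfl⟩
      · rw [List.isChain_cons_cons] at h
        obtain ⟨u, v', a', b', h1, h2⟩ := ih fun hc => h ⟨not_lt.mp hab, hc⟩
        exact ⟨a :: u, v', a', b', h1, by rw [h2, List.cons_append]⟩

/-- The word sorted into weakly decreasing order. -/
abbrev sortWord (w : List ℤ) : List ℤ := w.insertionSort (· ≥ ·)

theorem sortWord_eq_of_perm {w w' : List ℤ} (h : w.Perm w') : sortWord w = sortWord w' :=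
  List.Perm.eq_of_pairwise (le := (· ≥ ·)) (fun _ _ _ _ h1 h2 => le_antisymm h2 h1)
    (List.pairwise_insertionSort _ _) (List.pairwise_insertionSort _ _)
    ((List.perm_insertionSort _ w).trans (h.trans (List.perm_insertionSort _ w').symm))

theorem perm_swap (u v : List ℤ) (a b : ℤ) : (u ++ a :: b :: v).Perm (u ++ b :: a :: v) :=
  (List.Perm.swap b a v).append_left u

theorem step_swap (u v : List ℤ) {a b : ℤ} (h : a < b) :
    Step n l (u ++ a :: b :: v) (u ++ b :: a :: v) :=
  ⟨u, v, a, b, (b, a), h, Or.inl rfl, rfl, rfl⟩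

theorem step_corr (u v : List ℤ) {a b j : ℤ} (h : a < b) (hj : j ∈ corrRange n l a b) :
    Step n l (u ++ a :: b :: v) (u ++ (corr n l a b j).1 :: (corr n l a b j).2 :: v) :=
  ⟨u, v, a, b, corr n l a b j, h, Or.inr ⟨j, hj, rfl⟩, rfl, rfl⟩

theorem reach_sortWord (w : List ℤ) : Reach n l w (sortWord w) := by
  generalize hk : ascents w = k
  induction k generalizing w with
  | zero =>
    have : w.Pairwise (· ≥ ·) := by
      by_contra hc
      obtain ⟨u, v, a, b, h, rfl⟩ := exists_ascent hc
      rw [ascents_swap u v h] at hk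
      omega
    rw [sortWord, this.insertionSort_eq]
    exact Relation.ReflTransGen.refl
  | succ k ih =>
    by_cases hc : w.Pairwise (· ≥ ·)
    · rw [sortWord, hc.insertionSort_eq]
      exact Relation.ReflTransGen.refl
    · obtain ⟨u, v, a, b, h, rfl⟩ := exists_ascent hc
      rw [ascents_swap u v h, Nat.add_right_cancel_iff] at hk
      refine Relation.ReflTransGen.head (step_swap u v h) ?_
      have := ih _ hk
      rwa [sortWord_eq_of_perm (perm_swap u v a b)]

variable (n l)

/-- The ordered words that can be obtained from `w` by straightening, and satisfy `Q`. -/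
def straightenSpan (w : List ℤ) (Q : List ℤ → Prop) : Submodule laurent (FiniteWedge n l) :=
  Submodule.span laurent
    (cls n l '' {w' | w'.Pairwise (· > ·) ∧ Reach n l w w' ∧ Q w'})

variable {n l}

theorem straightenSpan_mono {w w' : List ℤ} {Q Q' : List ℤ → Prop} (h : Reach n l w w')
    (hQ : ∀ w, Q' w → Q w) : straightenSpan n l w' Q' ≤ straightenSpan n l w Q :=
  Submodule.span_mono (Set.image_mono fun _ ⟨h1, h2, h3⟩ => ⟨h1, h.trans h2, hQ _ h3⟩)

theorem laurent_smul_mem {M : Type*} [AddCommGroup M] [Module Kq M] (N : Submodule laurent M)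
    {c : Kq} (hc : c ∈ laurent) {x : M} (hx : x ∈ N) : c • x ∈ N :=
  N.smul_mem (⟨c, hc⟩ : laurent) hx

theorem cls_sortWord_eq_zero {w : List ℤ}
    (h : ¬ (sortWord w).Pairwise (· > ·)) : cls n l (sortWord w) = 0 := by
  have hs : (sortWord w).Pairwise (· ≥ ·) := List.pairwise_insertionSort _ _
  generalize sortWord w = w' at *
  rw [← List.isChain_iff_pairwise] at h hs
  obtain ⟨u, v, a, rfl⟩ : ∃ u v a, w' = u ++ a :: a :: v := by
    clear w
    induction w' with
    | nil => simp at h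
    | cons a w ih =>
      cases w with
      | nil => simp at h
      | cons b v =>
        rw [List.isChain_cons_cons] at h hs
        by_cases hab : a = b
        · exact ⟨[], v, a, by rw [hab]; rfl⟩
        · obtain ⟨u, v', a', h2⟩ := ih (fun hc => h ⟨lt_of_le_of_ne hs.1 (Ne.symm hab), hc⟩) hs.2
          exact ⟨a :: u, v', a', by rw [h2, List.cons_append]⟩
  exact cls_repeat u v a

theorem cls_sortWord_mem {w : List ℤ} {Q : List ℤ → Prop}
    (hQ : Q (sortWord w)) : cls n l (sortWord w) ∈ straightenSpan n l w Q := by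
  by_cases h : (sortWord w).Pairwise (· > ·)
  · exact Submodule.subset_span ⟨_, ⟨h, reach_sortWord w, hQ⟩, rfl⟩
  · rw [cls_sortWord_eq_zero h]
    exact zero_mem _

/-- Straightening is triangular with respect to the energy. -/
theorem cls_sub_sortWord_mem [NeZero n] [NeZero l] (w : List ℤ) :
    cls n l w - ascentFactor n l w • cls n l (sortWord w) ∈
      straightenSpan n l w fun w' => energy w' < energy w := by
  generalize he : energy w = e
  induction e using Nat.strong_induction_on generalizing w with
  | _ e ihe =>
  generalize hk : ascents w = k
  induction k using Nat.strong_induction_on generalizing w with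
  | _ k ihk =>
  by_cases hc : w.Pairwise (· ≥ ·)
  · rw [sortWord, hc.insertionSort_eq, ascentFactor_of_pairwise hc, one_smul, sub_self]
    exact zero_mem _
  obtain ⟨u, v, a, b, h, rfl⟩ := exists_ascent hc
  have h1 := ihk _ (by rw [← hk, ascents_swap u v h]; omega) (u ++ b :: a :: v)
    (by rw [← he, energy_perm (perm_swap u v a b)]) rfl
  have h2 : ∀ j ∈ corrRange n l a b,
      cls n l (u ++ (corr n l a b j).1 :: (corr n l a b j).2 :: v) ∈
        straightenSpan n l (u ++ a :: b :: v) fun w' => energy w' < e := by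
    intro j hj
    have hlt := energy_corr (n := n) (l := l) u v hj
    rw [he] at hlt
    have h3 := ihe _ hlt _ rfl
    have h4 := cls_sortWord_mem (n := n) (l := l)
      (w := u ++ (corr n l a b j).1 :: (corr n l a b j).2 :: v) (Q := fun w' => energy w' < e)
      (by rwa [energy_perm (List.perm_insertionSort _ _)])
    have h5 := add_mem (straightenSpan_mono Relation.ReflTransGen.refl
      (fun w hw => lt_trans hw hlt) h3)
      (laurent_smul_mem _ (ascentFactor_mem_laurent (n := n) (l := l)
        (u ++ (corr n l a b j).1 :: (corr n l a b j).2 :: v)) h4)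
    rw [sub_add_cancel] at h5
    exact straightenSpan_mono (Relation.ReflTransGen.single (step_corr u v h hj))
      (fun _ h => h) h5
  rw [cls_straighten u v h.le, ascentFactor_swap u v h, sortWord_eq_of_perm (perm_swap u v a b),
    mul_smul (cf n l a b), add_sub_right_comm, ← smul_sub]
  refine add_mem (laurent_smul_mem _ (cf_mem_laurent a b) ?_)
    (laurent_smul_mem _ (mul_mem (dFactor_mem_laurent a b) hq_mem_laurent) (sum_mem h2))
  exact straightenSpan_mono (Relation.ReflTransGen.single (step_swap u v h)) (fun _ h => h) h1

/-- Every word is a combination of ordered words. -/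
theorem cls_mem_straightenSpan [NeZero n] [NeZero l] (w : List ℤ) :
    cls n l w ∈ straightenSpan n l w fun w' => energy w' ≤ energy w := by
  have h1 := straightenSpan_mono (Relation.ReflTransGen.refl) (fun _ h => le_of_lt h)
    (cls_sub_sortWord_mem (n := n) (l := l) w)
  have h2 := cls_sortWord_mem (n := n) (l := l) (w := w) (Q := fun w' => energy w' ≤ energy w)
    (energy_perm (List.perm_insertionSort _ _)).le
  have := add_mem h1 (laurent_smul_mem _ (ascentFactor_mem_laurent (n := n) (l := l) w) h2)
  rwa [sub_add_cancel] at this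

end Words

/-! ### Linear independence of the ordered words -/

/-- Replace the entries `i`, `i + 1`. -/
def place (κ : Triples) (i : ℕ) (p : (ℤ × ℤ) × (ℤ × ℤ)) (d : ℤ × ℤ) : Triples :=
  (setTwo κ.1 i p, setTwo κ.2 i d)

theorem place_getTwo (κ : Triples) (i : ℕ) : place κ i (getTwo κ.1 i) (getTwo κ.2 i) = κ :=
  Prod.ext (setTwo_getTwo _ _) (setTwo_getTwo _ _)

theorem opA_place (κ : Triples) (i : ℕ) (a m b p : ℤ) (d : ℤ × ℤ) :
    opA i (Finsupp.single (place κ i ((a, m), (b, p)) d) 1) =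
      (if a = b then q else 1 : Kq) • Finsupp.single (place κ i ((b, p), (a, m)) d) 1 +
      (if a < b then hq else 0 : Kq) • Finsupp.single (place κ i ((a, p), (b, m)) d) 1 +
      hq • signedSum (fun k => Finsupp.single (place κ i ((a, k), (b, m + p - k)) d) (1 : Kq))
        p m := by
  rw [opA, localOp_single]
  dsimp only [place]
  rw [getTwo_setTwo]
  simp only [setTwo_setTwo]
  rw [demazureLusztig, ← Finsupp.lmapDomain_apply (M := Kq) (R := Kq)]
  simp only [map_add, map_smul, map_signedSum, Finsupp.lmapDomain_apply, Finsupp.mapDomain_single]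

theorem opB_place (κ : Triples) (i : ℕ) (p : (ℤ × ℤ) × (ℤ × ℤ)) (d : ℤ × ℤ) :
    opB i (Finsupp.single (place κ i p d) 1) =
      (if d.1 = d.2 then -q⁻¹ else 1 : Kq) • Finsupp.single (place κ i p (d.2, d.1)) 1 +
      (if d.1 < d.2 then hq else 0 : Kq) • Finsupp.single (place κ i p d) 1 := by
  rw [opB, localOp_single]
  dsimp only [place]
  rw [getTwo_setTwo]
  simp only [setTwo_setTwo]
  rw [jimbo, ← Finsupp.lmapDomain_apply (M := Kq) (R := Kq)]
  simp only [map_add, map_smul, Finsupp.lmapDomain_apply, Finsupp.mapDomain_single]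

theorem signedSum_of_le {M : Type*} [AddCommGroup M] (g : ℤ → M) {p m : ℤ} (h : p ≤ m) :
    signedSum g p m = ∑ j ∈ Finset.Icc 1 (m - p), g (p + j) := by
  rw [signedSum, Finset.Ioc_eq_empty (not_lt.mpr h), Finset.sum_empty, sub_zero]
  refine Finset.sum_bij' (fun i _ => i - p) (fun j _ => p + j) ?_ ?_ ?_ ?_ ?_
  · intro i hi; rw [Finset.mem_Ioc] at hi; rw [Finset.mem_Icc]; omega
  · intro i hi; rw [Finset.mem_Icc] at hi; rw [Finset.mem_Ioc]; omega
  · intro i _; ring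
  · intro i _; ring
  · intro i _; congr 1; ring

theorem sum_Icc_eq_signedSum {M : Type*} [AddCommGroup M] (g : ℤ → M) {p m : ℤ} (a b : ℤ)
    (h : p ≤ m) : ∑ j ∈ Finset.Icc (if b ≤ a then 1 else 0) (m - p), g (p + j) =
      (if a < b then g p else 0) + signedSum g p m := by
  rw [signedSum_of_le g h]
  by_cases hab : a < b
  · rw [if_neg (not_le.mpr hab), if_pos hab]
    have : Finset.Icc 0 (m - p) = insert 0 (Finset.Icc 1 (m - p)) := by
      ext i; simp only [Finset.mem_Icc, Finset.mem_insert]; omega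
    rw [this, Finset.sum_insert (by simp), add_zero]
  · rw [if_pos (not_lt.mp hab), if_neg hab, zero_add]

theorem sum_Icc_top {M : Type*} [AddCommGroup M] (g : ℤ → M) {p m : ℤ} (h : p ≤ m) :
    ∑ j ∈ Finset.Icc p (m - 1), g j = ∑ j ∈ Finset.Icc p m, g j - g m := by
  have : Finset.Icc p m = insert m (Finset.Icc p (m - 1)) := by
    ext i; simp only [Finset.mem_Icc, Finset.mem_insert]; omega
  rw [this, Finset.sum_insert (by simp)]
  abel

theorem q_add_qInv_ne_zero : q + q⁻¹ ≠ 0 := by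
  have h0 := q_ne_zero
  intro h
  have h1 : q ^ 2 + 1 = 0 := by
    have : q ^ 2 + 1 = q * (q + q⁻¹) := by field_simp
    rw [this, h, mul_zero]
  have h2 : evalAt q (Polynomial.X ^ 2 + 1) = evalAt q 0 := by
    rw [map_add, map_pow, evalAt_X, map_one, map_zero, h1]
  have h3 := congrArg (Polynomial.eval 0) (evalAt_q_injective h2)
  simp at h3

section Letters

variable {n l : ℕ} [NeZero n] [NeZero l]

variable (n l) in
/-- The basis vector with the letters `x.1`, `x.2` at the positions `i`, `i + 1`. -/
def twoLetters (κ : Triples) (i : ℕ) (x : ℤ × ℤ) : Triples →₀ Kq :=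
  Finsupp.single (place κ i ((cPart n x.1, mPart n l x.1), (cPart n x.2, mPart n l x.2))
    (dPart n l x.1, dPart n l x.2)) 1

theorem mPart_le_of_le {a b : ℤ} (h : a ≤ b) : mPart n l b ≤ mPart n l a := by
  rcases h.lt_or_eq with h | rfl
  · rw [lt_iff_parts (n := n) (l := l)] at h
    omega
  · exact le_rfl

/-- The straightening relations lie in the images of the operators `A_i - B_i`. -/
theorem straighten_mem_range (κ : Triples) (i : ℕ) {a b : ℤ} (h : a ≤ b) :
    twoLetters n l κ i (a, b) - (cf n l a b • twoLetters n l κ i (b, a) + (dFactor n l a b * hq) •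
      ∑ j ∈ corrRange n l a b, twoLetters n l κ i (corr n l a b j)) ∈
        LinearMap.range (opA i - opB i) := by
  set d : ℤ × ℤ := (dPart n l b, dPart n l a) with hd
  set y : Triples →₀ Kq := Finsupp.single
    (place κ i ((cPart n a, mPart n l a), (cPart n b, mPart n l b)) d) 1 with hy
  set g : ℤ → Triples →₀ Kq := fun k => Finsupp.single
    (place κ i ((cPart n a, k), (cPart n b, mPart n l a + mPart n l b - k)) d) 1 with hg
  have hcorr : ∀ j, twoLetters n l κ i (corr n l a b j) = g (mPart n l b + j) := by
    intro j
    simp only [hg, twoLetters, corr, cPart_cross, mPart_cross, dPart_cross, hd]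
    rw [show mPart n l a - j = mPart n l a + mPart n l b - (mPart n l b + j) by ring]
  have htop : g (mPart n l a) = y := by
    simp only [hg, hy, add_sub_cancel_left]
  have hm := mPart_le_of_le (n := n) (l := l) h
  have hA : opA i y = (if cPart n a = cPart n b then q else 1 : Kq) • twoLetters n l κ i (b, a) +
      hq • ∑ j ∈ Finset.Icc (if cPart n b ≤ cPart n a then 1 else 0) (mPart n l a - mPart n l b),
        g (mPart n l b + j) := by
    rw [hy, opA_place, sum_Icc_eq_signedSum g _ _ hm, smul_add, add_assoc]
    congr 1
    congr 1
    split_ifs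
    · simp only [hg, add_sub_cancel_right]
    · simp
  have hsum : (if cPart n b ≤ cPart n a then 1 else 0) ≤ mPart n l a - mPart n l b →
      ∑ j ∈ Finset.Icc (if cPart n b ≤ cPart n a then 1 else 0) (mPart n l a - mPart n l b - 1),
        g (mPart n l b + j) = ∑ j ∈ Finset.Icc (if cPart n b ≤ cPart n a then 1 else 0)
          (mPart n l a - mPart n l b), g (mPart n l b + j) - y := by
    intro hle
    rw [sum_Icc_top (fun j => g (mPart n l b + j)) hle, ← htop]
    congr 2
    ring
  simp only [hcorr, corrRange]
  rcases lt_trichotomy (dPart n l a) (dPart n l b) with hlt | heq | hgt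
  · refine ⟨-y, ?_⟩
    have hB : opB i y = twoLetters n l κ i (a, b) := by
      rw [hy, opB_place, hd, if_neg (by omega), if_neg (by omega), one_smul, zero_smul, add_zero]
      rfl
    rw [map_neg, LinearMap.sub_apply, hA, hB, cf, dFactor, if_neg hlt.ne, if_neg (not_le.mpr hlt),
      sub_zero, one_mul, one_mul]
    abel
  · have hy' : twoLetters n l κ i (a, b) = y := by
      rw [hy, twoLetters, hd]
      simp only [heq]
    have hB : opB i y = (-q⁻¹) • y := by
      rw [hy, opB_place, hd]
      dsimp only
      rw [if_pos heq.symm, if_neg (by omega), zero_smul, add_zero, heq]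
    have h0 := q_ne_zero
    rcases h.lt_or_eq with hlt | rfl
    · refine ⟨q⁻¹ • y, ?_⟩
      rw [lt_iff_parts (n := n) (l := l)] at hlt
      rw [map_smul, LinearMap.sub_apply, hA, hB, cf, dFactor, if_pos heq, if_pos heq.ge,
        hsum (by split_ifs <;> omega), hy']
      generalize (∑ j ∈ _, g (mPart n l b + j)) = S
      generalize twoLetters n l κ i (b, a) = T
      generalize (if cPart n a = cPart n b then q else 1 : Kq) = t
      ext x
      simp only [Finsupp.add_apply, Finsupp.sub_apply, Finsupp.smul_apply, smul_eq_mul, hq]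
      field_simp
      ring
    · refine ⟨((q + q⁻¹)⁻¹ * 2) • y, ?_⟩
      have hq2 := q_add_qInv_ne_zero
      rw [map_smul, LinearMap.sub_apply, hA, hB, cf, dFactor, if_pos rfl, if_pos rfl, hy',
        if_pos le_rfl, if_pos le_rfl, sub_self]
      simp only [show ¬ ((1 : ℤ) ≤ 0) by omega, show ¬ ((1 : ℤ) ≤ 0 - 1) by omega,
        Finset.Icc_eq_empty, not_false_eq_true, Finset.sum_empty, smul_zero, add_zero]
      rw [← sub_smul, smul_smul, sub_neg_eq_add, mul_right_comm, inv_mul_cancel₀ hq2, one_mul,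
        neg_mul, inv_mul_cancel₀ h0, neg_one_smul, sub_neg_eq_add, two_smul]
  · refine ⟨-y, ?_⟩
    have hB : opB i y = twoLetters n l κ i (a, b) + hq • y := by
      rw [hy, opB_place, hd, if_neg (by omega), if_pos (by omega), one_smul]
      rfl
    have hlt : a < b := lt_of_le_of_ne h (by rintro rfl; omega)
    rw [lt_iff_parts (n := n) (l := l)] at hlt
    rw [map_neg, LinearMap.sub_apply, hA, hB, cf, dFactor, if_neg hgt.ne', if_pos hgt.le,
      hsum (by split_ifs <;> omega), one_mul, one_mul, smul_sub]
    abel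

end Letters

section Words

variable (n l : ℕ)

/-- The sequence of the triples `(c, m, d)` of the letters of a word, padded by zeros. -/
def wordTriples (w : List ℤ) : Triples :=
  (fun i => (cPart n (w.getD i 0), mPart n l (w.getD i 0)), fun i => dPart n l (w.getD i 0))

/-- The linear map that sends the words of length `r` to the sequences of their triples, and the
other words to `0`. -/
def toTriples (r : ℕ) : (List ℤ →₀ Kq) →ₗ[Kq] (Triples →₀ Kq) :=
  Finsupp.linearCombination Kq fun w =>
    if w.length = r then Finsupp.single (wordTriples n l w) 1 else 0

variable {n l}

theorem toTriples_single {r : ℕ} {w : List ℤ} (h : w.length = r) :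
    toTriples n l r (Finsupp.single w 1) = Finsupp.single (wordTriples n l w) 1 := by
  rw [toTriples, Finsupp.linearCombination_single, one_smul, if_pos h]

theorem toTriples_single_of_ne {r : ℕ} {w : List ℤ} (h : w.length ≠ r) :
    toTriples n l r (Finsupp.single w 1) = 0 := by
  rw [toTriples, Finsupp.linearCombination_single, if_neg h, smul_zero]

theorem getD_pair (u v : List ℤ) (a b : ℤ) (i : ℕ) : (u ++ a :: b :: v).getD i 0 =
    if i = u.length then a else if i = u.length + 1 then b else (u ++ 0 :: 0 :: v).getD i 0 := by
  rcases Nat.lt_or_ge i u.length with h | h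
  · rw [if_neg (by omega), if_neg (by omega), List.getD_append _ _ _ _ h,
      List.getD_append _ _ _ _ h]
  · rw [List.getD_append_right _ _ _ _ h, List.getD_append_right _ _ _ _ h]
    obtain ⟨k, rfl⟩ := Nat.exists_eq_add_of_le h
    rw [Nat.add_sub_cancel_left]
    rcases k with _ | _ | k
    · simp
    · simp
    · rw [if_neg (by omega), if_neg (by omega)]
      rfl

theorem single_wordTriples (u v : List ℤ) (a b : ℤ) :
    Finsupp.single (wordTriples n l (u ++ a :: b :: v)) (1 : Kq) =
      twoLetters n l (wordTriples n l (u ++ 0 :: 0 :: v)) u.length (a, b) := by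
  rw [twoLetters]
  congr 1
  refine Prod.ext ?_ ?_
  · funext i
    simp only [wordTriples, place, setTwo]
    rw [getD_pair u v a b]
    split_ifs <;> rfl
  · funext i
    simp only [wordTriples, place, setTwo]
    rw [getD_pair u v a b]
    split_ifs <;> rfl

theorem Step.length_eq {w w' : List ℤ} (h : Step n l w w') : w.length = w'.length := by
  obtain ⟨u, v, a, b, p, -, -, rfl, rfl⟩ := h
  simp

theorem toTriples_eq_mapDomain {r : ℕ} {z : List ℤ →₀ Kq} (hz : ∀ w, z w ≠ 0 → w.length = r) :
    toTriples n l r z = z.mapDomain (wordTriples n l) := by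
  rw [toTriples, Finsupp.linearCombination_apply, Finsupp.mapDomain]
  refine Finset.sum_congr rfl fun w hw => ?_
  dsimp only
  rw [if_pos (hz w (Finsupp.mem_support_iff.mp hw)), Finsupp.smul_single, smul_eq_mul, mul_one]

variable [NeZero n] [NeZero l]

theorem wordTriples_injOn (r : ℕ) : Set.InjOn (wordTriples n l) {w | w.length = r} := by
  intro w (hw : w.length = r) w' (hw' : w'.length = r) h
  apply List.ext_getElem (hw.trans hw'.symm)
  intro i h1 h2
  have e1 := congrFun (congrArg Prod.fst h) i
  have e2 := congrFun (congrArg Prod.snd h) i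
  simp only [wordTriples, Prod.mk.injEq, List.getD_eq_getElem _ _ h1, List.getD_eq_getElem _ _ h2]
    at e1 e2
  exact eq_of_parts e1.1 e2 e1.2

/-- Relations between words are relations between sequences of triples. -/
theorem toTriples_mem {m : ℕ} {z : List ℤ →₀ Kq} (hz : z ∈ wordRelations n l) :
    toTriples n l (m + 1) z ∈ ⨆ i : Fin m, LinearMap.range (opA i - opB i) := by
  suffices h : wordRelations n l ≤
      (⨆ i : Fin m, LinearMap.range (opA i - opB i)).comap (toTriples n l (m + 1)) from h hz
  refine Submodule.span_le.mpr ?_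
  rintro _ ⟨u, v, a, b, hab, rfl⟩
  rw [SetLike.mem_coe, Submodule.mem_comap, wordRelation_eq]
  simp only [map_sub, map_add, map_smul, map_sum]
  by_cases h : (u ++ a :: b :: v).length = m + 1
  · have hlen : ∀ x y : ℤ, (u ++ x :: y :: v).length = m + 1 := by
      intro x y
      rw [← h]
      simp
    simp only [toTriples_single (hlen _ _), single_wordTriples]
    have hi : u.length < m := by
      simp only [List.length_append, List.length_cons] at h
      omega
    exact Submodule.mem_iSup_of_mem (⟨u.length, hi⟩ : Fin m)
      (straighten_mem_range _ _ hab)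
  · have hlen : ∀ x y : ℤ, (u ++ x :: y :: v).length ≠ m + 1 := by
      intro x y hc
      apply h
      rw [← hc]
      simp
    simp only [toTriples_single_of_ne (hlen _ _), Finset.sum_const_zero, smul_zero, add_zero,
      sub_zero]
    exact zero_mem _

theorem eq_zero_of_toTriples_mem {m : ℕ} {z : List ℤ →₀ Kq}
    (hz : ∀ w, z w ≠ 0 → w.Pairwise (· > ·) ∧ w.length = m + 1)
    (h : toTriples n l (m + 1) z ∈ ⨆ i : Fin m, LinearMap.range (opA i - opB i)) : z = 0 := by
  classical
  rw [toTriples_eq_mapDomain fun w hw => (hz w hw).2] at h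
  have h0 := eq_zero_of_mem_iSup_range (lt := fun x y => ∃ k k' : ℤ, k < k' ∧
      x = ((cPart n k, mPart n l k), dPart n l k) ∧ y = ((cPart n k', mPart n l k'), dPart n l k'))
    ?_ m ?_ h
  · have hz' : ∀ w ∈ (z.support : Set (List ℤ)), w ∈ {w : List ℤ | w.length = m + 1} :=
      fun w hw => (hz w (Finsupp.mem_support_iff.mp hw)).2
    refine Finsupp.mapDomain_injOn {w : List ℤ | w.length = m + 1}
      (wordTriples_injOn (n := n) (l := l) (m + 1)) hz' ?_ ?_
    · simp
    · rw [h0, Finsupp.mapDomain_zero]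
  · rintro x y ⟨k, k', h1, rfl, rfl⟩ ⟨j, j', h2, h3, h4⟩
    simp only [Prod.mk.injEq] at h3 h4
    have e1 := eq_of_parts h3.1.1 h3.2 h3.1.2
    have e2 := eq_of_parts h4.1.1 h4.2 h4.1.2
    omega
  · intro κ hκ
    obtain ⟨w, hw, rfl⟩ := Finset.mem_image.mp
      (Finsupp.mapDomain_support (Finsupp.mem_support_iff.mpr hκ))
    obtain ⟨h1, h2⟩ := hz w (Finsupp.mem_support_iff.mp hw)
    intro a b hab hb
    refine ⟨_, _, ?_, rfl, rfl⟩
    rw [List.getD_eq_getElem _ _ (by omega), List.getD_eq_getElem _ _ (by omega)]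
    exact List.pairwise_iff_getElem.mp h1 a b _ _ hab

/-- The ordered words of a given length are linearly independent. -/
theorem eq_zero_of_mem_wordRelations {m : ℕ} {z : List ℤ →₀ Kq}
    (hz : ∀ w, z w ≠ 0 → w.Pairwise (· > ·) ∧ w.length = m + 1)
    (h : z ∈ wordRelations n l) : z = 0 :=
  eq_zero_of_toTriples_mem hz (toTriples_mem h)

end Words

/-! ### The bar involution on finite wedges -/

section Flip

/-- The semilinear map that exchanges the entries `0` and `1`. -/
def flip : (Triples →₀ Kq) →ₛₗ[qBar] (Triples →₀ Kq) :=
  semilinearExt fun κ => Finsupp.single (swapEntries 0 κ) 1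

theorem flip_place (κ : Triples) (x y : ℤ × ℤ) (d : ℤ × ℤ) :
    flip (Finsupp.single (place κ 0 (x, y) d) 1) = Finsupp.single (place κ 0 (y, x) (d.2, d.1)) 1 := by
  rw [flip, semilinearExt_single, map_one, one_smul, swapEntries, place]
  simp only [getTwo_setTwo, setTwo_setTwo]
  rfl

theorem flip_smul_place (c : Kq) (κ : Triples) (x y : ℤ × ℤ) (d : ℤ × ℤ) :
    flip (c • Finsupp.single (place κ 0 (x, y) d) 1) =
      qBar c • Finsupp.single (place κ 0 (y, x) (d.2, d.1)) 1 := by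
  rw [LinearMap.map_smulₛₗ, flip_place]

/-- Exchanging the two entries conjugates `A` into its inverse. -/
theorem flip_opA (κ : Triples) : flip (opA 0 (Finsupp.single κ 1)) =
    opA 0 (flip (Finsupp.single κ 1)) - hq • flip (Finsupp.single κ 1) := by
  rw [← place_getTwo κ 0]
  generalize getTwo κ.2 0 = d
  obtain ⟨⟨a, m⟩, ⟨b, p⟩⟩ := getTwo κ.1 0
  rw [flip_place, opA_place, opA_place, map_add, map_add, flip_smul_place, flip_smul_place,
    LinearMap.map_smulₛₗ, map_signedSum, qBar_hq]
  simp only [flip_place]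
  set g : ℤ → Triples →₀ Kq := fun k =>
    Finsupp.single (place κ 0 ((b, k), (a, p + m - k)) (d.2, d.1)) 1 with hg
  have e1 : signedSum (fun k => (Finsupp.single (place κ 0 ((b, m + p - k), (a, k)) (d.2, d.1)) 1 :
      Triples →₀ Kq)) p m = signedSum g p m + g p - g m := by
    have h1 := signedSum_reflect g (m + p) p m
    have h2 := signedSum_succ_left g (p - 1) (m - 1)
    have h3 := signedSum_succ g p (m - 1)
    rw [sub_add_cancel] at h2 h3
    rw [show m + p - m - 1 = p - 1 by ring, show m + p - p - 1 = m - 1 by ring,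
      eq_add_of_sub_eq h2.symm, eq_sub_of_add_eq h3.symm] at h1
    rw [sub_add_eq_add_sub] at h1
    rw [← h1]
    congr 1
    funext k
    simp only [hg]
    rw [show p + m - (m + p - k) = k by ring]
  have e2 : signedSum (fun k => (Finsupp.single (place κ 0 ((b, k), (a, p + m - k)) (d.2, d.1)) 1 :
      Triples →₀ Kq)) m p = - signedSum g p m := signedSum_neg _ _ _
  have e3 : (Finsupp.single (place κ 0 ((b, p), (a, m)) (d.2, d.1)) 1 : Triples →₀ Kq) = g p := by
    simp only [hg, add_sub_cancel_left]
  have e4 : (Finsupp.single (place κ 0 ((b, m), (a, p)) (d.2, d.1)) 1 : Triples →₀ Kq) = g m := by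
    simp only [hg, add_sub_cancel_right]
  rw [e1, e2, e3, e4]
  generalize signedSum g p m = S
  have h0 := q_ne_zero
  rcases lt_trichotomy a b with h | rfl | h
  · rw [if_neg h.ne, if_neg h.ne', if_pos h, if_neg h.not_gt, map_one, qBar_hq]
    ext x
    simp only [Finsupp.add_apply, Finsupp.sub_apply, Finsupp.smul_apply, smul_eq_mul, Finsupp.neg_apply]
    ring1
  · have e5 : (Finsupp.single (place κ 0 ((a, m), (a, p)) (d.2, d.1)) 1 : Triples →₀ Kq) = g m := e4
    rw [if_pos rfl, if_neg (lt_irrefl a), e5, map_zero, qBar_q]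
    ext x
    simp only [Finsupp.add_apply, Finsupp.sub_apply, Finsupp.smul_apply, smul_eq_mul,
      Finsupp.neg_apply, hq, zero_mul]
    ring1
  · rw [if_neg h.ne, if_neg h.ne', if_pos h, if_neg h.not_gt, map_one, map_zero]
    ext x
    simp only [Finsupp.add_apply, Finsupp.sub_apply, Finsupp.smul_apply, smul_eq_mul, Finsupp.neg_apply]
    ring1

theorem flip_opB (κ : Triples) : flip (opB 0 (Finsupp.single κ 1)) =
    opB 0 (flip (Finsupp.single κ 1)) - hq • flip (Finsupp.single κ 1) := by
  rw [← place_getTwo κ 0]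
  obtain ⟨a, b⟩ := getTwo κ.2 0
  obtain ⟨x, y⟩ := getTwo κ.1 0
  rw [flip_place, opB_place, opB_place, map_add, flip_smul_place, flip_smul_place]
  dsimp only
  rcases lt_trichotomy a b with h | rfl | h
  · rw [if_neg h.ne, if_neg h.ne', if_pos h, if_neg h.not_gt, map_one, qBar_hq]
    ext x
    simp only [Finsupp.add_apply, Finsupp.sub_apply, Finsupp.smul_apply, smul_eq_mul]
    ring1
  · rw [if_pos rfl, if_neg (lt_irrefl a), map_zero, map_neg, qBar_qInv]
    ext x
    simp only [Finsupp.add_apply, Finsupp.sub_apply, Finsupp.smul_apply, smul_eq_mul, hq]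
    ring1
  · rw [if_neg h.ne, if_neg h.ne', if_pos h, if_neg h.not_gt, map_one, map_zero]
    ext x
    simp only [Finsupp.add_apply, Finsupp.sub_apply, Finsupp.smul_apply, smul_eq_mul]
    ring1

/-- The correction terms of the conjugates of `A` and `B` cancel in `A - B`. -/
theorem flip_mem_range {z : Triples →₀ Kq} (hz : z ∈ LinearMap.range (opA 0 - opB 0)) :
    flip z ∈ LinearMap.range (opA 0 - opB 0) := by
  obtain ⟨y, rfl⟩ := hz
  refine ⟨flip y, ?_⟩
  induction y using Finsupp.induction_linear with
  | zero => simp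
  | add x y hx hy => simp only [map_add, hx, hy]
  | single κ c =>
    rw [← mul_one c, ← smul_eq_mul, ← Finsupp.smul_single, LinearMap.map_smulₛₗ flip,
      (opA 0 - opB 0).map_smul, (opA 0 - opB 0).map_smul, LinearMap.map_smulₛₗ flip,
      LinearMap.sub_apply, LinearMap.sub_apply, map_sub, flip_opA, flip_opB]
    congr 1
    abel

end Flip

section Words

variable (n l : ℕ)

/-- The product of the inverses of `cf a b` over all pairs of letters. -/
def barFactor : List ℤ → Kq
  | [] => 1
  | a :: w => (w.map fun b => (cf n l a b)⁻¹).prod * barFactor w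

variable {n l}

theorem cf_inv_mem_laurent (a b : ℤ) : (cf n l a b)⁻¹ ∈ laurent := by
  rw [← qBar_cf]
  exact qBar_mem_laurent (cf_mem_laurent a b)

theorem barFactor_mem_laurent (w : List ℤ) : barFactor n l w ∈ laurent := by
  induction w with
  | nil => exact one_mem _
  | cons a w ih =>
    refine mul_mem (list_prod_mem fun x hx => ?_) ih
    obtain ⟨b, _, rfl⟩ := List.mem_map.mp hx
    exact cf_inv_mem_laurent a b

theorem barFactor_ne_zero (w : List ℤ) : barFactor n l w ≠ 0 := by
  induction w with
  | nil => exact one_ne_zero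
  | cons a w ih =>
    refine mul_ne_zero (List.prod_ne_zero fun h => ?_) ih
    obtain ⟨b, _, h⟩ := List.mem_map.mp h
    exact inv_ne_zero (cf_ne_zero a b) h

theorem qBar_barFactor (w : List ℤ) : qBar (barFactor n l w) = (barFactor n l w)⁻¹ := by
  induction w with
  | nil => rw [barFactor, map_one, inv_one]
  | cons a w ih =>
    rw [barFactor, map_mul, ih, mul_inv]
    congr 1
    clear ih
    induction w with
    | nil => simp
    | cons b w ih =>
      rw [List.map_cons, List.prod_cons, map_mul, ih, mul_inv, map_inv₀, qBar_cf]

theorem barFactor_perm {w w' : List ℤ} (h : w.Perm w') : barFactor n l w = barFactor n l w' := by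
  induction h with
  | nil => rfl
  | cons a h ih => rw [barFactor, barFactor, ih, (h.map _).prod_eq]
  | swap a b w =>
    simp only [barFactor, List.map_cons, List.prod_cons]
    rw [cf_comm a b]
    ring
  | trans _ _ ih1 ih2 => exact ih1.trans ih2

/-- The factor depends on the multisets of the `c` and of the `d` of the letters only. -/
theorem barFactor_congr (u v : List ℤ) {a b a' b' : ℤ} (h1 : cPart n a' = cPart n a)
    (h2 : cPart n b' = cPart n b) (h3 : dPart n l a' = dPart n l b)
    (h4 : dPart n l b' = dPart n l a) :
    barFactor n l (u ++ a' :: b' :: v) = barFactor n l (u ++ a :: b :: v) := by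
  have key : ∀ x, cf n l a' x * cf n l b' x = cf n l a x * cf n l b x := by
    intro x
    simp only [cf, dFactor, h1, h2, h3, h4]
    ring
  have key' : ∀ x, (cf n l a' x)⁻¹ * (cf n l b' x)⁻¹ = (cf n l a x)⁻¹ * (cf n l b x)⁻¹ := by
    intro x
    rw [← mul_inv, ← mul_inv, key]
  have hab : cf n l a' b' = cf n l a b := by
    simp only [cf, dFactor, h1, h2, h3, h4]
    simp only [eq_comm]
  induction u with
  | nil =>
    simp only [List.nil_append, barFactor, List.map_cons, List.prod_cons, hab]
    have : ∀ v : List ℤ, (v.map fun x => (cf n l a' x)⁻¹).prod * (v.map fun x => (cf n l b' x)⁻¹).prod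
        = (v.map fun x => (cf n l a x)⁻¹).prod * (v.map fun x => (cf n l b x)⁻¹).prod := by
      intro v
      rw [← List.prod_map_mul, ← List.prod_map_mul]
      simp only [key']
    have := this v
    linear_combination (cf n l a b)⁻¹ * barFactor n l v * this
  | cons x u ih =>
    simp only [List.cons_append, barFactor, ih, List.map_append, List.map_cons, List.prod_append,
      List.prod_cons]
    have := key' x
    rw [cf_comm a' x, cf_comm b' x, cf_comm a x, cf_comm b x] at this
    congr 1
    linear_combination (u.map fun b => (cf n l x b)⁻¹).prod *
      (v.map fun b => (cf n l x b)⁻¹).prod * this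

theorem ascentFactor_append_singleton (w : List ℤ) (a : ℤ) : ascentFactor n l (w ++ [a]) =
    ascentFactor n l w * (w.map fun b => if b < a then cf n l b a else 1).prod := by
  induction w with
  | nil => simp [ascentFactor]
  | cons x w ih =>
    rw [List.cons_append, ascentFactor, ascentFactor, ih, List.map_append, List.prod_append,
      List.map_cons, List.prod_cons]
    simp only [List.map_cons, List.prod_cons, List.map_nil, List.prod_nil, mul_one]
    ring

/-- The coefficient of an ordered word in its image under the bar involution is `1`. -/
theorem barFactor_mul_ascentFactor {w : List ℤ} (h : w.Pairwise (· > ·)) :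
    barFactor n l w * ascentFactor n l w.reverse = 1 := by
  induction w with
  | nil => simp [barFactor, ascentFactor]
  | cons a w ih =>
    rw [List.pairwise_cons] at h
    rw [List.reverse_cons, ascentFactor_append_singleton, barFactor,
      ((List.reverse_perm w).map _).prod_eq]
    have e : (w.map fun b => if b < a then cf n l b a else 1) = w.map fun b => cf n l a b := by
      apply List.map_congr_left
      intro b hb
      rw [if_pos (h.1 b hb), cf_comm]
    have e' : (w.map fun b => (cf n l a b)⁻¹).prod * (w.map fun b => cf n l a b).prod = 1 := by
      rw [← List.prod_map_mul]
      apply List.prod_eq_one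
      intro x hx
      obtain ⟨b, _, rfl⟩ := List.mem_map.mp hx
      exact inv_mul_cancel₀ (cf_ne_zero a b)
    rw [e]
    linear_combination (barFactor n l w * ascentFactor n l w.reverse) * e' + ih h.2

variable (n l)

/-- The bar involution on combinations of words. -/
def barWords : (List ℤ →₀ Kq) →ₛₗ[qBar] (List ℤ →₀ Kq) :=
  semilinearExt fun w => barFactor n l w • Finsupp.single w.reverse 1

/-- Multiplication with words from both sides. -/
def sandwich (u v : List ℤ) : (List ℤ →₀ Kq) →ₗ[Kq] (List ℤ →₀ Kq) :=
  Finsupp.lmapDomain Kq Kq fun w => u ++ (w ++ v)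

variable {n l}

theorem sandwich_single (u v w : List ℤ) :
    sandwich u v (Finsupp.single w 1) = Finsupp.single (u ++ (w ++ v)) 1 := by
  rw [sandwich, Finsupp.lmapDomain_apply, Finsupp.mapDomain_single]

theorem sandwich_mem (u v : List ℤ) {z : List ℤ →₀ Kq} (hz : z ∈ wordRelations n l) :
    sandwich u v z ∈ wordRelations n l := by
  suffices h : wordRelations n l ≤ (wordRelations n l).comap (sandwich u v) from h hz
  refine Submodule.span_le.mpr ?_
  rintro _ ⟨u', v', a, b, hab, rfl⟩
  rw [SetLike.mem_coe, Submodule.mem_comap]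
  have : sandwich u v (wordRelation n l u' v' a b) =
      wordRelation n l (u ++ u') (v' ++ v) a b := by
    rw [wordRelation_eq, wordRelation_eq]
    simp only [map_sub, map_add, map_smul, map_sum, sandwich_single, List.append_assoc,
      List.cons_append]
  rw [this]
  exact Submodule.subset_span ⟨_, _, a, b, hab, rfl⟩

theorem flip_twoLetters (κ : Triples) (x : ℤ × ℤ) :
    flip (twoLetters n l κ 0 x) = twoLetters n l κ 0 (x.2, x.1) := by
  rw [twoLetters, flip_place, twoLetters]

theorem barWords_single (w : List ℤ) :
    barWords n l (Finsupp.single w 1) = barFactor n l w • Finsupp.single w.reverse 1 := by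
  rw [barWords, semilinearExt_single, map_one, one_smul]

section

variable [NeZero n] [NeZero l]

/-- The straightening relations are the only relations between words that hold for triples. -/
theorem mem_wordRelations_of_toTriples_mem {m : ℕ} {z : List ℤ →₀ Kq}
    (hz : ∀ w, z w ≠ 0 → w.length = m + 1)
    (h : toTriples n l (m + 1) z ∈ ⨆ i : Fin m, LinearMap.range (opA i - opB i)) :
    z ∈ wordRelations n l := by
  -- the combinations of ordered words form a complement of the relations
  obtain ⟨y, hy, hzy⟩ : ∃ y : List ℤ →₀ Kq,
      (∀ w, y w ≠ 0 → w.Pairwise (· > ·) ∧ w.length = m + 1) ∧ z - y ∈ wordRelations n l := by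
    let N : Submodule Kq (FiniteWedge n l) :=
      (Finsupp.supported Kq Kq {w | w.Pairwise (· > ·) ∧ w.length = m + 1}).map
        (wordRelations n l).mkQ
    have key : ∀ w : List ℤ, w.length = m + 1 → cls n l w ∈ N := by
      intro w hw
      have h1 : straightenSpan n l w (fun w' => energy w' ≤ energy w) ≤
          N.restrictScalars laurent := by
        refine Submodule.span_le.mpr ?_
        rintro _ ⟨w', ⟨h1, h2, -⟩, rfl⟩
        refine ⟨Finsupp.single w' 1, Finsupp.single_mem_supported _ _ ⟨h1, ?_⟩, rfl⟩
        rw [← hw]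
        clear h1
        induction h2 with
        | refl => rfl
        | tail _ h ih => rw [← ih, h.length_eq]
      exact h1 (cls_mem_straightenSpan w)
    have hN : (wordRelations n l).mkQ z ∈ N := by
      rw [← Finsupp.sum_single z, Finsupp.sum, map_sum]
      refine sum_mem fun w hw => ?_
      rw [← mul_one (z w), ← smul_eq_mul, ← Finsupp.smul_single, map_smul]
      exact N.smul_mem _ (key w (hz w (Finsupp.mem_support_iff.mp hw)))
    obtain ⟨y, hy, e⟩ := hN
    refine ⟨y, fun w hw => (Finsupp.mem_supported _ _).mp hy (Finsupp.mem_support_iff.mpr hw), ?_⟩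
    rw [← Submodule.Quotient.mk_eq_zero, ← Submodule.mkQ_apply, map_sub, e, sub_self]
  have h1 := sub_mem h (toTriples_mem (m := m) hzy)
  rw [← map_sub, sub_sub_cancel] at h1
  rw [eq_zero_of_toTriples_mem hy h1, sub_zero] at hzy
  exact hzy

/-- The reversed straightening relation, with coefficients conjugated, is a relation. -/
theorem reversed_relation_mem {a b : ℤ} (h : a ≤ b) :
    Finsupp.single [b, a] 1 - ((cf n l a b)⁻¹ • Finsupp.single [a, b] 1 +
      ((dFactor n l a b)⁻¹ * -hq) • ∑ j ∈ corrRange n l a b,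
        Finsupp.single [(corr n l a b j).2, (corr n l a b j).1] (1 : Kq)) ∈ wordRelations n l := by
  have hlen : ∀ x y : ℤ, [x, y].length = 1 + 1 := fun _ _ => rfl
  refine mem_wordRelations_of_toTriples_mem (m := 1) ?_ ?_
  · have hs : ∀ x y : ℤ, Finsupp.single [x, y] (1 : Kq) ∈
        Finsupp.supported Kq Kq {w : List ℤ | w.length = 1 + 1} := fun x y =>
      Finsupp.single_mem_supported _ _ (hlen x y)
    have := sub_mem (hs b a) (add_mem (Submodule.smul_mem _ (cf n l a b)⁻¹ (hs a b))
      (Submodule.smul_mem _ ((dFactor n l a b)⁻¹ * -hq) (sum_mem fun j (_ : j ∈ corrRange n l a b) =>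
        hs (corr n l a b j).2 (corr n l a b j).1)))
    intro w hw
    exact (Finsupp.mem_supported _ _).mp this (Finsupp.mem_support_iff.mpr hw)
  · have h1 := flip_mem_range (straighten_mem_range (n := n) (l := l)
      (wordTriples n l ([] ++ 0 :: 0 :: [])) 0 h)
    refine Submodule.mem_iSup_of_mem (0 : Fin 1) ?_
    rw [map_sub, map_add, LinearMap.map_smulₛₗ, LinearMap.map_smulₛₗ, map_sum, qBar_cf, map_mul,
      qBar_dFactor, qBar_hq] at h1
    simp only [flip_twoLetters] at h1
    simp only [map_sub, map_add, map_smul, map_sum, toTriples_single (hlen _ _)]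
    have e : ∀ x y : ℤ, Finsupp.single (wordTriples n l [x, y]) (1 : Kq) =
      twoLetters n l (wordTriples n l ([] ++ 0 :: 0 :: [])) 0 (x, y) := fun x y =>
      single_wordTriples [] [] x y
    simp only [e]
    exact h1

/-- The bar involution is compatible with the straightening relations. -/
theorem barWords_mem {z : List ℤ →₀ Kq} (hz : z ∈ wordRelations n l) :
    barWords n l z ∈ wordRelations n l := by
  suffices h : wordRelations n l ≤ (wordRelations n l).comap (barWords n l) from h hz
  refine Submodule.span_le.mpr ?_
  rintro _ ⟨u, v, a, b, hab, rfl⟩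
  rw [SetLike.mem_coe, Submodule.mem_comap, wordRelation_eq]
  have h1 := Submodule.smul_mem _ (barFactor n l (u ++ a :: b :: v))
    (sandwich_mem v.reverse u.reverse (reversed_relation_mem (n := n) (l := l) hab))
  have h2 : ∀ j, barFactor n l (u ++ (corr n l a b j).1 :: (corr n l a b j).2 :: v) =
      barFactor n l (u ++ a :: b :: v) := fun j =>
    barFactor_congr u v (cPart_cross _ _ _) (cPart_cross _ _ _) (dPart_cross _ _ _)
      (dPart_cross _ _ _)
  have h3 := barFactor_perm (n := n) (l := l) (perm_swap u v b a)
  rw [map_sub, map_add, LinearMap.map_smulₛₗ, LinearMap.map_smulₛₗ, map_sum, qBar_cf, map_mul,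
    qBar_dFactor, qBar_hq]
  simp only [barWords_single, h2, h3]
  simp only [map_sub, map_add, map_smul, map_sum, sandwich_single] at h1
  convert h1 using 1
  simp only [List.reverse_append, List.reverse_cons, List.append_assoc, List.cons_append, List.nil_append]
  rw [← Finset.smul_sum, smul_sub, smul_add, smul_comm (cf n l a b)⁻¹,
    smul_comm ((dFactor n l a b)⁻¹ * -hq)]

variable (n l)

/-- The bar involution on finite wedges. -/
def barFinite : FiniteWedge n l →ₛₗ[qBar] FiniteWedge n l :=
  Submodule.mapQ _ _ (barWords n l) fun _ h => barWords_mem h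

variable {n l}

theorem barFinite_cls (w : List ℤ) :
    barFinite n l (cls n l w) = barFactor n l w • cls n l w.reverse := by
  rw [cls, Submodule.mkQ_apply, barFinite, Submodule.mapQ_apply, barWords_single,
    Submodule.Quotient.mk_smul]
  rfl

theorem barFinite_barFinite_cls (w : List ℤ) : barFinite n l (barFinite n l (cls n l w)) = cls n l w := by
  rw [barFinite_cls, LinearMap.map_smulₛₗ, barFinite_cls, qBar_barFactor, smul_smul,
    barFactor_perm (List.reverse_perm w), inv_mul_cancel₀ (barFactor_ne_zero w), one_smul,
    List.reverse_reverse]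

/-- The bar involution is unitriangular with respect to the energy. -/
theorem barFinite_cls_sub_mem {w : List ℤ} (hw : w.Pairwise (· > ·)) :
    barFinite n l (cls n l w) - cls n l w ∈
      straightenSpan n l w.reverse fun w' => energy w' < energy w := by
  have h := cls_sub_sortWord_mem (n := n) (l := l) w.reverse
  have hs : sortWord w.reverse = w := by
    rw [sortWord_eq_of_perm (List.reverse_perm w), sortWord,
      List.Pairwise.insertionSort_eq (hw.imp fun h => le_of_lt h)]
  rw [hs, energy_perm (List.reverse_perm w)] at h
  have := laurent_smul_mem _ (barFactor_mem_laurent (n := n) (l := l) w) h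
  rwa [smul_sub, smul_smul, barFactor_mul_ascentFactor hw, one_smul, ← barFinite_cls] at this

end

end Words

/-! ### From finite to semi-infinite wedges -/

section Prefix

/-- The word of the first `r` entries. -/
def prefixWord (k : ℕ → ℤ) (r : ℕ) : List ℤ := (List.range r).map k

theorem prefixWord_succ (k : ℕ → ℤ) (r : ℕ) : prefixWord k (r + 1) = prefixWord k r ++ [k r] := by
  rw [prefixWord, List.range_succ, List.map_append]; rfl

theorem length_prefixWord (k : ℕ → ℤ) (r : ℕ) : (prefixWord k r).length = r := by
  rw [prefixWord, List.length_map, List.length_range]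

theorem getD_prefixWord (k : ℕ → ℤ) {r i : ℕ} (h : i < r) (x : ℤ) :
    (prefixWord k r).getD i x = k i := by
  rw [List.getD_eq_getElem _ _ (by rwa [length_prefixWord])]
  simp [prefixWord]

theorem pairwise_prefixWord {k : ℕ → ℤ} (hk : StrictAnti k) (r : ℕ) :
    (prefixWord k r).Pairwise (· > ·) := by
  rw [prefixWord, List.pairwise_map]
  exact List.pairwise_lt_range.imp fun h => hk h

theorem mem_prefixWord {k : ℕ → ℤ} {r : ℕ} {x : ℤ} : x ∈ prefixWord k r ↔ ∃ i < r, k i = x := by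
  simp [prefixWord]

theorem eq_prefixWord {k : ℕ → ℤ} {r : ℕ} {w : List ℤ} (h : w.length = r)
    (hw : ∀ i < r, w.getD i 0 = k i) : w = prefixWord k r := by
  apply List.ext_getElem (by rw [h, length_prefixWord])
  intro i h1 h2
  have := hw i (h ▸ h1)
  rw [List.getD_eq_getElem _ _ h1] at this
  rw [this]
  simp [prefixWord]

/-- The sequence that starts with the letters of `w` and continues like the vacuum. -/
def extend (s : ℤ) (w : List ℤ) : P s :=
  ⟨fun t => w.getD t (s - t), by
    filter_upwards [eventually_ge_atTop w.length] with t ht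
    rw [List.getD_eq_default _ _ ht]⟩

theorem extend_append_vacuum (s : ℤ) (w : List ℤ) :
    extend s (w ++ [s - w.length]) = extend s w := by
  apply Subtype.ext
  funext t
  change (w ++ [s - w.length]).getD t (s - t) = w.getD t (s - t)
  rcases Nat.lt_or_ge t w.length with ht | ht
  · rw [List.getD_append _ _ _ _ ht]
  · rw [List.getD_append_right _ _ _ _ ht, List.getD_eq_default _ _ ht]
    obtain ⟨k, rfl⟩ := Nat.exists_eq_add_of_le ht
    rw [Nat.add_sub_cancel_left]
    cases k <;> simp

theorem extend_pair (s : ℤ) (u v : List ℤ) (a b x y : ℤ) :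
    extend s (u ++ x :: y :: v) = (extend s (u ++ a :: b :: v)).setPair u.length x y := by
  apply Subtype.ext
  funext t
  change (u ++ x :: y :: v).getD t (s - t) = if t = u.length then x else
    if t = u.length + 1 then y else (u ++ a :: b :: v).getD t (s - t)
  rcases Nat.lt_or_ge t u.length with h | h
  · rw [if_neg (by omega), if_neg (by omega), List.getD_append _ _ _ _ h,
      List.getD_append _ _ _ _ h]
  · rw [List.getD_append_right _ _ _ _ h, List.getD_append_right _ _ _ _ h]
    obtain ⟨k, rfl⟩ := Nat.exists_eq_add_of_le h
    rw [Nat.add_sub_cancel_left]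
    rcases k with _ | _ | k
    · simp
    · simp
    · rw [if_neg (by omega), if_neg (by omega)]
      rfl

theorem extend_apply_length (s : ℤ) (u v : List ℤ) (a b : ℤ) :
    (extend s (u ++ a :: b :: v)).1 u.length = a := by
  change (u ++ a :: b :: v).getD _ _ = a
  simp

theorem extend_apply_length_succ (s : ℤ) (u v : List ℤ) (a b : ℤ) :
    (extend s (u ++ a :: b :: v)).1 (u.length + 1) = b := by
  change (u ++ a :: b :: v).getD _ _ = b
  simp

theorem prefixWord_eq_append (k : ℕ → ℤ) {i r : ℕ} (h : i + 1 < r) : ∃ v, ∀ x y,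
    prefixWord (fun t => if t = i then x else if t = i + 1 then y else k t) r
      = prefixWord k i ++ x :: y :: v := by
  refine ⟨prefixWord (fun t => k (i + 2 + t)) (r - (i + 2)), fun x y => ?_⟩
  symm
  apply eq_prefixWord
  · simp only [List.length_append, List.length_cons, length_prefixWord]
    omega
  · intro t ht
    rw [getD_pair, length_prefixWord]
    split_ifs with h1 h2
    · rfl
    · rfl
    · rcases Nat.lt_or_ge t i with h3 | h3
      · rw [List.getD_append _ _ _ _ (by rwa [length_prefixWord]), getD_prefixWord _ h3]
      · obtain ⟨j, rfl⟩ := Nat.exists_eq_add_of_le (show i + 2 ≤ t by omega)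
        rw [List.getD_append_right _ _ _ _ (by rw [length_prefixWord]; omega), length_prefixWord,
          show i + 2 + j - i = j + 2 by omega]
        change (prefixWord _ _).getD j 0 = _
        rw [getD_prefixWord _ (by omega)]

end Prefix

section Wedge

variable (n l : ℕ) [NeZero n] [NeZero l]

/-- The straightening rule, with its coefficients and correction terms named. -/
theorem straighten_eq {s : ℤ} (k : P s) (i : ℕ) : straighten n l k i =
    cf n l (k.1 i) (k.1 (i + 1)) • Finsupp.single (k.setPair i (k.1 (i + 1)) (k.1 i)) 1 +
      (dFactor n l (k.1 i) (k.1 (i + 1)) * hq) •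
        ∑ j ∈ corrRange n l (k.1 i) (k.1 (i + 1)), Finsupp.single
          (k.setPair i (corr n l (k.1 i) (k.1 (i + 1)) j).1
            (corr n l (k.1 i) (k.1 (i + 1)) j).2) 1 := by
  rw [straighten, smul_add, smul_smul, smul_smul, cf, dFactor, corrRange]
  simp only [eq_comm (a := dPart n l (k.1 (i + 1))), eq_comm (a := cPart n (k.1 (i + 1)))]
  congr 1
  refine congrArg _ (Finset.sum_congr rfl fun j _ => ?_)
  have h1 := letter_eq n l (k.1 i)
  have h2 := letter_eq n l (k.1 (i + 1))
  congr 2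
  · simp only [corr, cross, letter] at *
    linarith
  · simp only [corr, cross, letter] at *
    linarith

theorem wordRelations_le_comap (s : ℤ) : wordRelations n l ≤
    (relations n l s).comap (Finsupp.lmapDomain Kq Kq (extend s)) := by
  refine Submodule.span_le.mpr ?_
  rintro _ ⟨u, v, a, b, hab, rfl⟩
  refine Submodule.subset_span ⟨extend s (u ++ a :: b :: v), u.length, ?_, ?_⟩
  · rwa [extend_apply_length, extend_apply_length_succ]
  · rw [wordRelation_eq, straighten_eq, extend_apply_length, extend_apply_length_succ]
    simp only [map_sub, map_add, map_smul, map_sum, Finsupp.lmapDomain_apply,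
      Finsupp.mapDomain_single, ← extend_pair]

/-- Completion of a finite wedge by the vacuum. -/
def completeWedge (s : ℤ) : FiniteWedge n l →ₗ[Kq] Wedge n l s :=
  Submodule.mapQ _ _ (Finsupp.lmapDomain Kq Kq (extend s)) (wordRelations_le_comap n l s)

variable {n l}

theorem completeWedge_cls (s : ℤ) (w : List ℤ) :
    completeWedge n l s (cls n l w) = wedge n l (extend s w) := by
  rw [cls, wedge, completeWedge, Submodule.mkQ_apply, Submodule.mapQ_apply, Submodule.mkQ_apply,
    Finsupp.lmapDomain_apply, Finsupp.mapDomain_single]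

/-- A relation between semi-infinite wedges involves finitely many factors only. -/
theorem eventually_mem_wordRelations {s : ℤ} {z : P s →₀ Kq} (hz : z ∈ relations n l s) :
    ∀ᶠ r in atTop, z.mapDomain (fun k => prefixWord k.1 r) ∈ wordRelations n l := by
  induction hz using Submodule.span_induction with
  | mem x hx =>
    obtain ⟨k, i, hki, rfl⟩ := hx
    filter_upwards [eventually_gt_atTop (i + 1)] with r hr
    obtain ⟨v, hv⟩ := prefixWord_eq_append k.1 hr
    have e1 : ∀ x y, prefixWord (k.setPair i x y).1 r = prefixWord k.1 i ++ x :: y :: v := hv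
    have e2 : prefixWord k.1 r = prefixWord k.1 i ++ k.1 i :: k.1 (i + 1) :: v := by
      rw [← hv]
      congr 1
      funext t
      split_ifs with h1 h2
      · rw [h1]
      · rw [h2]
      · rfl
    rw [straighten_eq, ← Finsupp.lmapDomain_apply (M := Kq) (R := Kq)]
    simp only [map_sub, map_add, map_smul, map_sum, Finsupp.lmapDomain_apply,
      Finsupp.mapDomain_single, e1, e2]
    rw [← wordRelation_eq]
    exact Submodule.subset_span ⟨_, _, _, _, hki, rfl⟩
  | zero => simp
  | add x y _ _ hx hy =>
    filter_upwards [hx, hy] with r h1 h2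
    rw [Finsupp.mapDomain_add]
    exact add_mem h1 h2
  | smul c x _ hx =>
    filter_upwards [hx] with r h1
    rw [Finsupp.mapDomain_smul]
    exact Submodule.smul_mem _ _ h1

/-- The ordered semi-infinite wedges are linearly independent. -/
theorem eq_zero_of_mem_relations {s : ℤ} {z : P s →₀ Kq} (hz : ∀ k, z k ≠ 0 → StrictAnti k.1)
    (h : z ∈ relations n l s) : z = 0 := by
  classical
  have h1 : ∀ᶠ r in atTop, ∀ k ∈ z.support, ∀ k' ∈ z.support,
      prefixWord k.1 r = prefixWord k'.1 r → k = k' := by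
    rw [Filter.eventually_all_finset]
    intro k _
    rw [Filter.eventually_all_finset]
    intro k' _
    by_cases hk : k = k'
    · exact Eventually.of_forall fun _ _ => hk
    · obtain ⟨i, hi⟩ : ∃ i, k.1 i ≠ k'.1 i := by
        by_contra hc
        push Not at hc
        exact hk (Subtype.ext (funext hc))
      filter_upwards [eventually_gt_atTop i] with r hr hc
      have := congrArg (fun w => List.getD w i 0) hc
      simp only [getD_prefixWord _ hr] at this
      exact absurd this hi
  obtain ⟨r, h2, h3, h4⟩ := ((eventually_mem_wordRelations h).and
    (h1.and (eventually_ge_atTop 1))).exists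
  obtain ⟨m, rfl⟩ := Nat.exists_eq_add_of_le' h4
  have h5 := eq_zero_of_mem_wordRelations (m := m) ?_ h2
  · refine Finsupp.mapDomain_injOn (z.support : Set (P s)) (f := fun k : P s => prefixWord k.1 (m + 1))
      (fun k hk k' hk' hkk => h3 k hk k' hk' hkk)
      (show (z.support : Set (P s)) ⊆ _ from subset_rfl) (by simp) ?_
    rw [h5, Finsupp.mapDomain_zero]
  · intro w hw
    obtain ⟨k, hk, rfl⟩ := Finset.mem_image.mp
      (Finsupp.mapDomain_support (Finsupp.mem_support_iff.mpr hw))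
    exact ⟨pairwise_prefixWord (hz k (Finsupp.mem_support_iff.mp hk)) _, length_prefixWord _ _⟩

end Wedge

/-! ### The bar involution on semi-infinite wedges -/

section Bar

variable {n l : ℕ}

theorem kappa_succ (r : ℕ) (a : ℕ → ℤ) :
    kappa (r + 1) a = kappa r a + ((Finset.range r).filter fun i => a i = a r).card := by
  have e : (Finset.range (r + 1) ×ˢ Finset.range (r + 1)).filter
      (fun p => p.1 < p.2 ∧ a p.1 = a p.2) =
      (Finset.range r ×ˢ Finset.range r).filter (fun p => p.1 < p.2 ∧ a p.1 = a p.2) ∪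
        ((Finset.range r).filter fun i => a i = a r) ×ˢ {r} := by
    ext ⟨i, j⟩
    simp only [Finset.mem_filter, Finset.mem_product, Finset.mem_range, Finset.mem_union,
      Finset.mem_singleton]
    constructor
    · rintro ⟨⟨h1, h2⟩, h3, h4⟩
      rcases Nat.lt_succ_iff_lt_or_eq.mp h2 with h | rfl
      · left; exact ⟨⟨by omega, h⟩, h3, h4⟩
      · right; exact ⟨⟨h3, h4⟩, rfl⟩
    · rintro (⟨⟨h1, h2⟩, h3, h4⟩ | ⟨⟨h1, h2⟩, rfl⟩)
      · exact ⟨⟨by omega, by omega⟩, h3, h4⟩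
      · exact ⟨⟨by omega, by omega⟩, h1, h2⟩
  rw [kappa, e, Finset.card_union_of_disjoint, Finset.card_product, Finset.card_singleton, mul_one,
    kappa]
  rw [Finset.disjoint_left]
  rintro ⟨i, j⟩ h1 h2
  simp only [Finset.mem_filter, Finset.mem_product, Finset.mem_range, Finset.mem_singleton] at h1 h2
  omega

theorem prod_prefixWord_cf (k : ℕ → ℤ) (x : ℤ) (r : ℕ) :
    ((prefixWord k r).map fun b => (cf n l x b)⁻¹).prod =
      (-q) ^ ((Finset.range r).filter fun i => dPart n l (k i) = dPart n l x).card *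
      (q⁻¹) ^ ((Finset.range r).filter fun i => cPart n (k i) = cPart n x).card := by
  induction r with
  | zero => simp [prefixWord]
  | succ r ih =>
    rw [prefixWord_succ, List.map_append, List.prod_append, ih, Finset.range_add_one,
      Finset.filter_insert, Finset.filter_insert, List.map_singleton, List.prod_singleton, cf, dFactor]
    simp only [eq_comm (a := dPart n l x), eq_comm (a := cPart n x)]
    split_ifs
    all_goals
      simp only [Finset.card_insert_of_notMem, Finset.mem_filter, Finset.mem_range, lt_self_iff_false,
        false_and, not_false_eq_true, pow_succ, mul_inv, inv_neg, inv_inv, inv_one, mul_one, one_mul]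
      try ring

/-- The normalization factor of the bar involution, as a product over pairs of letters. -/
theorem barFactor_prefixWord (k : ℕ → ℤ) (r : ℕ) :
    (-q) ^ kappa r (fun i => dPart n l (k i)) * (q⁻¹) ^ kappa r (fun i => cPart n (k i)) =
      barFactor n l (prefixWord k r) := by
  induction r with
  | zero => simp [kappa, prefixWord, barFactor]
  | succ r ih =>
    rw [kappa_succ, kappa_succ, prefixWord_succ, barFactor_perm (List.perm_append_singleton _ _),
      barFactor, ← ih, prod_prefixWord_cf]
    ring

/-- Distinct letters above `m` have at least the sum of the smallest such letters. -/
theorem two_mul_sum_ge {w : List ℤ} (hw : w.Pairwise (· > ·)) {m : ℤ} (hm : ∀ x ∈ w, m < x) :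
    (w.length : ℤ) * (2 * m + 1 + w.length) ≤ 2 * w.sum ∧ ∀ a, (∀ x ∈ w, x < a) → m < a →
      m + 1 + w.length ≤ a := by
  induction w with
  | nil => simp
  | cons b w ih =>
    rw [List.pairwise_cons] at hw
    obtain ⟨h1, h2⟩ := ih hw.2 fun x hx => hm x (List.mem_cons_of_mem _ hx)
    have h3 := h2 b hw.1 (hm b List.mem_cons_self)
    rw [List.length_cons, List.sum_cons]
    push_cast
    refine ⟨by nlinarith, fun a ha _ => ?_⟩
    have := ha b List.mem_cons_self
    omega

theorem two_mul_sum_prefixWord {s : ℤ} (k : ℕ → ℤ) {r₀ : ℕ} (h : ∀ t, r₀ ≤ t → k t = s - t)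
    {r : ℕ} (hr : r₀ ≤ r) : 2 * (prefixWord k r).sum =
      2 * (prefixWord k r₀).sum + (r - r₀) * (2 * s - r - r₀ + 1) := by
  obtain ⟨i, rfl⟩ := Nat.exists_eq_add_of_le hr
  clear hr
  induction i with
  | zero => simp
  | succ i ih =>
    rw [← add_assoc, prefixWord_succ, List.sum_append, List.sum_singleton, h _ (by omega), mul_add, ih]
    push_cast
    ring

/-- A predicate that is preserved by straightening. -/
theorem Reach.induct {Q : List ℤ → Prop} (hQ : ∀ w w', Step n l w w' → Q w → Q w') {w w' : List ℤ}
    (h : Reach n l w w') (hw : Q w) : Q w' := by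
  induction h with
  | refl => exact hw
  | tail _ h ih => exact hQ _ _ h ih

variable [NeZero n] [NeZero l]

theorem barWedge_eq {s : ℤ} (k : P s) {r : ℕ} (h : ∀ t, r ≤ t → k.1 t = s - t) :
    barWedge n l r k = completeWedge n l s (barFinite n l (cls n l (prefixWord k.1 r))) := by
  rw [barWedge, barFactor_prefixWord, barFinite_cls, map_smul, completeWedge_cls]
  congr 2
  apply Subtype.ext
  funext t
  change (if t < r then k.1 (r - 1 - t) else k.1 t) = (prefixWord k.1 r).reverse.getD t (s - t)
  split_ifs with ht
  · rw [List.getD_eq_getElem _ _ (by rwa [List.length_reverse, length_prefixWord]),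
      List.getElem_reverse, ← List.getD_eq_getElem _ 0, getD_prefixWord _
        (by rw [length_prefixWord]; omega), length_prefixWord]
  · rw [List.getD_eq_default _ _ (by rw [List.length_reverse, length_prefixWord]; omega),
      h t (by omega)]

theorem PairStep.sum_eq {a b : ℤ} {p : ℤ × ℤ} (h : PairStep n l a b p) : p.1 + p.2 = a + b := by
  rcases h with rfl | ⟨j, hj, rfl⟩
  · exact add_comm _ _
  · exact corr_add

theorem PairStep.bounds {a b : ℤ} {p : ℤ × ℤ} (hab : a < b) (h : PairStep n l a b p) :
    a ≤ p.1 ∧ a ≤ p.2 ∧ p.1 ≤ b ∧ p.2 ≤ b := by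
  rcases h with rfl | ⟨j, hj, rfl⟩
  · exact ⟨hab.le, le_rfl, le_rfl, hab.le⟩
  · exact ⟨(lt_corr_fst hj).le, (lt_corr_snd hj).le, (corr_fst_lt hj).le, (corr_snd_lt hj).le⟩

theorem Step.sum_eq {w w' : List ℤ} (h : Step n l w w') : w'.sum = w.sum := by
  obtain ⟨u, v, a, b, p, -, hp, rfl, rfl⟩ := h
  have := hp.sum_eq
  simp only [List.sum_append, List.sum_cons]
  linarith

theorem Step.forall_lt {w w' : List ℤ} (h : Step n l w w') {m : ℤ} (hw : ∀ x ∈ w, m < x) :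
    ∀ x ∈ w', m < x := by
  obtain ⟨u, v, a, b, p, hab, hp, rfl, rfl⟩ := h
  obtain ⟨h1, h2, -, -⟩ := hp.bounds hab
  have ha := hw a (by simp)
  intro x hx
  simp only [List.mem_append, List.mem_cons] at hx hw
  rcases hx with hx | rfl | rfl | hx
  · exact hw x (Or.inl hx)
  · omega
  · omega
  · exact hw x (Or.inr (Or.inr (Or.inr hx)))

/-- Too many letters above a bound: the wedge vanishes. -/
theorem cls_eq_zero_of_sum_lt {w : List ℤ} {m : ℤ} (hm : ∀ x ∈ w, m < x)
    (hsum : 2 * w.sum < w.length * (2 * m + 1 + w.length)) : cls n l w = 0 := by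
  have h := cls_mem_straightenSpan (n := n) (l := l) w
  have e : {w' : List ℤ | w'.Pairwise (· > ·) ∧ Reach n l w w' ∧ energy w' ≤ energy w} = ∅ := by
    rw [Set.eq_empty_iff_forall_notMem]
    rintro w' ⟨h1, h2, -⟩
    have h3 := h2.induct (Q := fun w' => (∀ x ∈ w', m < x) ∧ w'.sum = w.sum ∧ w'.length = w.length)
      (fun w w' h ⟨g1, g2, g3⟩ => ⟨h.forall_lt g1, h.sum_eq.trans g2, h.length_eq ▸ g3⟩)
      ⟨hm, rfl, rfl⟩
    have h4 := (two_mul_sum_ge h1 h3.1).1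
    rw [h3.2.1, h3.2.2] at h4
    omega
  rw [straightenSpan, e, Set.image_empty, Submodule.span_empty, Submodule.mem_bot] at h
  exact h

/-- A small letter moves to the right without corrections if there is no room for them. -/
theorem cls_move_right (u v : List ℤ) {m : ℤ} (hu : ∀ x ∈ u, m < x) (hv : ∀ x ∈ v, m < x)
    (hsum : 2 * (u ++ m :: v).sum <
      (u ++ m :: v).length * (2 * m + 1 + (u ++ m :: v).length)) :
    cls n l (u ++ m :: v) = (v.map fun x => cf n l m x).prod • cls n l (u ++ v ++ [m]) := by
  induction v generalizing u with
  | nil => simp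
  | cons x v ih =>
    have hx := hv x List.mem_cons_self
    have hv' : ∀ y ∈ v, m < y := fun y hy => hv y (List.mem_cons_of_mem _ hy)
    rw [cls_straighten u v hx.le, Finset.sum_eq_zero, smul_zero, add_zero, List.map_cons,
      List.prod_cons, mul_smul]
    · congr 1
      have h := ih (u ++ [x]) (fun y hy => ?_) hv' ?_
      · simpa using h
      · rcases List.mem_append.mp hy with hy | hy
        · exact hu y hy
        · rwa [List.mem_singleton.mp hy]
      · convert hsum using 1
        · simp only [List.sum_append, List.sum_cons, List.sum_nil]; ring
        · simp
    · intro j hj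
      apply cls_eq_zero_of_sum_lt (m := m)
      · intro y hy
        simp only [List.mem_append, List.mem_cons] at hy
        rcases hy with hy | rfl | rfl | hy
        · exact hu y hy
        · exact lt_corr_fst hj
        · exact lt_corr_snd hj
        · exact hv' y hy
      · convert hsum using 1
        · have := corr_add (n := n) (l := l) (a := m) (b := x) (j := j)
          simp only [List.sum_append, List.sum_cons]
          linear_combination 2 * this
        · simp

/-- The bar involution does not depend on the number of factors, if it is large. -/
theorem eventually_barWedge_succ {s : ℤ} (k : P s) (hk : StrictAnti k.1) :
    ∀ᶠ r in atTop, barWedge n l (r + 1) k = barWedge n l r k := by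
  obtain ⟨r₀, hr₀⟩ := eventually_atTop.mp k.2
  -- the excess of the sum of the letters over the vacuum
  set E : ℤ := 2 * (prefixWord k.1 r₀).sum - r₀ * (2 * s - r₀ + 1) with hE
  filter_upwards [eventually_ge_atTop r₀, eventually_ge_atTop E.toNat] with r hr hrE
  rw [barWedge_eq k (r := r) fun t ht => hr₀ t (by omega),
    barWedge_eq k (r := r + 1) fun t ht => hr₀ t (by omega), barFinite_cls, barFinite_cls]
  have hm : ∀ x ∈ (prefixWord k.1 r).reverse, k.1 r < x := by
    intro x hx
    rw [List.mem_reverse, mem_prefixWord] at hx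
    obtain ⟨i, hi, rfl⟩ := hx
    exact hk hi
  have hkr := hr₀ r hr
  have hsum := two_mul_sum_prefixWord k.1 hr₀ (r := r) hr
  rw [prefixWord_succ, List.reverse_append, List.reverse_singleton, List.singleton_append,
    ← List.nil_append (k.1 r :: (prefixWord k.1 r).reverse),
    cls_move_right [] _ (by simp) hm ?_, smul_smul, map_smul, map_smul, completeWedge_cls,
    completeWedge_cls, List.nil_append]
  · congr 1
    · rw [barFactor_perm (List.perm_append_singleton _ _), barFactor,
        ((List.reverse_perm (prefixWord k.1 r)).map _).prod_eq]
      have e' : ((prefixWord k.1 r).map fun b => (cf n l (k.1 r) b)⁻¹).prod *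
          ((prefixWord k.1 r).map fun b => cf n l (k.1 r) b).prod = 1 := by
        rw [← List.prod_map_mul]
        apply List.prod_eq_one
        intro x hx
        obtain ⟨b, _, rfl⟩ := List.mem_map.mp hx
        exact inv_mul_cancel₀ (cf_ne_zero _ b)
      linear_combination barFactor n l (prefixWord k.1 r) * e'
    · have := extend_append_vacuum s (prefixWord k.1 r).reverse
      rw [List.length_reverse, length_prefixWord, ← hkr] at this
      rw [this]
  · simp only [List.nil_append, List.sum_cons, List.length_cons, List.length_reverse,
      length_prefixWord, List.sum_reverse]
    push_cast
    rw [mul_add, hsum, hkr]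
    have : E ≤ r := by omega
    nlinarith

theorem eventually_barWedge_eq {s : ℤ} (k : P s) (hk : StrictAnti k.1) :
    ∃ r₀, ∀ r, r₀ ≤ r → barWedge n l r k = barWedge n l r₀ k := by
  obtain ⟨r₀, h⟩ := eventually_atTop.mp (eventually_barWedge_succ (n := n) (l := l) k hk)
  refine ⟨r₀, fun r hr => ?_⟩
  induction r, hr using Nat.le_induction with
  | base => rfl
  | succ r hr ih => rw [h r hr, ih]

end Bar

/-! ### Multipartitions and ordered words -/

section YoungDiagrams

theorem exists_youngDiagram {f : ℕ → ℕ} (hf : Antitone f) {L : ℕ} (hL : ∀ r, L ≤ r → f r = 0) :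
    ∃ mu : YoungDiagram, ∀ r, mu.rowLen r = f r := by
  have hw : ((List.range L).map f).SortedGE := by
    rw [List.sortedGE_iff_pairwise, List.pairwise_map]
    exact List.pairwise_lt_range.imp fun h => hf h.le
  refine ⟨YoungDiagram.ofRowLens _ hw, fun r => ?_⟩
  rcases Nat.lt_or_ge r L with h | h
  · have := YoungDiagram.rowLen_ofRowLens (hw := hw) ⟨r, by simpa using h⟩
    simpa using this
  · rw [hL r h]
    by_contra hne
    have hmem : (r, 0) ∈ YoungDiagram.ofRowLens _ hw := by
      rw [YoungDiagram.mem_iff_lt_rowLen]; omega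
    rw [YoungDiagram.mem_ofRowLens] at hmem
    obtain ⟨h1, -⟩ := hmem
    simp at h1
    omega

theorem rowLen_eq_zero {mu : YoungDiagram} {r : ℕ} (h : mu.colLen 0 ≤ r) : mu.rowLen r = 0 := by
  by_contra hne
  have hmem : (r, 0) ∈ mu := by rw [YoungDiagram.mem_iff_lt_rowLen]; omega
  rw [YoungDiagram.mem_iff_lt_colLen] at hmem
  omega

theorem colLen_le {mu : YoungDiagram} {L : ℕ} (h : mu.rowLen L = 0) : mu.colLen 0 ≤ L := by
  by_contra hc
  have hmem : (L, 0) ∈ mu := by rw [YoungDiagram.mem_iff_lt_colLen]; omega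
  rw [YoungDiagram.mem_iff_lt_rowLen] at hmem
  omega

theorem sum_rowLen (mu : YoungDiagram) {L : ℕ} (h : mu.colLen 0 ≤ L) :
    ∑ r ∈ Finset.range L, mu.rowLen r = mu.card := by
  rw [YoungDiagram.card, Finset.card_eq_sum_card_fiberwise (f := Prod.fst) (t := Finset.range L)]
  · refine Finset.sum_congr rfl fun r _ => ?_
    rw [YoungDiagram.rowLen_eq_card]
    rfl
  · rintro ⟨i, j⟩ hij
    have h1 : (i, 0) ∈ mu := mu.up_left_mem le_rfl (Nat.zero_le j) hij
    rw [YoungDiagram.mem_iff_lt_colLen] at h1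
    simp
    omega

theorem colLen_le_card (mu : YoungDiagram) : mu.colLen 0 ≤ mu.card := by
  rw [YoungDiagram.colLen_eq_card]
  exact Finset.card_le_card (Finset.filter_subset _ _)

end YoungDiagrams

section Positions

variable (n l : ℕ)

/-- The integer `x = c - n m`, for which `u_k = u_x^{(d)}`. -/
def xPart (k : ℤ) : ℤ := cPart n k - n * mPart n l k

variable {n l} [NeZero n]

theorem dPart_position (d : Fin l) (x : ℤ) : dPart n l (position n l d x) = (d : ℕ) + 1 :=
  (position_spec n l d x).1

theorem xPart_position (d : Fin l) (x : ℤ) : xPart n l (position n l d x) = x :=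
  (position_spec n l d x).2

theorem position_injective {d d' : Fin l} {x x' : ℤ} (h : position n l d x = position n l d' x') :
    d = d' ∧ x = x' := by
  have h1 := dPart_position (n := n) d x
  have h2 := xPart_position (n := n) d x
  rw [h, dPart_position] at h1
  rw [h, xPart_position] at h2
  exact ⟨Fin.ext (by omega), h2.symm⟩

variable [NeZero l]

theorem position_xPart {d : Fin l} {k : ℤ} (h : dPart n l k = (d : ℕ) + 1) :
    position n l d (xPart n l k) = k := by
  obtain ⟨d', x, rfl⟩ := exists_position n l k
  rw [dPart_position] at h
  rw [xPart_position, show d = d' from Fin.ext (by omega)]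

theorem xPart_lt_xPart {k k' : ℤ} (hd : dPart n l k = dPart n l k') (h : k < k') :
    xPart n l k < xPart n l k' := by
  rw [lt_iff_parts (n := n) (l := l)] at h
  have h1 := cPart_bounds n k
  have h2 := cPart_bounds n k'
  rw [xPart, xPart]
  rcases h with h | ⟨h3, h | ⟨-, h⟩⟩
  · have : (n : ℤ) * (mPart n l k' + 1) ≤ n * mPart n l k :=
      mul_le_mul_of_nonneg_left (by omega) (by positivity)
    linarith
  · omega
  · rw [h3]; linarith

end Positions

section Sequences

theorem extend_strictAnti {s : ℤ} {w : List ℤ} (hw : w.Pairwise (· > ·))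
    (h : ∀ k ∈ w, s - w.length < k) : StrictAnti (extend s w).1 := by
  intro a b hab
  change w.getD b (s - b) < w.getD a (s - a)
  rcases Nat.lt_or_ge b w.length with hb | hb
  · rw [List.getD_eq_getElem _ _ hb, List.getD_eq_getElem _ _ (by omega)]
    exact List.pairwise_iff_getElem.mp hw a b _ _ hab
  · rw [List.getD_eq_default _ _ hb]
    rcases Nat.lt_or_ge a w.length with ha | ha
    · rw [List.getD_eq_getElem _ _ ha]
      have := h _ (List.getElem_mem ha)
      omega
    · rw [List.getD_eq_default _ _ ha]
      omega

theorem range_extend (s : ℤ) (w : List ℤ) :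
    Set.range (extend s w).1 = {k | k ∈ w} ∪ {k | k ≤ s - w.length} := by
  ext k
  simp only [Set.mem_range, Set.mem_union, Set.mem_ofPred_eq]
  constructor
  · rintro ⟨t, rfl⟩
    change w.getD t (s - t) ∈ w ∨ w.getD t (s - t) ≤ _
    rcases Nat.lt_or_ge t w.length with ht | ht
    · rw [List.getD_eq_getElem _ _ ht]
      exact Or.inl (List.getElem_mem ht)
    · rw [List.getD_eq_default _ _ ht]
      right; omega
  · rintro (h | h)
    · obtain ⟨t, ht, rfl⟩ := List.mem_iff_getElem.mp h
      exact ⟨t, List.getD_eq_getElem _ _ ht⟩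
    · refine ⟨(s - k).toNat, ?_⟩
      change w.getD _ _ = k
      rw [List.getD_eq_default _ _ (by omega)]
      omega

theorem StrictAnti.antitone_add {k : ℕ → ℤ} (hk : StrictAnti k) : Antitone fun r => k r + r := by
  apply antitone_nat_of_succ_le
  intro r
  have : k (r + 1) < k r := hk (Nat.lt_succ_self r)
  push_cast
  omega

theorem strictAnti_range_inj {k k' : ℕ → ℤ} (hk : StrictAnti k) (hk' : StrictAnti k')
    (h : Set.range k = Set.range k') : k = k' := by
  have h1 : (fun r => -k r) = fun r => -k' r := by
    rw [← StrictMono.range_inj (fun _ _ h => neg_lt_neg (hk h)) (fun _ _ h => neg_lt_neg (hk' h))]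
    change Set.range (Neg.neg ∘ k) = Set.range (Neg.neg ∘ k')
    rw [Set.range_comp, Set.range_comp, h]
  funext r
  exact neg_injective (congrFun h1 r)

theorem sum_eq_of_list_range (f : ℕ → ℤ) (L : ℕ) :
    ((List.range L).map f).sum = ∑ r ∈ Finset.range L, f r := by
  induction L with
  | zero => simp
  | succ L ih => simp [List.range_succ, Finset.sum_range_succ, ih]

theorem sum_map_indicator (w : List ℤ) (p : ℤ → Prop) [DecidablePred p] :
    (w.map fun k => if p k then (1 : ℤ) else 0).sum = (w.filter (fun k => p k)).length := by
  induction w with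
  | nil => simp
  | cons a w ih =>
    rw [List.map_cons, List.sum_cons, ih, List.filter_cons]
    by_cases h : p a
    · simp [h, add_comm]
    · simp [h]

end Sequences

section KetWords

variable (n : ℕ) {l : ℕ} (s : Fin l → ℤ)

/-- The beads above `-n ℓ M`, component by component. -/
def beadList (lam : MultiPartition l) (M : ℕ) : List ℤ :=
  (List.finRange l).flatMap fun d => (List.range (s d + n * M).toNat).map fun r =>
    position n l d (s d + (lam d).rowLen r - r)

/-- The beads above `-n ℓ M` in decreasing order. -/
def ketWord (lam : MultiPartition l) (M : ℕ) : List ℤ := sortWord (beadList n s lam M)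

/-- Every position not above `-n ℓ M` is occupied. -/
def Fits (lam : MultiPartition l) (M : ℕ) : Prop :=
  ∀ d, ((lam d).colLen 0 : ℤ) ≤ s d + n * M

variable {n s}

theorem mem_beadList {lam : MultiPartition l} {M : ℕ} {k : ℤ} : k ∈ beadList n s lam M ↔
    ∃ (d : Fin l) (r : ℕ), (r : ℤ) < s d + n * M ∧
      k = position n l d (s d + (lam d).rowLen r - r) := by
  simp only [beadList, List.mem_flatMap, List.mem_finRange, true_and, List.mem_map, List.mem_range]
  refine exists_congr fun d => exists_congr fun r => and_congr (by omega) eq_comm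

theorem row_strictAnti (lam : MultiPartition l) (d : Fin l) :
    StrictAnti fun r : ℕ => s d + (lam d).rowLen r - r := by
  intro a b hab
  have := (lam d).rowLen_anti a b hab.le
  dsimp only
  omega

theorem perm_ketWord (lam : MultiPartition l) (M : ℕ) :
    (ketWord n s lam M).Perm (beadList n s lam M) := List.perm_insertionSort _ _

theorem Fits.toNat {lam : MultiPartition l} {M : ℕ} (h : Fits n s lam M) (d : Fin l) :
    ((s d + n * M).toNat : ℤ) = s d + n * M := by
  have := h d
  omega

theorem mem_ketWord {lam : MultiPartition l} {M : ℕ} {k : ℤ} : k ∈ ketWord n s lam M ↔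
    ∃ (d : Fin l) (r : ℕ), (r : ℤ) < s d + n * M ∧
      k = position n l d (s d + (lam d).rowLen r - r) := by
  rw [(perm_ketWord lam M).mem_iff, mem_beadList]

theorem sum_ketWord (lam : MultiPartition l) (M : ℕ) (g : ℤ → ℤ) :
    ((ketWord n s lam M).map g).sum = ∑ d, ∑ r ∈ Finset.range (s d + n * M).toNat,
      g (position n l d (s d + (lam d).rowLen r - r)) := by
  rw [((perm_ketWord lam M).map g).sum_eq, beadList, List.map_flatMap, Fin.sum_univ_def,
    List.flatMap, List.sum_flatten, List.map_map]
  congr 1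
  refine List.map_congr_left fun d _ => ?_
  rw [Function.comp_apply, List.map_map, sum_eq_of_list_range]
  rfl

theorem length_ketWord {lam : MultiPartition l} {M : ℕ} (h : Fits n s lam M) :
    ((ketWord n s lam M).length : ℤ) = ∑ d, s d + n * l * M := by
  have := sum_ketWord (n := n) (s := s) lam M fun _ => 1
  rw [List.map_const', List.sum_replicate] at this
  simp only [Finset.sum_const, Finset.card_range, nsmul_eq_mul, mul_one, h.toNat,
    Finset.sum_add_distrib, Finset.card_univ, Fintype.card_fin] at this
  rw [this]
  ring

variable [NeZero n]

theorem nodup_beadList (lam : MultiPartition l) (M : ℕ) : (beadList n s lam M).Nodup := by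
  rw [beadList, List.nodup_flatMap]
  refine ⟨fun d _ => ?_, ?_⟩
  · refine List.Nodup.map (fun r r' h => ?_) List.nodup_range
    exact (row_strictAnti lam d).injective (position_injective h).2
  · refine (List.nodup_finRange l).imp fun {d d'} hd k h1 h2 => ?_
    obtain ⟨r, -, rfl⟩ := List.mem_map.mp h1
    obtain ⟨r', -, h⟩ := List.mem_map.mp h2
    exact hd (position_injective h).1.symm

theorem pairwise_ketWord (lam : MultiPartition l) (M : ℕ) :
    (ketWord n s lam M).Pairwise (· > ·) := by
  have h1 : (ketWord n s lam M).Pairwise (· ≥ ·) := List.pairwise_insertionSort _ _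
  have h2 : (ketWord n s lam M).Nodup := (perm_ketWord lam M).nodup_iff.mpr (nodup_beadList lam M)
  exact (h1.and h2).imp fun ⟨h, h'⟩ => lt_of_le_of_ne h (Ne.symm h')

theorem lt_of_mem_ketWord {lam : MultiPartition l} {M : ℕ} {k : ℤ} (hk : k ∈ ketWord n s lam M) :
    -(n * l * M : ℤ) < k := by
  obtain ⟨d, r, hr, rfl⟩ := mem_ketWord.mp hk
  rw [lt_position_iff]
  omega

theorem sum_xPart_ketWord {lam : MultiPartition l} {M : ℕ} (h : Fits n s lam M) :
    ((ketWord n s lam M).map (xPart n l)).sum =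
      ∑ d, ∑ r ∈ Finset.range (s d + n * M).toNat, (s d - r : ℤ) + lam.size := by
  rw [sum_ketWord, MultiPartition.size, Nat.cast_sum, ← Finset.sum_add_distrib]
  refine Finset.sum_congr rfl fun d _ => ?_
  have h1 : (lam d).colLen 0 ≤ (s d + n * M).toNat := by
    have := h d
    omega
  rw [← sum_rowLen (lam d) h1, Nat.cast_sum, ← Finset.sum_add_distrib]
  refine Finset.sum_congr rfl fun r _ => ?_
  rw [xPart_position]
  ring

theorem sum_dPart_ketWord {lam : MultiPartition l} {M : ℕ} (h : Fits n s lam M) (d : Fin l) :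
    ((ketWord n s lam M).map fun k => if dPart n l k = (d : ℕ) + 1 then (1 : ℤ) else 0).sum =
      s d + n * M := by
  rw [sum_ketWord, Finset.sum_eq_single d]
  · simp only [dPart_position, if_true, Finset.sum_const, Finset.card_range, nsmul_eq_mul, mul_one,
      h.toNat]
  · intro d' _ hd
    apply Finset.sum_eq_zero
    intro r _
    rw [dPart_position, if_neg]
    intro e
    exact hd (Fin.ext (by omega))
  · intro h
    exact absurd (Finset.mem_univ d) h

variable [NeZero l]

theorem ketSeq_strictAnti (lam : MultiPartition l) : StrictAnti (ketSeq n l s lam).1 :=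
  (exists_ordered n l lam s).choose_spec.1

theorem range_ketSeq (lam : MultiPartition l) :
    Set.range (ketSeq n l s lam).1 = beads n l lam s :=
  (exists_ordered n l lam s).choose_spec.2

theorem ketSeq_eq {lam : MultiPartition l} {M : ℕ} (h : Fits n s lam M) :
    ketSeq n l s lam = extend (∑ d, s d) (ketWord n s lam M) := by
  have hlen := length_ketWord h
  have hs : StrictAnti (extend (∑ d, s d) (ketWord n s lam M)).1 := by
    refine extend_strictAnti (pairwise_ketWord lam M) fun k hk => ?_
    have := lt_of_mem_ketWord hk
    omega
  apply Subtype.ext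
  refine strictAnti_range_inj (ketSeq_strictAnti lam) hs ?_
  rw [range_ketSeq, range_extend, hlen]
  ext k
  simp only [beads, Set.mem_ofPred_eq, Set.mem_union, mem_ketWord]
  constructor
  · rintro ⟨d, r, rfl⟩
    by_cases hr : (r : ℤ) < s d + n * M
    · exact Or.inl ⟨d, r, hr, rfl⟩
    · right
      have h1 := h d
      have h2 := lt_position_iff n l d (s d + (lam d).rowLen r - r) M
      rw [rowLen_eq_zero (mu := lam d) (r := r) (by omega)] at h2 ⊢
      push_cast at h2 ⊢
      omega
  · rintro (⟨d, r, -, e⟩ | hk)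
    · exact ⟨d, r, e⟩
    · obtain ⟨d, x, rfl⟩ := exists_position n l k
      have h1 := h d
      have h2 := lt_position_iff n l d x M
      have e : (((s d - x).toNat : ℕ) : ℤ) = s d - x := by omega
      refine ⟨d, (s d - x).toNat, ?_⟩
      rw [rowLen_eq_zero (mu := lam d) (by omega), e]
      congr 1
      simp

theorem ketSeq_vacuum {lam : MultiPartition l} {M : ℕ} (h : Fits n s lam M) {t : ℕ}
    (ht : (ketWord n s lam M).length ≤ t) : (ketSeq n l s lam).1 t = ∑ d, s d - t := by
  rw [ketSeq_eq h]
  exact List.getD_eq_default _ _ ht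

theorem prefixWord_ketSeq {lam : MultiPartition l} {M : ℕ} (h : Fits n s lam M) :
    prefixWord (ketSeq n l s lam).1 (ketWord n s lam M).length = ketWord n s lam M := by
  symm
  apply eq_prefixWord rfl
  intro i hi
  rw [ketSeq_eq h]
  change _ = (ketWord n s lam M).getD i _
  rw [List.getD_eq_getElem _ _ hi, List.getD_eq_getElem _ _ hi]

theorem ketSeq_injective : Function.Injective (ketSeq n l s) := by
  intro lam mu h
  have hb : beads n l lam s = beads n l mu s := by rw [← range_ketSeq, ← range_ketSeq, h]
  have key : ∀ d, (fun r : ℕ => s d + ((lam d).rowLen r : ℤ) - r) =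
      fun r : ℕ => s d + ((mu d).rowLen r : ℤ) - r := by
    intro d
    refine strictAnti_range_inj (row_strictAnti lam d) (row_strictAnti mu d) ?_
    have hr : ∀ nu : MultiPartition l, Set.range (fun r : ℕ => s d + ((nu d).rowLen r : ℤ) - r) =
        {x | position n l d x ∈ beads n l nu s} := by
      intro nu
      ext x
      simp only [Set.mem_range, beads, Set.mem_ofPred_eq]
      constructor
      · rintro ⟨r, rfl⟩
        exact ⟨d, r, rfl⟩
      · rintro ⟨d', r, e⟩
        obtain ⟨rfl, e⟩ := position_injective e
        exact ⟨r, e.symm⟩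
    rw [hr, hr, hb]
  funext d
  exact YoungDiagram.ext (by
    ext ⟨i, j⟩
    have e := congrFun (key d) i
    rw [YoungDiagram.mem_cells, YoungDiagram.mem_cells, YoungDiagram.mem_iff_lt_rowLen,
      YoungDiagram.mem_iff_lt_rowLen]
    omega)

/-- An ordered word whose numbers of letters are right describes a multipartition. -/
theorem exists_ketWord_eq {w : List ℤ} (hw : w.Pairwise (· > ·)) {M : ℕ}
    (hM : ∀ k ∈ w, -(n * l * M : ℤ) < k)
    (hd : ∀ d : Fin l, (w.map fun k => if dPart n l k = (d : ℕ) + 1 then (1 : ℤ) else 0).sum =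
      s d + n * M) : ∃ mu, Fits n s mu M ∧ ketWord n s mu M = w := by
  set X : Fin l → List ℤ := fun d =>
    (w.filter fun k => dPart n l k = (d : ℕ) + 1).map (xPart n l) with hX
  have hlen : ∀ d, ((X d).length : ℤ) = s d + n * M := by
    intro d
    rw [← hd, sum_map_indicator, hX, List.length_map]
  have hmem : ∀ d x, x ∈ X d ↔ position n l d x ∈ w := by
    intro d x
    rw [hX, List.mem_map]
    constructor
    · rintro ⟨k, hk, rfl⟩
      rw [List.mem_filter, decide_eq_true_eq] at hk
      rw [position_xPart hk.2]
      exact hk.1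
    · intro h
      exact ⟨_, List.mem_filter.mpr ⟨h, by simp [dPart_position]⟩, xPart_position d x⟩
  have hanti : ∀ d, StrictAnti (extend (s d) (X d)).1 := by
    intro d
    apply extend_strictAnti
    · rw [hX, List.pairwise_map]
      refine List.Pairwise.imp_of_mem ?_ (hw.filter _)
      intro a b ha hb hab
      rw [List.mem_filter, decide_eq_true_eq] at ha hb
      exact xPart_lt_xPart (hb.2.trans ha.2.symm) hab
    · intro x hx
      have := (lt_position_iff n l d x M).mp (hM _ ((hmem d x).mp hx))
      rw [hlen]
      omega
  have hvac : ∀ d r, (X d).length ≤ r → (extend (s d) (X d)).1 r = s d - r := fun d r hr =>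
    List.getD_eq_default _ _ hr
  have hanti' : ∀ d, Antitone fun r : ℕ => (extend (s d) (X d)).1 r + r := fun d =>
    StrictAnti.antitone_add (hanti d)
  have hge : ∀ d (r : ℕ), s d ≤ (extend (s d) (X d)).1 r + r := by
    intro d r
    have h1 := hanti' d (le_max_left r (X d).length)
    have h2 := hvac d _ (le_max_right r (X d).length)
    dsimp only at h1
    omega
  have hmu : ∀ d, ∃ mu : YoungDiagram, ∀ r, mu.rowLen r =
      ((extend (s d) (X d)).1 r + r - s d).toNat := by
    intro d
    refine exists_youngDiagram (L := (X d).length) ?_ ?_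
    · intro a b hab
      have := hanti' d hab
      dsimp only at this ⊢
      omega
    · intro r hr
      rw [hvac d r hr]
      omega
  choose mu hmu using hmu
  have hrow : ∀ d (r : ℕ), s d + ((mu d).rowLen r : ℤ) - r = (extend (s d) (X d)).1 r := by
    intro d r
    have := hge d r
    rw [hmu]
    omega
  refine ⟨mu, fun d => ?_, ?_⟩
  · rw [← hlen, Nat.cast_le]
    apply colLen_le
    rw [hmu, hvac d _ le_rfl]
    omega
  · refine List.Pairwise.eq_of_mem_iff (pairwise_ketWord mu M) hw ?_
    intro k
    rw [mem_ketWord]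
    constructor
    · rintro ⟨d, r, hr, rfl⟩
      rw [hrow, ← hmem]
      rw [← hlen, Nat.cast_lt] at hr
      change (X d).getD r _ ∈ X d
      rw [List.getD_eq_getElem _ _ hr]
      exact List.getElem_mem hr
    · intro hk
      obtain ⟨d, x, rfl⟩ := exists_position n l k
      obtain ⟨r, hr, rfl⟩ := List.mem_iff_getElem.mp ((hmem d x).mpr hk)
      refine ⟨d, r, by rw [← hlen, Nat.cast_lt]; exact hr, ?_⟩
      rw [hrow]
      change _ = position n l d ((X d).getD r _)
      rw [List.getD_eq_getElem _ _ hr]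

/-- Sums over the letters that are additive in `(c, d, m)` are preserved by straightening. -/
theorem Step.sum_map_eq {w w' : List ℤ} (h : Step n l w w') (α β : ℤ → ℤ) (γ : ℤ) :
    (w'.map fun k => α (cPart n k) + β (dPart n l k) + γ * mPart n l k).sum =
      (w.map fun k => α (cPart n k) + β (dPart n l k) + γ * mPart n l k).sum := by
  obtain ⟨u, v, a, b, p, -, hp, rfl, rfl⟩ := h
  simp only [List.map_append, List.map_cons, List.sum_append, List.sum_cons]
  rcases hp with rfl | ⟨j, -, rfl⟩
  · ring
  · simp only [corr, cPart_cross, dPart_cross, mPart_cross]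
    ring

theorem Reach.sum_map_eq {w w' : List ℤ} (h : Reach n l w.reverse w') (α β : ℤ → ℤ) (γ : ℤ) :
    (w'.map fun k => α (cPart n k) + β (dPart n l k) + γ * mPart n l k).sum =
      (w.map fun k => α (cPart n k) + β (dPart n l k) + γ * mPart n l k).sum := by
  refine h.induct (Q := fun w' => (w'.map fun k =>
    α (cPart n k) + β (dPart n l k) + γ * mPart n l k).sum =
      (w.map fun k => α (cPart n k) + β (dPart n l k) + γ * mPart n l k).sum)
    (fun _ _ h g => (h.sum_map_eq α β γ).trans g) ?_
  rw [((List.reverse_perm w).map _).sum_eq]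

/-- Straightening a reversed ordered wedge yields ordered wedges of multipartitions of the same
size. -/
theorem exists_ketWord_of_reach {lam : MultiPartition l} {M : ℕ} (h : Fits n s lam M)
    {w : List ℤ} (hw : w.Pairwise (· > ·)) (hr : Reach n l (ketWord n s lam M).reverse w) :
    ∃ mu, Fits n s mu M ∧ ketWord n s mu M = w ∧ mu.size = lam.size := by
  have hM : ∀ k ∈ w, -(n * l * M : ℤ) < k :=
    hr.induct (Q := fun w => ∀ k ∈ w, -(n * l * M : ℤ) < k)
      (fun _ _ h g => h.forall_lt g) fun k hk => lt_of_mem_ketWord (List.mem_reverse.mp hk)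
  obtain ⟨mu, h1, h2⟩ := exists_ketWord_eq (s := s) hw hM fun d => by
    have e := hr.sum_map_eq (fun _ => 0) (fun x => if x = (d : ℕ) + 1 then 1 else 0) 0
    simp only [zero_add, zero_mul, add_zero] at e
    rw [e, sum_dPart_ketWord h d]
  refine ⟨mu, h1, h2, ?_⟩
  have e := hr.sum_map_eq (fun c => c) (fun _ => 0) (-(n : ℤ))
  have e' : (fun k => cPart n k + 0 + -(n : ℤ) * mPart n l k) = xPart n l := by
    funext k
    rw [xPart]
    ring
  rw [e', ← h2, sum_xPart_ketWord h1, sum_xPart_ketWord h] at e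
  omega

end KetWords

/-! ### The matrix of the bar involution -/

section BarMatrix

variable (n : ℕ) {l : ℕ} (s : Fin l → ℤ)

/-- The height function for which the bar involution is triangular: the energy of the ordered word,
cut off at a level that depends on the number of boxes only. -/
def height (lam : MultiPartition l) : ℕ :=
  energy (ketWord n s lam (lam.size + ∑ d, (s d).natAbs))

/-- The vector of the Fock space, as a combination of finite wedges cut off at level `M`. -/
def finiteKet (M : ℕ) : Fock l →ₗ[Kq] FiniteWedge n l :=
  Finsupp.linearCombination Kq fun lam => cls n l (ketWord n s lam M)

variable {n s}

theorem finiteKet_single (M : ℕ) (lam : MultiPartition l) :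
    finiteKet n s M (Finsupp.single lam 1) = cls n l (ketWord n s lam M) := by
  rw [finiteKet, Finsupp.linearCombination_single, one_smul]

variable [NeZero n]

theorem eventually_fits (lam : MultiPartition l) : ∀ᶠ M in atTop, Fits n s lam M := by
  refine eventually_all.mpr fun d => ?_
  filter_upwards [eventually_ge_atTop ((lam d).colLen 0 + (s d).natAbs)] with M hM
  have hn : (1 : ℤ) ≤ n := by exact_mod_cast Nat.one_le_iff_ne_zero.mpr (NeZero.ne n)
  nlinarith [neg_abs_le (s d), Int.natCast_natAbs (s d)]

theorem fits_of_size (lam : MultiPartition l) {M : ℕ} (hM : lam.size + ∑ d, (s d).natAbs ≤ M) :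
    Fits n s lam M := by
  intro d
  have hn : (1 : ℤ) ≤ n := by exact_mod_cast Nat.one_le_iff_ne_zero.mpr (NeZero.ne n)
  have h1 : (lam d).card ≤ lam.size :=
    Finset.single_le_sum (f := fun d => (lam d).card) (fun _ _ => Nat.zero_le _) (Finset.mem_univ d)
  have h2 : (s d).natAbs ≤ ∑ d, (s d).natAbs :=
    Finset.single_le_sum (f := fun d => (s d).natAbs) (fun _ _ => Nat.zero_le _) (Finset.mem_univ d)
  have h3 := colLen_le_card (lam d)
  have h4 : (((lam d).colLen 0 + (s d).natAbs : ℕ) : ℤ) ≤ M := by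
    rw [Nat.cast_le]; omega
  push_cast at h4
  nlinarith [neg_abs_le (s d), Int.natCast_natAbs (s d)]

variable [NeZero l]

theorem toWedge_single (lam : MultiPartition l) :
    toWedge n l s (Finsupp.single lam 1) = wedge n l (ketSeq n l s lam) := by
  rw [toWedge, Finsupp.linearCombination_single, one_smul]

theorem completeWedge_ketWord {lam : MultiPartition l} {M : ℕ} (h : Fits n s lam M) :
    completeWedge n l (∑ d, s d) (cls n l (ketWord n s lam M)) =
      toWedge n l s (Finsupp.single lam 1) := by
  rw [completeWedge_cls, toWedge_single, ketSeq_eq h]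

theorem completeWedge_finiteKet {z : Fock l} {M : ℕ} (h : ∀ lam, z lam ≠ 0 → Fits n s lam M) :
    completeWedge n l (∑ d, s d) (finiteKet n s M z) = toWedge n l s z := by
  rw [linearMap_apply_eq_sum (finiteKet n s M), linearMap_apply_eq_sum (toWedge n l s), Finsupp.sum,
    map_sum]
  refine Finset.sum_congr rfl fun lam hlam => ?_
  rw [map_smul, finiteKet_single, completeWedge_ketWord (h lam (Finsupp.mem_support_iff.mp hlam))]

theorem toWedge_injective : Function.Injective (toWedge n l s) := by
  rw [← LinearMap.ker_eq_bot, LinearMap.ker_eq_bot']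
  intro z hz
  have e : toWedge n l s z = (relations n l _).mkQ (z.mapDomain (ketSeq n l s)) := by
    rw [linearMap_apply_eq_sum, Finsupp.mapDomain, Finsupp.sum, Finsupp.sum, map_sum]
    refine Finset.sum_congr rfl fun lam _ => ?_
    rw [toWedge_single, wedge, ← map_smul, Finsupp.smul_single, smul_eq_mul, mul_one]
  rw [e, Submodule.mkQ_apply, Submodule.Quotient.mk_eq_zero] at hz
  classical
  have h0 := eq_zero_of_mem_relations (fun k hk => by
    obtain ⟨lam, -, rfl⟩ := Finset.mem_image.mp
      (Finsupp.mapDomain_support (Finsupp.mem_support_iff.mpr hk))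
    exact ketSeq_strictAnti lam) hz
  exact Finsupp.mapDomain_injective ketSeq_injective (h0.trans Finsupp.mapDomain_zero.symm)

theorem eventually_le_length_ketWord (lam : MultiPartition l) (r : ℕ) :
    ∀ᶠ M in atTop, r ≤ (ketWord n s lam M).length := by
  filter_upwards [eventually_fits (n := n) (s := s) lam,
    eventually_ge_atTop (r + (∑ d, s d).natAbs)] with M h hM
  have h1 := length_ketWord h
  have hn : (1 : ℤ) ≤ n := by exact_mod_cast Nat.one_le_iff_ne_zero.mpr (NeZero.ne n)
  have hl : (1 : ℤ) ≤ l := by exact_mod_cast Nat.one_le_iff_ne_zero.mpr (NeZero.ne l)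
  have h2 : (1 : ℤ) ≤ n * l := by nlinarith
  zify at hM ⊢
  rw [h1]
  nlinarith [neg_abs_le (∑ d, s d)]

theorem energy_prefixWord {s : ℤ} {k k' : ℕ → ℤ} {r₀ r : ℕ} (hr : r₀ ≤ r)
    (h : ∀ t, r₀ ≤ t → k t = s - t) (h' : ∀ t, r₀ ≤ t → k' t = s - t) :
    energy (prefixWord k r) + energy (prefixWord k' r₀) =
      energy (prefixWord k r₀) + energy (prefixWord k' r) := by
  induction r, hr using Nat.le_induction with
  | base => rfl
  | succ r hr ih =>
    rw [prefixWord_succ, prefixWord_succ, energy_append, energy_append, h r hr, h' r hr]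
    omega

/-- A comparison of energies at any sufficiently large cut-off is one of heights, because a change of
the cut-off adds the same vacuum letters to both words. -/
theorem height_lt_height {lam mu : MultiPartition l} {M : ℕ} (hsize : mu.size = lam.size)
    (hM : lam.size + ∑ d, (s d).natAbs ≤ M)
    (h : energy (ketWord n s mu M) < energy (ketWord n s lam M)) :
    height n s mu < height n s lam := by
  rw [height, height, hsize]
  set M₀ := lam.size + ∑ d, (s d).natAbs with hM₀
  have f1 : Fits n s lam M₀ := fits_of_size lam le_rfl
  have f2 : Fits n s mu M₀ := fits_of_size mu (by rw [hsize])
  have f3 : Fits n s lam M := fits_of_size lam hM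
  have f4 : Fits n s mu M := fits_of_size mu (by rw [hsize]; exact hM)
  have l1 := length_ketWord f1
  have l2 := length_ketWord f2
  have l3 := length_ketWord f3
  have l4 := length_ketWord f4
  have l12 : (ketWord n s mu M₀).length = (ketWord n s lam M₀).length := by omega
  have l34 : (ketWord n s mu M).length = (ketWord n s lam M).length := by omega
  have l13 : (ketWord n s lam M₀).length ≤ (ketWord n s lam M).length := by
    zify
    rw [l1, l3]
    have : (n : ℤ) * l * M₀ ≤ n * l * M :=
      mul_le_mul_of_nonneg_left (by exact_mod_cast hM) (by positivity)
    omega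
  have e := energy_prefixWord l13 (fun t => ketSeq_vacuum f1)
    (fun t ht => ketSeq_vacuum f2 (l12.trans_le ht))
  rw [prefixWord_ketSeq f1, prefixWord_ketSeq f3, ← l12, prefixWord_ketSeq f2, ← l34,
    prefixWord_ketSeq f4] at e
  omega

/-- The bar involution of an ordered finite wedge, cut off at level `M`. -/
theorem exists_barFinite_ketWord {lam : MultiPartition l} {M : ℕ} (h : Fits n s lam M) :
    ∃ a : Fock l, barFinite n l (cls n l (ketWord n s lam M)) = finiteKet n s M a ∧ a lam = 1 ∧
      (∀ mu, a mu ∈ laurent) ∧ ∀ mu, a mu ≠ 0 → Fits n s mu M ∧ mu.size = lam.size ∧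
        Reach n l (ketWord n s lam M).reverse (ketWord n s mu M) ∧
        (mu ≠ lam → energy (ketWord n s mu M) < energy (ketWord n s lam M)) := by
  classical
  have hmem := barFinite_cls_sub_mem (n := n) (l := l) (pairwise_ketWord (n := n) (s := s) lam M)
  have key : ∀ y ∈ straightenSpan n l (ketWord n s lam M).reverse
      (fun w' => energy w' < energy (ketWord n s lam M)), ∃ a : Fock l, y = finiteKet n s M a ∧
      (∀ mu, a mu ∈ laurent) ∧ ∀ mu, a mu ≠ 0 → Fits n s mu M ∧ mu.size = lam.size ∧
        Reach n l (ketWord n s lam M).reverse (ketWord n s mu M) ∧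
        energy (ketWord n s mu M) < energy (ketWord n s lam M) := by
    intro y hy
    induction hy using Submodule.span_induction with
    | mem y hy =>
      obtain ⟨w, ⟨h1, h2, h3⟩, rfl⟩ := hy
      obtain ⟨mu, g1, rfl, g2⟩ := exists_ketWord_of_reach h h1 h2
      refine ⟨Finsupp.single mu 1, (finiteKet_single M mu).symm, fun nu => ?_, fun nu hnu => ?_⟩
      · rw [Finsupp.single_apply]
        split_ifs
        · exact one_mem _
        · exact zero_mem _
      · have : nu = mu := by
          by_contra hc
          exact hnu (Finsupp.single_eq_of_ne hc)
        subst this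
        exact ⟨g1, g2, h2, h3⟩
    | zero => exact ⟨0, (map_zero _).symm, fun _ => zero_mem _, fun mu hmu => absurd rfl hmu⟩
    | add x y _ _ hx hy =>
      obtain ⟨a, e1, a1, a2⟩ := hx
      obtain ⟨b, e2, b1, b2⟩ := hy
      refine ⟨a + b, by rw [map_add, e1, e2], fun mu => add_mem (a1 mu) (b1 mu), fun mu hmu => ?_⟩
      by_cases ha : a mu = 0
      · refine b2 mu fun hb => hmu ?_
        rw [Finsupp.add_apply, ha, hb, add_zero]
      · exact a2 mu ha
    | smul c x _ hx =>
      obtain ⟨a, e1, a1, a2⟩ := hx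
      refine ⟨(c : Kq) • a, ?_, fun mu => mul_mem c.2 (a1 mu), fun mu hmu => a2 mu fun h0 => hmu ?_⟩
      · rw [map_smul, e1]; rfl
      · rw [Finsupp.smul_apply, h0, smul_zero]
  obtain ⟨a, e, a1, a2⟩ := key _ hmem
  have ha : a lam = 0 := by
    by_contra hc
    exact lt_irrefl _ (a2 lam hc).2.2.2
  refine ⟨a + Finsupp.single lam 1, ?_, ?_, fun mu => add_mem (a1 mu) ?_, fun mu hmu => ?_⟩
  · rw [map_add, finiteKet_single, ← e, sub_add_cancel]
  · rw [Finsupp.add_apply, ha, Finsupp.single_eq_same, zero_add]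
  · rw [Finsupp.single_apply]
    split_ifs
    · exact one_mem _
    · exact zero_mem _
  · by_cases hml : mu = lam
    · subst hml
      refine ⟨h, rfl, ?_, fun hc => absurd rfl hc⟩
      have := reach_sortWord (n := n) (l := l) (ketWord n s mu M).reverse
      rwa [sortWord_eq_of_perm (List.reverse_perm _), sortWord, List.Pairwise.insertionSort_eq
        ((pairwise_ketWord mu M).imp fun h => le_of_lt h)] at this
    · rw [Finsupp.add_apply, Finsupp.single_eq_of_ne hml, add_zero] at hmu
      obtain ⟨g1, g2, g3, g4⟩ := a2 mu hmu
      exact ⟨g1, g2, g3, fun _ => g4⟩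

/-- The bar involution of `|λ; s⟩` has an expansion in the standard basis that is valid for all
sufficiently large cut-offs. -/
theorem exists_barColumn (lam : MultiPartition l) : ∃ a : Fock l,
    (∀ᶠ r in atTop, barWedge n l r (ketSeq n l s lam) = toWedge n l s a) ∧
    (∀ᶠ M in atTop, barFinite n l (cls n l (ketWord n s lam M)) = finiteKet n s M a) ∧
    a lam = 1 ∧ (∀ mu, a mu ∈ laurent) ∧
    ∀ mu, a mu ≠ 0 → mu.size = lam.size ∧ (mu ≠ lam → height n s mu < height n s lam) ∧
      ∀ᶠ M in atTop, Reach n l (ketWord n s lam M).reverse (ketWord n s mu M) := by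
  obtain ⟨r₀, hr₀⟩ := eventually_barWedge_eq (n := n) (l := l) _
    (ketSeq_strictAnti (n := n) (s := s) lam)
  have hstep : ∀ M a, Fits n s lam M → r₀ ≤ (ketWord n s lam M).length →
      barFinite n l (cls n l (ketWord n s lam M)) = finiteKet n s M a →
      (∀ mu, a mu ≠ 0 → Fits n s mu M) →
      barWedge n l r₀ (ketSeq n l s lam) = toWedge n l s a := by
    intro M a hM hr e ha
    rw [← hr₀ _ hr, barWedge_eq _ (fun t => ketSeq_vacuum hM), prefixWord_ketSeq hM, e,
      completeWedge_finiteKet ha]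
  have hM : ∀ᶠ M in atTop, Fits n s lam M ∧ r₀ ≤ (ketWord n s lam M).length ∧
      lam.size + ∑ d, (s d).natAbs ≤ M :=
    (eventually_fits lam).and
      ((eventually_le_length_ketWord (n := n) (s := s) lam r₀).and (eventually_ge_atTop _))
  obtain ⟨M₁, h1, h2, h3⟩ := hM.exists
  obtain ⟨a, e, ha1, ha2, ha3⟩ := exists_barFinite_ketWord h1
  have hw := hstep M₁ a h1 h2 e fun mu hmu => (ha3 mu hmu).1
  have hall : ∀ᶠ M in atTop, barFinite n l (cls n l (ketWord n s lam M)) = finiteKet n s M a ∧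
      ∀ mu, a mu ≠ 0 → Reach n l (ketWord n s lam M).reverse (ketWord n s mu M) := by
    filter_upwards [hM] with M ⟨g1, g2, _⟩
    obtain ⟨b, e', -, -, hb⟩ := exists_barFinite_ketWord g1
    have hw' := hstep M b g1 g2 e' fun mu hmu => (hb mu hmu).1
    obtain rfl : a = b := toWedge_injective (hw.symm.trans hw')
    exact ⟨e', fun mu hmu => (hb mu hmu).2.2.1⟩
  refine ⟨a, ?_, hall.mono fun M h => h.1, ha1, ha2, fun mu hmu => ⟨(ha3 mu hmu).2.1, fun hne =>
    height_lt_height (ha3 mu hmu).2.1 h3 ((ha3 mu hmu).2.2.2 hne), hall.mono fun M h => h.2 mu hmu⟩⟩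
  filter_upwards [eventually_ge_atTop r₀] with r hr
  rw [hr₀ r hr, hw]

variable (n s) in
/-- The expansion of the bar involution of `|λ; s⟩` in the standard basis. -/
def barMatrix (lam : MultiPartition l) : Fock l := (exists_barColumn (n := n) (s := s) lam).choose

theorem barMatrix_spec (lam : MultiPartition l) :
    (∀ᶠ r in atTop, barWedge n l r (ketSeq n l s lam) = toWedge n l s (barMatrix n s lam)) ∧
    (∀ᶠ M in atTop, barFinite n l (cls n l (ketWord n s lam M)) =
      finiteKet n s M (barMatrix n s lam)) ∧
    barMatrix n s lam lam = 1 ∧ (∀ mu, barMatrix n s lam mu ∈ laurent) ∧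
    ∀ mu, barMatrix n s lam mu ≠ 0 → mu.size = lam.size ∧
      (mu ≠ lam → height n s mu < height n s lam) ∧
      ∀ᶠ M in atTop, Reach n l (ketWord n s lam M).reverse (ketWord n s mu M) :=
  (exists_barColumn lam).choose_spec

theorem eventually_barFinite_finiteKet (z : Fock l) : ∀ᶠ M in atTop,
    barFinite n l (finiteKet n s M z) = finiteKet n s M (semilinearExt (barMatrix n s) z) := by
  induction z using Finsupp.induction_linear with
  | zero => simp
  | add x y hx hy =>
    filter_upwards [hx, hy] with M h1 h2
    simp only [map_add, h1, h2]
  | single lam c =>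
    filter_upwards [(barMatrix_spec (n := n) (s := s) lam).2.1] with M h
    rw [semilinearExt_single, (finiteKet n s M).map_smul, ← h, ← mul_one c, ← smul_eq_mul,
      ← Finsupp.smul_single, (finiteKet n s M).map_smul, LinearMap.map_smulₛₗ, finiteKet_single,
      smul_eq_mul, mul_one]

theorem eventually_completeWedge_finiteKet (z : Fock l) : ∀ᶠ M in atTop,
    completeWedge n l (∑ d, s d) (finiteKet n s M z) = toWedge n l s z := by
  have : ∀ᶠ M in atTop, ∀ lam ∈ z.support, Fits n s lam M :=
    (Filter.eventually_all_finset _).mpr fun lam _ => eventually_fits lam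
  filter_upwards [this] with M h
  exact completeWedge_finiteKet fun lam hlam => h lam (Finsupp.mem_support_iff.mpr hlam)

/-- Equality in the Fock space can be tested on finite wedges. -/
theorem eq_of_eventually_finiteKet {x y : Fock l}
    (h : ∀ᶠ M in atTop, finiteKet n s M x = finiteKet n s M y) : x = y := by
  obtain ⟨M, h1, h2, h3⟩ := (h.and ((eventually_completeWedge_finiteKet (n := n) (s := s) x).and
    (eventually_completeWedge_finiteKet (n := n) (s := s) y))).exists
  apply toWedge_injective (n := n) (s := s)
  rw [← h2, ← h3, h1]

theorem isBarMatrix_barMatrix : IsBarMatrix (barMatrix n s) (height n s) where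
  diag lam := (barMatrix_spec (n := n) (s := s) lam).2.2.1
  lower lam mu h hne := ((barMatrix_spec (n := n) (s := s) lam).2.2.2.2 mu h).2.1 hne
  mem_laurent lam := (barMatrix_spec (n := n) (s := s) lam).2.2.2.1
  invol lam := by
    apply eq_of_eventually_finiteKet (n := n) (s := s)
    filter_upwards [eventually_barFinite_finiteKet (n := n) (s := s) (barMatrix n s lam),
      (barMatrix_spec (n := n) (s := s) lam).2.1] with M h1 h2
    rw [← h1, ← h2, barFinite_barFinite_cls, finiteKet_single]

theorem isBar_iff {x y : Fock l} : IsBar n l s x y ↔ semilinearExt (barMatrix n s) x = y := by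
  have h : ∀ᶠ r in atTop, barTrunc n l r s x = toWedge n l s (semilinearExt (barMatrix n s) x) := by
    have : ∀ᶠ r in atTop, ∀ lam ∈ x.support, barWedge n l r (ketSeq n l s lam) =
        toWedge n l s (barMatrix n s lam) :=
      (Filter.eventually_all_finset _).mpr fun lam _ => (barMatrix_spec (n := n) (s := s) lam).1
    filter_upwards [this] with r hr
    rw [barTrunc, semilinearExt_apply, Finsupp.sum, Finsupp.sum, map_sum]
    refine Finset.sum_congr rfl fun lam hlam => ?_
    rw [hr lam hlam, map_smul]
  constructor
  · intro hxy
    obtain ⟨r, h1, h2⟩ := (h.and hxy).exists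
    exact toWedge_injective (h1.symm.trans h2)
  · rintro rfl
    exact h

theorem isCanonicalBasis_iff {ε : Sgn} {G : Module.Basis (MultiPartition l) Kq (Fock l)} :
    IsCanonicalBasis n l ε s G ↔ ∀ lam, semilinearExt (barMatrix n s) (G lam) = G lam ∧
      ∀ mu, ∃ p, (G lam - Finsupp.single lam (1 : Kq) : Fock l) mu = ε.q * evalAt ε.q p := by
  refine forall_congr' fun lam => and_congr isBar_iff ?_
  constructor
  · rintro ⟨y, hy, e⟩ mu
    obtain ⟨p, hp⟩ := hy mu
    refine ⟨p, ?_⟩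
    rw [e, add_sub_cancel_left, Finsupp.smul_apply, smul_eq_mul, hp]
  · intro h
    refine ⟨ε.q⁻¹ • (G lam - Finsupp.single lam 1), fun mu => ?_, ?_⟩
    · obtain ⟨p, hp⟩ := h mu
      refine ⟨p, ?_⟩
      rw [Finsupp.smul_apply, hp, smul_eq_mul, inv_mul_cancel_left₀ (sgn_ne_zero ε)]
    · rw [smul_smul, mul_inv_cancel₀ (sgn_ne_zero ε), one_smul, add_sub_cancel]

variable (n s) in
theorem existsUnique_isCanonicalBasis (ε : Sgn) : ∃! G, IsCanonicalBasis n l ε s G := by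
  simp only [isCanonicalBasis_iff]
  exact isBarMatrix_barMatrix.existsUnique_basis ε

/-- The characterization of the vectors of the canonical basis, and the support of these. -/
theorem exists_canonicalVector (ε : Sgn) (lam : MultiPartition l) : ∃ g : Fock l,
    (∀ mu, decompositionNumber n l ε s lam mu = g mu) ∧
    semilinearExt (barMatrix n s) g = g ∧
    (∀ mu, ∃ p, (g - Finsupp.single lam (1 : Kq) : Fock l) mu = ε.q * evalAt ε.q p) ∧
    (∀ x : Fock l, semilinearExt (barMatrix n s) x = x →
      (∀ mu, ∃ p, (x - Finsupp.single lam (1 : Kq) : Fock l) mu = ε.q * evalAt ε.q p) → x = g) ∧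
    ∀ C : MultiPartition l → Prop, (∀ mu nu, C mu → barMatrix n s mu nu ≠ 0 → C nu) → C lam →
      ∀ mu, g mu ≠ 0 → C mu := by
  have hex := (existsUnique_isCanonicalBasis n s ε).exists
  have hG := isCanonicalBasis_iff.mp hex.choose_spec lam
  have huniq : ∀ x : Fock l, semilinearExt (barMatrix n s) x = x →
      (∀ mu, ∃ p, (x - Finsupp.single lam (1 : Kq) : Fock l) mu = ε.q * evalAt ε.q p) →
      x = hex.choose lam := by
    intro x h1 h2
    refine isBarMatrix_barMatrix.eq_of_invariant ε h1 hG.1 fun mu => ?_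
    obtain ⟨p, hp⟩ := h2 mu
    obtain ⟨p', hp'⟩ := hG.2 mu
    refine ⟨p - p', ?_⟩
    rw [map_sub, mul_sub, ← hp, ← hp']
    simp only [Finsupp.sub_apply]
    ring
  refine ⟨hex.choose lam, fun mu => ?_, hG.1, hG.2, huniq, ?_⟩
  · rw [decompositionNumber, dif_pos hex]
  · obtain ⟨g, h1, h2, -, h4⟩ := isBarMatrix_barMatrix.exists_invariant (a := barMatrix n s) ε lam
    rw [← huniq g h1 h2]
    exact h4

end BarMatrix

/-! ### Products of wedges with a complete set of letters of one component -/

section Products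

variable {n l : ℕ}

variable (n l) in
/-- Multiplication of finite wedges with words from both sides. -/
def sandwichWedge (u v : List ℤ) : FiniteWedge n l →ₗ[Kq] FiniteWedge n l :=
  Submodule.mapQ _ _ (sandwich u v) fun _ h => sandwich_mem u v h

theorem sandwichWedge_cls (u v w : List ℤ) :
    sandwichWedge n l u v (cls n l w) = cls n l (u ++ (w ++ v)) := by
  rw [cls, Submodule.mkQ_apply, sandwichWedge, Submodule.mapQ_apply, sandwich_single]
  rfl

theorem barFactor_append (u v : List ℤ) : barFactor n l (u ++ v) =
    barFactor n l u * barFactor n l v *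
      (u.map fun a => (v.map fun b => cf n l a b).prod).prod⁻¹ := by
  have hinv : ∀ (a : ℤ) (v : List ℤ), (v.map fun b => (cf n l a b)⁻¹).prod =
      (v.map fun b => cf n l a b).prod⁻¹ := by
    intro a v
    induction v with
    | nil => simp
    | cons b v ih => rw [List.map_cons, List.prod_cons, ih, List.map_cons, List.prod_cons, mul_inv]
  induction u with
  | nil => simp [barFactor]
  | cons a u ih =>
    rw [List.cons_append, barFactor, barFactor, ih, List.map_append, List.prod_append, hinv a v,
      List.map_cons, List.prod_cons, mul_inv]
    ring

/-- The product of the `cf t x` over the letters `x > t` of `S`. -/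
def upperFactor (n l : ℕ) (S : List ℤ) (t : ℤ) : Kq :=
  (S.map fun x => if t < x then cf n l t x else 1).prod

/-- The product of the `cf t x` over the letters `x < t` of `S`. -/
def lowerFactor (n l : ℕ) (S : List ℤ) (t : ℤ) : Kq :=
  (S.map fun x => if x < t then cf n l t x else 1).prod

theorem upperFactor_mul_lowerFactor {S : List ℤ} {t : ℤ} (ht : t ∉ S) :
    upperFactor n l S t * lowerFactor n l S t = (S.map fun x => cf n l t x).prod := by
  rw [upperFactor, lowerFactor, ← List.prod_map_mul]
  congr 1
  refine List.map_congr_left fun x hx => ?_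
  rcases lt_trichotomy t x with h | rfl | h
  · rw [if_pos h, if_neg h.not_gt, mul_one]
  · exact absurd hx ht
  · rw [if_neg h.not_gt, if_pos h, one_mul]

theorem ascentFactor_cons_of_pairwise {S : List ℤ} (hS : S.Pairwise (· > ·)) (t : ℤ) :
    ascentFactor n l (t :: S) = upperFactor n l S t := by
  rw [ascentFactor, ascentFactor_of_pairwise (hS.imp fun h => le_of_lt h), mul_one, upperFactor]

theorem ascentFactor_append_of_pairwise {S : List ℤ} (hS : S.Pairwise (· > ·)) (t : ℤ) :
    ascentFactor n l (S ++ [t]) = lowerFactor n l S t := by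
  rw [ascentFactor_append_singleton, ascentFactor_of_pairwise (hS.imp fun h => le_of_lt h),
    one_mul, lowerFactor]
  simp only [cf_comm t]

/-- The predicate `E` on letters is preserved by straightening. -/
def LetterClosed (n l : ℕ) (E : ℤ → Prop) : Prop :=
  ∀ a b p, a < b → PairStep n l a b p → E a → E b → E p.1 ∧ E p.2

theorem LetterClosed.reach {E : ℤ → Prop} (hE : LetterClosed n l E) {w w' : List ℤ}
    (h : Reach n l w w') (hw : ∀ k ∈ w, E k) : ∀ k ∈ w', E k := by
  refine h.induct (Q := fun w => ∀ k ∈ w, E k) ?_ hw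
  rintro _ _ ⟨u, v, a, b, p, hab, hp, rfl, rfl⟩ hw k hk
  have := hE a b p hab hp (hw a (by simp)) (hw b (by simp))
  simp only [List.mem_append, List.mem_cons] at hk hw
  rcases hk with hk | rfl | rfl | hk
  · exact hw k (Or.inl hk)
  · exact this.1
  · exact this.2
  · exact hw k (Or.inr (Or.inr (Or.inr hk)))

/-- The ordered list `S` consists of all letters with given `d` that satisfy `E`. -/
structure IsComplete (n l : ℕ) (E : ℤ → Prop) (d : ℤ) (S : List ℤ) : Prop where
  closed : LetterClosed n l E
  pairwise : S.Pairwise (· > ·)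
  mem_iff : ∀ k, k ∈ S ↔ dPart n l k = d ∧ E k

variable [NeZero n] [NeZero l]

theorem LetterClosed.and_gt {E : ℤ → Prop} (hE : LetterClosed n l E) (t : ℤ) :
    LetterClosed n l fun k => E k ∧ t < k := by
  rintro a b p hab hp ⟨ha, ha'⟩ ⟨hb, hb'⟩
  have h1 := hE a b p hab hp ha hb
  have h2 := hp.bounds hab
  exact ⟨⟨h1.1, by omega⟩, ⟨h1.2, by omega⟩⟩

theorem Reach.sum_additive_eq {w w' : List ℤ} (h : Reach n l w w') (α β : ℤ → ℤ) (γ : ℤ) :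
    (w'.map fun k => α (cPart n k) + β (dPart n l k) + γ * mPart n l k).sum =
      (w.map fun k => α (cPart n k) + β (dPart n l k) + γ * mPart n l k).sum := by
  rw [← List.reverse_reverse w] at h
  rw [h.sum_map_eq, ((List.reverse_perm w).map _).sum_eq]

/-- In the product of a complete set of letters with at most one more letter, straightening does not
yield correction terms: there is no room for them, because the letters of the component `d` remain
distinct and the multisets of the `c` and `d` and the sum of the `m` are preserved. -/
theorem IsComplete.cls_eq {E : ℤ → Prop} {d : ℤ} {S : List ℤ} (hS : IsComplete n l E d S)
    {T w : List ℤ} (hT : T.length ≤ 1) (hTE : ∀ t ∈ T, dPart n l t ≠ d ∧ E t)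
    (hw : w.Perm (S ++ T)) : cls n l w = ascentFactor n l w • cls n l (sortWord w) := by
  have h := cls_sub_sortWord_mem (n := n) (l := l) w
  have e : {w' : List ℤ | w'.Pairwise (· > ·) ∧ Reach n l w w' ∧ energy w' < energy w} = ∅ := by
    rw [Set.eq_empty_iff_forall_notMem]
    rintro w' ⟨h1, h2, h3⟩
    have hE' := hS.closed.reach h2 fun k hk => by
      rcases List.mem_append.mp (hw.mem_iff.mp hk) with hk | hk
      · exact ((hS.mem_iff k).mp hk).2
      · exact (hTE k hk).2
    set U := w'.filter fun k => dPart n l k = d with hU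
    set T' := w'.filter fun k => !decide (dPart n l k = d) with hT'
    have hperm : (U ++ T').Perm w' := List.filter_append_perm _ _
    have hfS : (S.filter fun k => dPart n l k = d) = S :=
      List.filter_eq_self.mpr fun k hk => by simpa using ((hS.mem_iff k).mp hk).1
    have hfT : (T.filter fun k => dPart n l k = d) = [] :=
      List.filter_eq_nil_iff.mpr fun k hk => by simpa using (hTE k hk).1
    have hlenU : U.length = S.length := by
      have e1 := h2.sum_additive_eq (fun _ => 0) (fun x => if x = d then 1 else 0) 0
      simp only [zero_add, zero_mul, add_zero] at e1
      rw [(hw.map _).sum_eq, sum_map_indicator, sum_map_indicator, List.filter_append, hfS, hfT,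
        List.append_nil, Nat.cast_inj] at e1
      exact e1
    have hUS : U.Perm S := by
      refine List.Subperm.perm_of_length_le (List.subperm_of_subset ?_ ?_) hlenU.ge
      · exact (h1.filter _).imp fun h => ne_of_gt h
      · intro k hk
        rw [hU, List.mem_filter, decide_eq_true_eq] at hk
        exact (hS.mem_iff k).mpr ⟨hk.2, hE' k hk.1⟩
    have hw' : w'.Perm (S ++ T') := hperm.symm.trans (hUS.append_right T')
    have hsum : ∀ (α β : ℤ → ℤ) (γ : ℤ),
        (T'.map fun k => α (cPart n k) + β (dPart n l k) + γ * mPart n l k).sum =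
          (T.map fun k => α (cPart n k) + β (dPart n l k) + γ * mPart n l k).sum := by
      intro α β γ
      have e1 := h2.sum_additive_eq α β γ
      rw [(hw.map _).sum_eq, (hw'.map _).sum_eq, List.map_append, List.map_append, List.sum_append,
        List.sum_append] at e1
      exact add_left_cancel e1
    have hTT : T' = T := by
      have hl : T'.length = T.length := by
        have := hsum (fun _ => 1) (fun _ => 0) 0
        simp only [zero_mul, add_zero, List.map_const', List.sum_replicate] at this
        simpa using this
      rcases T with _ | ⟨t, _ | ⟨t₂, T⟩⟩
      · exact List.length_eq_zero_iff.mp hl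
      · obtain ⟨t', ht'⟩ := List.length_eq_one_iff.mp hl
        rw [ht'] at hsum ⊢
        have c1 := hsum (fun c => c) (fun _ => 0) 0
        have c2 := hsum (fun _ => 0) (fun x => x) 0
        have c3 := hsum (fun _ => 0) (fun _ => 0) 1
        simp at c1 c2 c3
        rw [eq_of_parts c1 c2 c3]
      · simp at hT
    rw [hTT] at hw'
    rw [energy_perm (hw'.trans hw.symm)] at h3
    exact lt_irrefl _ h3
  rw [straightenSpan, e, Set.image_empty, Submodule.span_empty, Submodule.mem_bot, sub_eq_zero] at h
  exact h

/-- The wedge of a complete set of letters is invariant under the bar involution. -/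
theorem IsComplete.barFinite_cls {E : ℤ → Prop} {d : ℤ} {S : List ℤ} (hS : IsComplete n l E d S) :
    barFinite n l (cls n l S) = cls n l S := by
  have h := hS.cls_eq (T := []) (w := S.reverse) (by simp) (by simp)
    (by rw [List.append_nil]; exact List.reverse_perm S)
  rw [sortWord_eq_of_perm (List.reverse_perm S), sortWord, List.Pairwise.insertionSort_eq
    (hS.pairwise.imp fun h => le_of_lt h)] at h
  rw [FockSpace.barFinite_cls, h, smul_smul, barFactor_mul_ascentFactor hS.pairwise, one_smul]

/-- Shuffling ordered letters into a complete set of letters. -/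
theorem IsComplete.cls_append {E : ℤ → Prop} {d : ℤ} {S : List ℤ} (hS : IsComplete n l E d S)
    {p : List ℤ} (hp : p.Pairwise (· > ·)) (hpE : ∀ t ∈ p, dPart n l t ≠ d ∧ E t) :
    cls n l (p ++ S) = (p.map (upperFactor n l S)).prod • cls n l (sortWord (p ++ S)) := by
  induction p using List.reverseRecOn generalizing E S with
  | nil =>
    rw [List.nil_append, List.map_nil, List.prod_nil, one_smul, sortWord,
      List.Pairwise.insertionSort_eq (hS.pairwise.imp fun h => le_of_lt h)]
  | append_singleton p t ih =>
    obtain ⟨ht, htE⟩ := hpE t (by simp)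
    rw [List.pairwise_append] at hp
    obtain ⟨hp1, -, hp2⟩ := hp
    have hpt : ∀ x ∈ p, t < x := fun x hx => hp2 x hx t (by simp)
    set S₁ := S.filter fun x => t < x with hS₁
    set S₂ := S.filter fun x => !decide (t < x) with hS₂
    have hS₂lt : ∀ x ∈ S₂, x < t := by
      intro x hx
      rw [hS₂, List.mem_filter] at hx
      have h1 : ¬ t < x := by simpa using hx.2
      refine lt_of_le_of_ne (not_lt.mp h1) ?_
      rintro rfl
      exact ht ((hS.mem_iff _).mp hx.1).1
    have hcomp : IsComplete n l (fun k => E k ∧ t < k) d S₁ := by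
      refine ⟨hS.closed.and_gt t, hS.pairwise.filter _, fun k => ?_⟩
      rw [hS₁, List.mem_filter, hS.mem_iff, decide_eq_true_eq, and_assoc]
    have hperm : (S₁ ++ S₂).Perm S := List.filter_append_perm _ _
    have hsort2 : (t :: S₂).Pairwise (· > ·) :=
      List.pairwise_cons.mpr ⟨hS₂lt, hS.pairwise.filter _⟩
    have hsort1 : sortWord (t :: S) = S₁ ++ t :: S₂ := by
      have h1 : (S₁ ++ t :: S₂).Pairwise (· ≥ ·) := by
        rw [List.pairwise_append]
        refine ⟨(hS.pairwise.filter _).imp fun h => le_of_lt h, hsort2.imp fun h => le_of_lt h,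
          fun a ha b hb => ?_⟩
        have ha' : t < a := by simpa using (List.mem_filter.mp ha).2
        rcases List.mem_cons.mp hb with rfl | hb
        · exact ha'.le
        · exact (hS₂lt b hb).le.trans ha'.le
      rw [← h1.insertionSort_eq]
      refine sortWord_eq_of_perm (List.Perm.trans ?_ List.perm_middle.symm)
      exact hperm.symm.cons t
    have hstep : cls n l (t :: S) = upperFactor n l S t • cls n l (S₁ ++ t :: S₂) := by
      have := hS.cls_eq (T := [t]) (w := t :: S) (by simp) (by
        intro x hx
        rw [List.mem_singleton.mp hx]
        exact ⟨ht, htE⟩) (List.perm_append_singleton t S).symm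
      rwa [ascentFactor_cons_of_pairwise hS.pairwise, hsort1] at this
    have hstep' : cls n l (p ++ [t] ++ S) =
        upperFactor n l S t • cls n l (p ++ S₁ ++ t :: S₂) := by
      have := congrArg (sandwichWedge n l p []) hstep
      rw [map_smul, sandwichWedge_cls, sandwichWedge_cls] at this
      simpa using this
    have hih := congrArg (sandwichWedge n l [] (t :: S₂))
      (ih hcomp hp1 fun x hx => ⟨(hpE x (by simp [hx])).1, (hpE x (by simp [hx])).2, hpt x hx⟩)
    rw [map_smul, sandwichWedge_cls, sandwichWedge_cls, List.nil_append, List.nil_append] at hih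
    rw [hstep', hih, smul_smul]
    congr 1
    · rw [List.map_append, List.prod_append, List.map_singleton, List.prod_singleton, mul_comm]
      congr 2
      refine List.map_congr_left fun x hx => ?_
      have h1 := hpt x hx
      rw [upperFactor, upperFactor, ← (hperm.map _).prod_eq, List.map_append, List.prod_append,
        List.prod_eq_one (l := S₂.map _), mul_one]
      intro y hy
      obtain ⟨z, hz, rfl⟩ := List.mem_map.mp hy
      rw [if_neg (by have := hS₂lt z hz; omega)]
    · have h1 : (sortWord (p ++ S₁) ++ t :: S₂).Pairwise (· ≥ ·) := by
        rw [List.pairwise_append]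
        refine ⟨List.pairwise_insertionSort _ _, hsort2.imp fun h => le_of_lt h, fun a ha b hb => ?_⟩
        have ha' : t < a := by
          rcases List.mem_append.mp ((List.perm_insertionSort _ _).mem_iff.mp ha) with ha | ha
          · exact hpt a ha
          · simpa using (List.mem_filter.mp ha).2
        rcases List.mem_cons.mp hb with rfl | hb
        · exact ha'.le
        · exact (hS₂lt b hb).le.trans ha'.le
      rw [← h1.insertionSort_eq]
      congr 1
      refine sortWord_eq_of_perm ?_
      refine ((List.perm_insertionSort _ _).append_right _).trans ?_
      rw [List.append_assoc, List.append_assoc]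
      refine List.Perm.append_left p (List.perm_middle.trans ?_)
      exact hperm.cons t

/-- Moving letters through a complete set of letters. -/
theorem IsComplete.cls_append_comm {E : ℤ → Prop} {d : ℤ} {S : List ℤ} (hS : IsComplete n l E d S)
    {p : List ℤ} (hpE : ∀ t ∈ p, dPart n l t ≠ d ∧ E t) :
    (p.map (lowerFactor n l S)).prod • cls n l (p ++ S) =
      (p.map (upperFactor n l S)).prod • cls n l (S ++ p) := by
  induction p using List.reverseRecOn with
  | nil => simp
  | append_singleton p t ih =>
    have ht := hpE t (by simp)
    have hT : ∀ x ∈ [t], dPart n l x ≠ d ∧ E x := by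
      intro x hx
      rw [List.mem_singleton.mp hx]
      exact ht
    have h1 := hS.cls_eq (T := [t]) (w := t :: S) (by simp) hT (List.perm_append_singleton t S).symm
    have h2 := hS.cls_eq (T := [t]) (w := S ++ [t]) (by simp) hT (List.Perm.refl _)
    rw [ascentFactor_cons_of_pairwise hS.pairwise] at h1
    rw [ascentFactor_append_of_pairwise hS.pairwise,
      sortWord_eq_of_perm (List.perm_append_singleton t S)] at h2
    have h3 : lowerFactor n l S t • cls n l (t :: S) = upperFactor n l S t • cls n l (S ++ [t]) := by
      rw [h1, h2, smul_comm]
    have h4 := congrArg (sandwichWedge n l p []) h3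
    have h5 := congrArg (sandwichWedge n l [] [t]) (ih fun x hx => hpE x (by simp [hx]))
    rw [map_smul, map_smul, sandwichWedge_cls, sandwichWedge_cls, List.append_nil,
      List.append_nil] at h4
    rw [map_smul, map_smul, sandwichWedge_cls, sandwichWedge_cls, List.nil_append,
      List.nil_append] at h5
    simp only [List.map_append, List.prod_append, List.map_singleton, List.prod_singleton,
      List.append_assoc, List.singleton_append]
    rw [mul_smul, h4, smul_comm, ← List.append_assoc p, h5, smul_smul, mul_comm, List.append_assoc]

end Products

/-! ### Inserting a component -/

section Lift

variable {l : ℕ}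

/-- The renumbering of the components, numbered from `1`, that leaves out the component `j`, which
is numbered from `0`. -/
def shiftComponent (j : Fin (l + 1)) (d : ℤ) : ℤ := if d ≤ (j : ℕ) then d else d + 1

theorem shiftComponent_le_iff (j : Fin (l + 1)) {d d' : ℤ} :
    shiftComponent j d ≤ shiftComponent j d' ↔ d ≤ d' := by
  rw [shiftComponent, shiftComponent]
  split_ifs <;> omega

theorem shiftComponent_lt_iff (j : Fin (l + 1)) {d d' : ℤ} :
    shiftComponent j d < shiftComponent j d' ↔ d < d' := by
  rw [shiftComponent, shiftComponent]
  split_ifs <;> omega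

theorem shiftComponent_inj (j : Fin (l + 1)) {d d' : ℤ} :
    shiftComponent j d = shiftComponent j d' ↔ d = d' := by
  rw [shiftComponent, shiftComponent]
  split_ifs <;> omega

theorem shiftComponent_ne (j : Fin (l + 1)) (d : ℤ) : shiftComponent j d ≠ (j : ℕ) + 1 := by
  rw [shiftComponent]
  split_ifs <;> omega

variable {n : ℕ}

variable (n) in
/-- The letter of level `ℓ + 1` with the same `c` and `m`, and with the component renumbered. -/
def liftLetter (j : Fin (l + 1)) (k : ℤ) : ℤ :=
  letter n (l + 1) (cPart n k) (shiftComponent j (dPart n l k)) (mPart n l k)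

variable [NeZero n] [NeZero l]

theorem liftLetter_parts (j : Fin (l + 1)) (k : ℤ) :
    cPart n (liftLetter n j k) = cPart n k ∧
      dPart n (l + 1) (liftLetter n j k) = shiftComponent j (dPart n l k) ∧
      mPart n (l + 1) (liftLetter n j k) = mPart n l k := by
  have h1 := cPart_bounds n k
  have h2 := dPart_bounds n l k
  refine letter_parts h1.1 h1.2 ?_ ?_ <;> rw [shiftComponent] <;> push_cast <;> split_ifs <;> omega

theorem cPart_liftLetter (j : Fin (l + 1)) (k : ℤ) : cPart n (liftLetter n j k) = cPart n k :=
  (liftLetter_parts j k).1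

theorem dPart_liftLetter (j : Fin (l + 1)) (k : ℤ) :
    dPart n (l + 1) (liftLetter n j k) = shiftComponent j (dPart n l k) :=
  (liftLetter_parts j k).2.1

theorem mPart_liftLetter (j : Fin (l + 1)) (k : ℤ) :
    mPart n (l + 1) (liftLetter n j k) = mPart n l k :=
  (liftLetter_parts j k).2.2

theorem xPart_liftLetter (j : Fin (l + 1)) (k : ℤ) :
    xPart n (l + 1) (liftLetter n j k) = xPart n l k := by
  rw [xPart, xPart, cPart_liftLetter, mPart_liftLetter]

theorem liftLetter_lt_iff (j : Fin (l + 1)) {a b : ℤ} :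
    liftLetter n j a < liftLetter n j b ↔ a < b := by
  rw [lt_iff_parts (n := n) (l := l + 1), lt_iff_parts (n := n) (l := l) a b, cPart_liftLetter,
    cPart_liftLetter, dPart_liftLetter, dPart_liftLetter, mPart_liftLetter, mPart_liftLetter,
    shiftComponent_lt_iff, shiftComponent_inj]

theorem liftLetter_strictMono (j : Fin (l + 1)) : StrictMono (liftLetter (l := l) n j) :=
  fun _ _ h => (liftLetter_lt_iff j).mpr h

theorem liftLetter_position (j : Fin (l + 1)) (d : Fin l) (x : ℤ) :
    liftLetter n j (position n l d x) = position n (l + 1) (j.succAbove d) x := by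
  have hd : dPart n (l + 1) (liftLetter n j (position n l d x)) = ((j.succAbove d : Fin _) : ℕ) + 1 := by
    rw [dPart_liftLetter, dPart_position, shiftComponent]
    rcases lt_or_ge d.castSucc j with h | h
    · rw [Fin.succAbove_of_castSucc_lt _ _ h]
      rw [Fin.lt_def, Fin.val_castSucc] at h
      rw [if_pos (by omega), Fin.val_castSucc]
    · rw [Fin.succAbove_of_le_castSucc _ _ h]
      rw [Fin.le_def, Fin.val_castSucc] at h
      rw [if_neg (by omega), Fin.val_succ]
      push_cast
      ring
  rw [← position_xPart hd, xPart_liftLetter, xPart_position]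

theorem dFactor_liftLetter (j : Fin (l + 1)) (a b : ℤ) :
    dFactor n (l + 1) (liftLetter n j a) (liftLetter n j b) = dFactor n l a b := by
  simp only [dFactor, dPart_liftLetter, shiftComponent_inj]

theorem cf_liftLetter (j : Fin (l + 1)) (a b : ℤ) :
    cf n (l + 1) (liftLetter n j a) (liftLetter n j b) = cf n l a b := by
  rw [cf, cf, dFactor_liftLetter, cPart_liftLetter, cPart_liftLetter]

theorem corrRange_liftLetter (j : Fin (l + 1)) (a b : ℤ) :
    corrRange n (l + 1) (liftLetter n j a) (liftLetter n j b) = corrRange n l a b := by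
  simp only [corrRange, cPart_liftLetter, dPart_liftLetter, mPart_liftLetter, shiftComponent_le_iff]

theorem corr_liftLetter (j : Fin (l + 1)) (a b i : ℤ) :
    corr n (l + 1) (liftLetter n j a) (liftLetter n j b) i =
      (liftLetter n j (corr n l a b i).1, liftLetter n j (corr n l a b i).2) := by
  have h : ∀ a b m : ℤ, cross n (l + 1) (liftLetter n j a) (liftLetter n j b) m =
      liftLetter n j (cross n l a b m) := by
    intro a b m
    rw [cross, cPart_liftLetter, dPart_liftLetter, liftLetter, cPart_cross, dPart_cross,
      mPart_cross]
  rw [corr, h, h, mPart_liftLetter, mPart_liftLetter]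
  rfl

theorem barFactor_map_liftLetter (j : Fin (l + 1)) (w : List ℤ) :
    barFactor n (l + 1) (w.map (liftLetter n j)) = barFactor n l w := by
  induction w with
  | nil => rfl
  | cons a w ih =>
    rw [List.map_cons, barFactor, barFactor, ih, List.map_map]
    congr 2
    refine List.map_congr_left fun b _ => ?_
    rw [Function.comp_apply, cf_liftLetter]

theorem lift_mem_wordRelations (j : Fin (l + 1)) :
    wordRelations n l ≤ (wordRelations n (l + 1)).comap
      (Finsupp.lmapDomain Kq Kq (List.map (liftLetter n j))) := by
  refine Submodule.span_le.mpr ?_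
  rintro _ ⟨u, v, a, b, hab, rfl⟩
  rw [SetLike.mem_coe, Submodule.mem_comap]
  have : Finsupp.lmapDomain Kq Kq (List.map (liftLetter n j)) (wordRelation n l u v a b) =
      wordRelation n (l + 1) (u.map (liftLetter n j)) (v.map (liftLetter n j))
        (liftLetter n j a) (liftLetter n j b) := by
    rw [wordRelation_eq, wordRelation_eq]
    simp only [map_sub, map_add, map_smul, map_sum, Finsupp.lmapDomain_apply,
      Finsupp.mapDomain_single, List.map_append, List.map_cons, cf_liftLetter, dFactor_liftLetter,
      corrRange_liftLetter, corr_liftLetter]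
  rw [this]
  exact Submodule.subset_span ⟨_, _, _, _, (liftLetter_strictMono j).monotone hab, rfl⟩

variable (n) in
/-- The map between finite wedges induced by the renumbering of the components. -/
def liftWedge (j : Fin (l + 1)) : FiniteWedge n l →ₗ[Kq] FiniteWedge n (l + 1) :=
  Submodule.mapQ _ _ (Finsupp.lmapDomain Kq Kq (List.map (liftLetter n j)))
    (lift_mem_wordRelations j)

theorem liftWedge_cls (j : Fin (l + 1)) (w : List ℤ) :
    liftWedge n j (cls n l w) = cls n (l + 1) (w.map (liftLetter n j)) := by
  rw [cls, Submodule.mkQ_apply, liftWedge, Submodule.mapQ_apply, Finsupp.lmapDomain_apply,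
    Finsupp.mapDomain_single]
  rfl

end Lift

section Complete

variable {n l : ℕ}

theorem cf_of_dPart_ne {a b : ℤ} (h : dPart n l a ≠ dPart n l b) :
    cf n l a b = if cPart n a = cPart n b then q else 1 := by
  rw [cf, dFactor, if_neg h, one_mul]

variable [NeZero n]

theorem xPart_le_iff {S k : ℤ} : xPart n l k ≤ S ↔ -((S - cPart n k) / n) ≤ mPart n l k := by
  have hn : (0 : ℤ) < n := by exact_mod_cast Nat.pos_of_ne_zero (NeZero.ne n)
  rw [xPart, neg_le, Int.le_ediv_iff_mul_le hn]
  constructor <;> intro h <;> linarith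

variable [NeZero l]

theorem letterClosed_xPart_le (S : ℤ) : LetterClosed n l fun k => xPart n l k ≤ S := by
  rintro a b p - (rfl | ⟨i, hi, rfl⟩) ha hb
  · exact ⟨hb, ha⟩
  · have h1 := cPart_bounds n a
    have h2 := cPart_bounds n b
    rw [corrRange, Finset.mem_Icc] at hi
    have hn : (0 : ℤ) ≤ n := by positivity
    have hi0 : i ≤ mPart n l a - mPart n l b := by
      have := hi.2
      split_ifs at this <;> omega
    simp only [xPart, corr, cPart_cross, mPart_cross] at *
    constructor
    · refine le_trans ?_ hb
      by_cases hc : cPart n b ≤ cPart n a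
      · rw [if_pos hc] at hi
        have : (n : ℤ) * 1 ≤ n * i := mul_le_mul_of_nonneg_left hi.1 hn
        linarith
      · rw [if_neg hc] at hi
        have : 0 ≤ (n : ℤ) * i := mul_nonneg hn hi.1
        linarith
    · refine le_trans ?_ hb
      have : (n : ℤ) * i ≤ n * (mPart n l a - mPart n l b) := mul_le_mul_of_nonneg_left hi0 hn
      linarith

variable (n) in
/-- The beads of the component `j`, with charge `S` and the empty diagram, above `-n ℓ M`. -/
def vacuumList (j : Fin l) (S : ℤ) (M : ℕ) : List ℤ :=
  (List.range (S + n * M).toNat).map fun r : ℕ => position n l j (S - r)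

theorem mem_vacuumList {j : Fin l} {S : ℤ} {M : ℕ} {k : ℤ} : k ∈ vacuumList n j S M ↔
    dPart n l k = (j : ℕ) + 1 ∧ xPart n l k ≤ S ∧ -(n * l * M : ℤ) < k := by
  simp only [vacuumList, List.mem_map, List.mem_range]
  constructor
  · rintro ⟨r, hr, rfl⟩
    refine ⟨dPart_position j _, ?_, ?_⟩
    · rw [xPart_position]; omega
    · rw [lt_position_iff]; omega
  · rintro ⟨h1, h2, h3⟩
    rw [← position_xPart h1, lt_position_iff] at h3
    refine ⟨(S - xPart n l k).toNat, by omega, ?_⟩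
    rw [← position_xPart h1, xPart_position]
    congr 1
    omega

theorem isComplete_vacuumList (j : Fin l) (S : ℤ) (M : ℕ) : IsComplete n l
    (fun k => xPart n l k ≤ S ∧ -(n * l * M : ℤ) < k) ((j : ℕ) + 1) (vacuumList n j S M) where
  closed := (letterClosed_xPart_le S).and_gt _
  pairwise := by
    rw [vacuumList, List.pairwise_map]
    refine List.pairwise_lt_range.imp fun {a b} hab => ?_
    by_contra hc
    rcases (not_lt.mp hc).lt_or_eq with h | h
    · have := xPart_lt_xPart (n := n) (l := l) (by rw [dPart_position, dPart_position]) h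
      rw [xPart_position, xPart_position] at this
      omega
    · have := (position_injective h).2
      omega
  mem_iff k := mem_vacuumList

theorem neg_lt_iff_mPart_le {M k : ℤ} : -(n * l * M : ℤ) < k ↔ mPart n l k ≤ M := by
  have h1 := letter_eq n l k
  have h2 := cPart_bounds n k
  have h3 := dPart_bounds n l k
  rw [letter] at h1
  have h4 : (n : ℤ) * (dPart n l k - 1) ≤ n * (l - 1) :=
    mul_le_mul_of_nonneg_left (by omega) (by positivity)
  have h5 : 0 ≤ (n : ℤ) * (dPart n l k - 1) := mul_nonneg (by positivity) (by omega)
  constructor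
  · intro h
    by_contra hc
    have : (n : ℤ) * l * (M + 1) ≤ n * l * mPart n l k :=
      mul_le_mul_of_nonneg_left (by omega) (by positivity)
    linarith
  · intro h
    have : (n : ℤ) * l * mPart n l k ≤ n * l * M := mul_le_mul_of_nonneg_left h (by positivity)
    linarith

/-- The number of beads of a vacuum component that are larger than a given letter `t` and have the
same `c`. It is additive in the `c`, `d` and `m` of `t`. -/
theorem sum_vacuumList_indicator {j : Fin l} {S : ℤ} {M : ℕ} {t : ℤ}
    (hx : xPart n l t ≤ S) (hM : -(n * l * M : ℤ) < t) :
    ((vacuumList n j S M).map fun x => if t < x ∧ cPart n t = cPart n x then (1 : ℤ) else 0).sum =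
      (S - cPart n t) / n + (if dPart n l t ≤ (j : ℕ) then 1 else 0) + mPart n l t := by
  have hjl : ((j : ℕ) : ℤ) + 1 ≤ l := by exact_mod_cast j.2
  set δ : ℤ := if dPart n l t ≤ (j : ℕ) then 1 else 0 with hδ
  set f : ℤ → ℤ := fun m => letter n l (cPart n t) ((j : ℕ) + 1) m with hf
  have hfp : ∀ m, cPart n (f m) = cPart n t ∧ dPart n l (f m) = (j : ℕ) + 1 ∧
      mPart n l (f m) = m := fun m =>
    letter_parts (cPart_bounds n t).1 (cPart_bounds n t).2 (by omega) hjl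
  have hinj : Function.Injective f := fun m m' h => by rw [← (hfp m).2.2, h, (hfp m').2.2]
  have hnd : (vacuumList n j S M).Nodup :=
    (isComplete_vacuumList j S M).pairwise.imp fun h => ne_of_gt h
  have hset : ((vacuumList n j S M).filter fun x => t < x ∧ cPart n t = cPart n x).toFinset =
      (Finset.Ico (-((S - cPart n t) / n)) (mPart n l t + δ)).image f := by
    ext x
    rw [List.mem_toFinset, List.mem_filter, decide_eq_true_eq, mem_vacuumList, xPart_le_iff,
      neg_lt_iff_mPart_le, Finset.mem_image, lt_iff_parts (n := n) (l := l)]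
    rw [neg_lt_iff_mPart_le] at hM
    constructor
    · rintro ⟨⟨h1, h2, h3⟩, h4, h5⟩
      refine ⟨mPart n l x, ?_, ?_⟩
      · rw [Finset.mem_Ico, h5]
        refine ⟨h2, ?_⟩
        split_ifs at hδ <;> omega
      · refine eq_of_parts (n := n) (l := l) ?_ ?_ ?_
        · rw [(hfp _).1, h5]
        · rw [(hfp _).2.1, h1]
        · rw [(hfp _).2.2]
    · rintro ⟨m, hm, rfl⟩
      rw [Finset.mem_Ico] at hm
      rw [(hfp m).1, (hfp m).2.1, (hfp m).2.2]
      split_ifs at hδ <;> refine ⟨⟨rfl, hm.1, ?_⟩, ?_, rfl⟩ <;> omega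
  rw [sum_map_indicator, ← List.toFinset_card_of_nodup (hnd.filter _), hset,
    Finset.card_image_of_injective _ hinj, Int.card_Ico]
  rw [xPart_le_iff] at hx
  have : 0 ≤ δ := by rw [hδ]; split_ifs <;> omega
  omega

theorem prod_ite_q {X : Type*} (S : List X) (p : X → Prop) [DecidablePred p] :
    (S.map fun x => if p x then q else 1).prod =
      q ^ (S.map fun x => if p x then (1 : ℤ) else 0).sum := by
  induction S with
  | nil => simp
  | cons a S ih =>
    rw [List.map_cons, List.prod_cons, ih, List.map_cons, List.sum_cons, zpow_add₀ q_ne_zero]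
    split_ifs <;> simp

theorem prod_q_zpow {X : Type*} (S : List X) (f : X → ℤ) :
    (S.map fun x => q ^ f x).prod = q ^ (S.map f).sum := by
  induction S with
  | nil => simp
  | cons a S ih =>
    rw [List.map_cons, List.prod_cons, ih, List.map_cons, List.sum_cons, zpow_add₀ q_ne_zero]

theorem upperFactor_vacuumList {j : Fin l} {S : ℤ} {M : ℕ} {t : ℤ}
    (ht : dPart n l t ≠ (j : ℕ) + 1) (hx : xPart n l t ≤ S) (hM : -(n * l * M : ℤ) < t) :
    upperFactor n l (vacuumList n j S M) t =
      q ^ ((S - cPart n t) / n + (if dPart n l t ≤ (j : ℕ) then 1 else 0) + mPart n l t) := by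
  rw [← sum_vacuumList_indicator hx hM, ← prod_ite_q, upperFactor]
  congr 1
  refine List.map_congr_left fun x hx => ?_
  rw [cf_of_dPart_ne (fun h => ht (h.trans (mem_vacuumList.mp hx).1)), ite_and]

theorem prod_cf_vacuumList {j : Fin l} {S : ℤ} {M : ℕ} {t : ℤ} (ht : dPart n l t ≠ (j : ℕ) + 1) :
    ((vacuumList n j S M).map fun x => cf n l t x).prod = q ^ ((vacuumList n j S M).map fun x =>
      if cPart n t = cPart n x then (1 : ℤ) else 0).sum := by
  rw [← prod_ite_q]
  congr 1
  refine List.map_congr_left fun x hx => ?_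
  rw [cf_of_dPart_ne (fun h => ht (h.trans (mem_vacuumList.mp hx).1))]

end Complete

/-! ### Canonical bases and an empty component -/

section InsertEmpty

variable {l : ℕ}

/-- The multipartition with an empty Young diagram inserted as the component `j`. -/
def insertEmpty (j : Fin (l + 1)) (mu : MultiPartition l) : MultiPartition (l + 1) :=
  Fin.insertNth (α := fun _ => YoungDiagram) j ⊥ mu

theorem insertEmpty_same (j : Fin (l + 1)) (mu : MultiPartition l) : insertEmpty j mu j = ⊥ :=
  Fin.insertNth_apply_same (α := fun _ => YoungDiagram) j ⊥ mu

theorem insertEmpty_succAbove (j : Fin (l + 1)) (mu : MultiPartition l) (d : Fin l) :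
    insertEmpty j mu (j.succAbove d) = mu d :=
  Fin.insertNth_apply_succAbove (α := fun _ => YoungDiagram) j ⊥ mu d

theorem removeNth_insertEmpty (j : Fin (l + 1)) (mu : MultiPartition l) :
    j.removeNth (insertEmpty j mu) = mu :=
  Fin.removeNth_insertNth (α := fun _ => YoungDiagram) j ⊥ mu

theorem insertEmpty_removeNth {j : Fin (l + 1)} {mu : MultiPartition (l + 1)} (h : mu j = ⊥) :
    insertEmpty j (j.removeNth mu) = mu := by
  rw [insertEmpty, ← h]
  exact Fin.insertNth_self_removeNth (α := fun _ => YoungDiagram) j mu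

theorem insertEmpty_injective (j : Fin (l + 1)) : Function.Injective (insertEmpty j) :=
  Function.LeftInverse.injective (removeNth_insertEmpty j)

theorem size_removeNth (j : Fin (l + 1)) (mu : MultiPartition (l + 1)) :
    mu.size = (mu j).card + MultiPartition.size (j.removeNth mu) :=
  Fin.sum_univ_succAbove (fun d => (mu d).card) j

theorem card_eq_zero_iff {mu : YoungDiagram} : mu.card = 0 ↔ mu = ⊥ := by
  rw [YoungDiagram.card, Finset.card_eq_zero]
  constructor
  · intro h
    exact YoungDiagram.ext h
  · rintro rfl
    rfl

theorem rowLen_bot (r : ℕ) : (⊥ : YoungDiagram).rowLen r = 0 := by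
  by_contra h
  have : (r, 0) ∈ (⊥ : YoungDiagram) := by rw [YoungDiagram.mem_iff_lt_rowLen]; omega
  exact YoungDiagram.notMem_bot _ this

theorem eq_bot_of_rowLen {mu : YoungDiagram} (h : mu.rowLen 0 = 0) : mu = ⊥ := by
  rw [← card_eq_zero_iff, ← sum_rowLen mu (L := 0) (by exact colLen_le h), Finset.sum_range_zero]

end InsertEmpty

section Words

variable {n l : ℕ} {s : Fin (l + 1) → ℤ} {j : Fin (l + 1)}

variable (n s j) in
/-- A condition on the multipartitions `μ` of level `ℓ` that occur in the canonical basis vector of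
`λ`: the sums over the beads that straightening preserves are the same for `λ` and `μ`, and no bead
exceeds the charge of the component that is to be inserted. -/
def Linked (lam mu : MultiPartition l) : Prop :=
  mu.size = lam.size ∧ ∀ᶠ M in atTop,
    (∀ k ∈ ketWord n (j.removeNth s) mu M, xPart n l k ≤ s j) ∧
    ∀ (α β : ℤ → ℤ) (γ : ℤ),
      ((ketWord n (j.removeNth s) mu M).map fun k =>
        α (cPart n k) + β (dPart n l k) + γ * mPart n l k).sum =
      ((ketWord n (j.removeNth s) lam M).map fun k =>
        α (cPart n k) + β (dPart n l k) + γ * mPart n l k).sum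

variable [NeZero n]

/-- The beads of the component `d` do not exceed `s_d + λ^{(d)}_1`. -/
theorem linked_self {lam : MultiPartition l}
    (h : ∀ d, ((lam d).rowLen 0 : ℤ) ≤ s j - s (j.succAbove d)) : Linked n s j lam lam := by
  refine ⟨rfl, Eventually.of_forall fun M => ⟨fun k hk => ?_, fun _ _ _ => rfl⟩⟩
  obtain ⟨d, r, -, rfl⟩ := mem_ketWord.mp hk
  rw [xPart_position]
  have h1 := h d
  have h2 := (lam d).rowLen_anti 0 r (Nat.zero_le r)
  change s (j.succAbove d) + _ - _ ≤ _
  omega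

variable [NeZero l]

/-- Inserting an empty component adds the vacuum beads of this component. -/
theorem ketWord_insertEmpty (mu : MultiPartition l) (M : ℕ) :
    ketWord n s (insertEmpty j mu) M = sortWord
      ((ketWord n (j.removeNth s) mu M).map (liftLetter n j) ++ vacuumList n j (s j) M) := by
  refine sortWord_eq_of_perm ((List.perm_ext_iff_of_nodup (nodup_beadList _ M) ?_).mpr fun k => ?_)
  · rw [List.nodup_append]
    refine ⟨List.Nodup.map (liftLetter_strictMono j).injective
      ((perm_ketWord mu M).nodup_iff.mpr (nodup_beadList mu M)),
      (isComplete_vacuumList j (s j) M).pairwise.imp fun h => ne_of_gt h, ?_⟩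
    rintro a ha b hb rfl
    obtain ⟨t, -, rfl⟩ := List.mem_map.mp ha
    refine shiftComponent_ne j _ ((dPart_liftLetter j t).symm.trans (mem_vacuumList.mp hb).1)
  · rw [mem_beadList, List.mem_append, List.mem_map]
    constructor
    · rintro ⟨d, r, hr, rfl⟩
      rcases Fin.eq_self_or_eq_succAbove j d with rfl | ⟨d', rfl⟩
      · right
        rw [insertEmpty_same, rowLen_bot, mem_vacuumList, dPart_position, xPart_position,
          lt_position_iff]
        push_cast
        omega
      · left
        rw [insertEmpty_succAbove]
        exact ⟨_, mem_ketWord.mpr ⟨d', r, hr, rfl⟩, liftLetter_position j d' _⟩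
    · rintro (⟨t, ht, rfl⟩ | hk)
      · obtain ⟨d, r, hr, rfl⟩ := mem_ketWord.mp ht
        refine ⟨j.succAbove d, r, hr, ?_⟩
        rw [liftLetter_position, insertEmpty_succAbove]
        rfl
      · obtain ⟨r, hr, rfl⟩ := List.mem_map.mp hk
        refine ⟨j, r, by have := List.mem_range.mp hr; omega, ?_⟩
        rw [insertEmpty_same, rowLen_bot]
        simp

theorem Linked.of_barMatrix {lam mu nu : MultiPartition l} (h : Linked n s j lam mu)
    (hne : barMatrix n (j.removeNth s) mu nu ≠ 0) : Linked n s j lam nu := by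
  obtain ⟨h1, -, h2⟩ := (barMatrix_spec (n := n) (s := j.removeNth s) mu).2.2.2.2 nu hne
  refine ⟨h1.trans h.1, ?_⟩
  filter_upwards [h.2, h2] with M ⟨g1, g2⟩ g3
  refine ⟨?_, fun α β γ => ?_⟩
  · exact (letterClosed_xPart_le (s j)).reach g3 fun k hk => g1 k (List.mem_reverse.mp hk)
  · rw [g3.sum_map_eq, g2]

/-- The bar involution of a product with a bar-invariant factor `S`. The scalar accounts for the pairs
of letters from both factors. -/
theorem barFinite_cls_append {p S : List ℤ} (hS : barFinite n (l + 1) (cls n (l + 1) S) =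
    cls n (l + 1) S) : barFinite n (l + 1) (cls n (l + 1) (p.map (liftLetter n j) ++ S)) =
      ((p.map (liftLetter n j)).map fun t => (S.map fun x => cf n (l + 1) t x).prod).prod⁻¹ •
        sandwichWedge n (l + 1) S [] (liftWedge n j (barFinite n l (cls n l p))) := by
  rw [barFinite_cls] at hS
  have h1 := congrArg (sandwichWedge n (l + 1) [] (p.map (liftLetter n j)).reverse) hS
  rw [map_smul, sandwichWedge_cls, sandwichWedge_cls, List.nil_append, List.nil_append] at h1
  rw [barFinite_cls, barFinite_cls, map_smul, map_smul, liftWedge_cls, sandwichWedge_cls,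
    List.append_nil, List.reverse_append, List.map_reverse, ← h1, barFactor_append,
    barFactor_map_liftLetter, smul_smul, smul_smul]
  congr 1
  ring

end Words

section Transport

variable {n l : ℕ} [NeZero n] [NeZero l] {s : Fin (l + 1) → ℤ} {j : Fin (l + 1)}

theorem prod_upperFactor_liftLetter {S : ℤ} {M : ℕ} {p : List ℤ} (hx : ∀ t ∈ p, xPart n l t ≤ S)
    (hM : ∀ t ∈ p, -(n * l * M : ℤ) < t) :
    ((p.map (liftLetter n j)).map (upperFactor n (l + 1) (vacuumList n j S M))).prod =
      q ^ (p.map fun k => (S - cPart n k) / n +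
        (if shiftComponent j (dPart n l k) ≤ (j : ℕ) then 1 else 0) + 1 * mPart n l k).sum := by
  rw [← prod_q_zpow, List.map_map]
  congr 1
  refine List.map_congr_left fun t ht => ?_
  rw [Function.comp_apply, upperFactor_vacuumList, cPart_liftLetter, dPart_liftLetter,
    mPart_liftLetter, one_mul]
  · rw [dPart_liftLetter]
    exact shiftComponent_ne j _
  · rw [xPart_liftLetter]
    exact hx t ht
  · have := hM t ht
    rw [neg_lt_iff_mPart_le] at this
    rwa [neg_lt_iff_mPart_le, mPart_liftLetter]

theorem prod_cf_liftLetter {S : ℤ} {M : ℕ} (p : List ℤ) :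
    ((p.map (liftLetter (l := l) n j)).map fun t =>
      ((vacuumList n j S M).map fun x => cf n (l + 1) t x).prod).prod =
      q ^ (p.map fun k => ((vacuumList n j S M).map fun x =>
        if cPart n k = cPart n x then (1 : ℤ) else 0).sum + 0 + 0 * mPart n l k).sum := by
  rw [← prod_q_zpow, List.map_map]
  congr 1
  refine List.map_congr_left fun t ht => ?_
  rw [Function.comp_apply, prod_cf_vacuumList, cPart_liftLetter, zero_mul, add_zero, add_zero]
  rw [dPart_liftLetter]
  exact shiftComponent_ne j _

/-- For linked multipartitions, the powers of `q` that arise when the beads of the vacuum component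
are moved through the other ones do not depend on the multipartition. -/
theorem exists_vacuum_factors (lam : MultiPartition l) (M : ℕ) : ∃ a b : ℤ,
    ∀ mu : MultiPartition l, (∀ k ∈ ketWord n (j.removeNth s) mu M, xPart n l k ≤ s j) →
    (∀ (α β : ℤ → ℤ) (γ : ℤ),
      ((ketWord n (j.removeNth s) mu M).map fun k =>
        α (cPart n k) + β (dPart n l k) + γ * mPart n l k).sum =
      ((ketWord n (j.removeNth s) lam M).map fun k =>
        α (cPart n k) + β (dPart n l k) + γ * mPart n l k).sum) →
    let p := (ketWord n (j.removeNth s) mu M).map (liftLetter n j)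
    let J := vacuumList n j (s j) M
    cls n (l + 1) (p ++ J) = q ^ a • cls n (l + 1) (ketWord n s (insertEmpty j mu) M) ∧
    q ^ b • cls n (l + 1) (p ++ J) = (q ^ a * q ^ a) • cls n (l + 1) (J ++ p) ∧
    barFinite n (l + 1) (cls n (l + 1) (p ++ J)) = (q ^ b)⁻¹ • sandwichWedge n (l + 1) J []
      (liftWedge n j (barFinite n l (cls n l (ketWord n (j.removeNth s) mu M)))) := by
  refine ⟨((ketWord n (j.removeNth s) lam M).map fun k => (s j - cPart n k) / n +
      (if shiftComponent j (dPart n l k) ≤ (j : ℕ) then 1 else 0) + 1 * mPart n l k).sum,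
    ((ketWord n (j.removeNth s) lam M).map fun k => ((vacuumList n j (s j) M).map fun x =>
      if cPart n k = cPart n x then (1 : ℤ) else 0).sum + 0 + 0 * mPart n l k).sum,
    fun mu hx hsum => ?_⟩
  intro p J
  have hM : ∀ t ∈ ketWord n (j.removeNth s) mu M, -(n * l * M : ℤ) < t :=
    fun t ht => lt_of_mem_ketWord ht
  have hU := prod_upperFactor_liftLetter (j := j) hx hM
  have hH := prod_cf_liftLetter (n := n) (j := j) (S := s j) (M := M)
    (ketWord n (j.removeNth s) mu M)
  rw [hsum (fun c => (s j - c) / n)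
    (fun d => if shiftComponent j d ≤ (j : ℕ) then 1 else 0) 1] at hU
  rw [hsum (fun c => ((vacuumList n j (s j) M).map fun x =>
        if c = cPart n x then (1 : ℤ) else 0).sum) (fun _ => 0) 0] at hH
  have hJ := isComplete_vacuumList (n := n) j (s j) M
  have hp : p.Pairwise (· > ·) := by
    rw [List.pairwise_map]
    exact (pairwise_ketWord mu M).imp fun h => liftLetter_strictMono j h
  have hpE : ∀ t ∈ p, dPart n (l + 1) t ≠ (j : ℕ) + 1 ∧
      (xPart n (l + 1) t ≤ s j ∧ -(n * (l + 1 : ℕ) * M : ℤ) < t) := by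
    intro t ht
    obtain ⟨t, ht', rfl⟩ := List.mem_map.mp ht
    refine ⟨?_, ?_, ?_⟩
    · rw [dPart_liftLetter]
      exact shiftComponent_ne j _
    · rw [xPart_liftLetter]
      exact hx t ht'
    · have := hM t ht'
      rw [neg_lt_iff_mPart_le] at this
      rwa [neg_lt_iff_mPart_le, mPart_liftLetter]
  refine ⟨?_, ?_, ?_⟩
  · rw [hJ.cls_append hp hpE, hU, ketWord_insertEmpty]
  · have h1 := congrArg (fun y => (p.map (upperFactor n (l + 1) J)).prod • y)
      (hJ.cls_append_comm hpE)
    rw [smul_smul, smul_smul, ← List.prod_map_mul] at h1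
    rw [List.map_congr_left (g := fun t => (J.map fun x => cf n (l + 1) t x).prod) fun t ht =>
      upperFactor_mul_lowerFactor fun h => (hpE t ht).1 (mem_vacuumList.mp h).1, hH, hU] at h1
    exact h1
  · rw [barFinite_cls_append hJ.barFinite_cls, hH]

/-- A bar-invariant vector of level `ℓ` with linked support yields a bar-invariant vector of level
`ℓ + 1`. -/
theorem invariant_mapDomain_insertEmpty {lam : MultiPartition l} {g : Fock l}
    (hg : semilinearExt (barMatrix n (j.removeNth s)) g = g)
    (hlink : ∀ mu, g mu ≠ 0 → Linked n s j lam mu) :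
    semilinearExt (barMatrix n s) (g.mapDomain (insertEmpty j)) = g.mapDomain (insertEmpty j) := by
  apply eq_of_eventually_finiteKet (n := n) (s := s)
  have hall := (Filter.eventually_all_finset g.support).mpr fun mu hmu =>
    (hlink mu (Finsupp.mem_support_iff.mp hmu)).2
  filter_upwards [hall, eventually_barFinite_finiteKet (n := n) (s := s)
    (g.mapDomain (insertEmpty j)), eventually_barFinite_finiteKet (n := n) (s := j.removeNth s) g]
    with M hM h1 h2
  rw [← h1]
  rw [hg] at h2
  obtain ⟨a, b, hab⟩ := exists_vacuum_factors (n := n) (s := s) (j := j) lam M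
  have hq : ∀ i : ℤ, q ^ i ≠ 0 := fun i => zpow_ne_zero i q_ne_zero
  set J := vacuumList n j (s j) M
  set z := finiteKet n (j.removeNth s) M g with hz
  set Φ : FiniteWedge n l →ₗ[Kq] FiniteWedge n (l + 1) :=
    (sandwichWedge n (l + 1) [] J).comp (liftWedge n j) with hΦ
  set Ψ : FiniteWedge n l →ₗ[Kq] FiniteWedge n (l + 1) :=
    (sandwichWedge n (l + 1) J []).comp (liftWedge n j) with hΨ
  have hΦc : ∀ w, Φ (cls n l w) = cls n (l + 1) (w.map (liftLetter n j) ++ J) := by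
    intro w
    rw [hΦ, LinearMap.comp_apply, liftWedge_cls, sandwichWedge_cls, List.nil_append]
  have hΨc : ∀ w, Ψ (cls n l w) = cls n (l + 1) (J ++ w.map (liftLetter n j)) := by
    intro w
    rw [hΨ, LinearMap.comp_apply, liftWedge_cls, sandwichWedge_cls, List.append_nil]
  have hzs : z = ∑ mu ∈ g.support, g mu • cls n l (ketWord n (j.removeNth s) mu M) := by
    rw [hz, finiteKet, Finsupp.linearCombination_apply, Finsupp.sum]
  have e1 : Φ z = q ^ a • finiteKet n s M (g.mapDomain (insertEmpty j)) := by
    rw [hzs, finiteKet, Finsupp.linearCombination_mapDomain, Finsupp.linearCombination_apply,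
      Finsupp.sum, map_sum, Finset.smul_sum]
    refine Finset.sum_congr rfl fun mu hmu => ?_
    rw [map_smul, hΦc, (hab mu (hM mu hmu).1 (hM mu hmu).2).1, smul_comm]
    rfl
  have e2 : q ^ b • Φ z = (q ^ a * q ^ a) • Ψ z := by
    rw [hzs, map_sum, map_sum, Finset.smul_sum, Finset.smul_sum]
    refine Finset.sum_congr rfl fun mu hmu => ?_
    rw [map_smul, map_smul, hΦc, hΨc, smul_comm, (hab mu (hM mu hmu).1 (hM mu hmu).2).2.1, smul_comm]
  have e3 : barFinite n (l + 1) (Φ z) = (q ^ b)⁻¹ • Ψ (barFinite n l z) := by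
    rw [hzs, map_sum, map_sum, map_sum, map_sum, Finset.smul_sum]
    refine Finset.sum_congr rfl fun mu hmu => ?_
    rw [Φ.map_smul, LinearMap.map_smulₛₗ, hΦc, (hab mu (hM mu hmu).1 (hM mu hmu).2).2.2,
      LinearMap.map_smulₛₗ (barFinite n l), Ψ.map_smul, smul_comm]
    rfl
  have e4 : finiteKet n s M (g.mapDomain (insertEmpty j)) = (q ^ a)⁻¹ • Φ z := by
    rw [e1, smul_smul, inv_mul_cancel₀ (hq a), one_smul]
  have e5 : Ψ z = ((q ^ a * q ^ a)⁻¹ * q ^ b) • Φ z := by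
    rw [mul_smul, e2, smul_smul, inv_mul_cancel₀ (mul_ne_zero (hq a) (hq a)), one_smul]
  have hbar : qBar (q ^ a)⁻¹ = q ^ a := by
    rw [map_inv₀, map_zpow₀, qBar_q, inv_zpow, inv_inv]
  rw [e4, LinearMap.map_smulₛₗ, hbar, e3, h2, e5, smul_smul, smul_smul]
  congr 1
  have ha := hq a
  have hb := hq b
  field_simp

end Transport

section Comparison

variable {n l : ℕ} {s : Fin (l + 1) → ℤ} {j : Fin (l + 1)} {lam : MultiPartition (l + 1)}

/-- If `s_j` is sufficiently large for `|λ; s⟩`, the component `j` of `λ` is empty. -/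
theorem SufficientlyLarge.eq_bot (h : SufficientlyLarge s j lam) : lam j = ⊥ := by
  refine eq_bot_of_rowLen ?_
  have := h j
  omega

variable [NeZero n] [NeZero l]

/-- If `s_j` is sufficiently large for `|λ; s⟩`, the canonical basis vector of `λ` is obtained from
one of level `ℓ` by inserting an empty component. -/
theorem SufficientlyLarge.decompositionNumber_eq (h : SufficientlyLarge s j lam) (ε : Sgn) :
    ∃ g : Fock l,
      (∀ mu, decompositionNumber n l ε (j.removeNth s) (j.removeNth lam) mu = g mu) ∧
      (∀ mu, decompositionNumber n (l + 1) ε s lam mu = g.mapDomain (insertEmpty j) mu) ∧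
      ∀ mu, g mu ≠ 0 → mu.size = MultiPartition.size (j.removeNth lam) := by
  obtain ⟨g, hg1, hg2, hg3, -, hg4⟩ :=
    exists_canonicalVector (n := n) (s := j.removeNth s) ε (j.removeNth lam)
  obtain ⟨x, hx1, -, -, hx2, -⟩ := exists_canonicalVector (n := n) (s := s) ε lam
  have hlink : ∀ mu, g mu ≠ 0 → Linked n s j (j.removeNth lam) mu :=
    hg4 _ (fun mu nu hmu hne => hmu.of_barMatrix hne) (linked_self fun d => h (j.succAbove d))
  refine ⟨g, hg1, fun mu => ?_, fun mu hmu => (hlink mu hmu).1⟩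
  rw [hx1, hx2 _ (invariant_mapDomain_insertEmpty hg2 hlink) fun nu => ?_]
  have e : g.mapDomain (insertEmpty j) - Finsupp.single lam (1 : Kq) =
      (g - Finsupp.single (j.removeNth lam) 1).mapDomain (insertEmpty j) := by
    rw [← Finsupp.lmapDomain_apply (M := Kq) (R := Kq), ← Finsupp.lmapDomain_apply (M := Kq) (R := Kq),
      map_sub, Finsupp.lmapDomain_apply, Finsupp.lmapDomain_apply, Finsupp.mapDomain_single,
      insertEmpty_removeNth h.eq_bot]
  rw [e]
  by_cases hnu : nu j = ⊥
  · rw [← insertEmpty_removeNth hnu, Finsupp.mapDomain_apply (insertEmpty_injective j)]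
    exact hg3 _
  · refine ⟨0, ?_⟩
    rw [Finsupp.mapDomain_of_notMem_range, map_zero, mul_zero]
    rintro ⟨mu, rfl⟩
    exact hnu (insertEmpty_same j mu)

end Comparison

end FockSpace

end

theorem theoremA (n l : ℕ) [NeZero n] [NeZero l] (hn : 2 ≤ n) (ε : FockSpace.Sgn)
    (s : Fin (l + 1) → ℤ) (j : Fin (l + 1)) (lam : FockSpace.MultiPartition (l + 1))
    (hlarge : FockSpace.SufficientlyLarge s j lam) :
    -- the canonical bases of level `l + 1` and of level `l` exist and are unique
    (∃! G, FockSpace.IsCanonicalBasis n (l + 1) ε s G) ∧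
    (∃! G, FockSpace.IsCanonicalBasis n l ε (j.removeNth s) G) ∧
    -- the `q`-decomposition numbers agree
    (∀ mu : FockSpace.MultiPartition (l + 1), (mu j = ⊥ ∨ mu.size = lam.size) →
      FockSpace.decompositionNumber n (l + 1) ε s lam mu =
        FockSpace.decompositionNumber n l ε (j.removeNth s) (j.removeNth lam) (j.removeNth mu)) ∧
    -- and those with a nonempty `j`-th component vanish
    (∀ mu : FockSpace.MultiPartition (l + 1), mu j ≠ ⊥ →
      FockSpace.decompositionNumber n (l + 1) ε s lam mu = 0) := by
  obtain ⟨g, h1, h2, h3⟩ := hlarge.decompositionNumber_eq (n := n) ε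
  have hvanish : ∀ mu : FockSpace.MultiPartition (l + 1), mu j ≠ ⊥ →
      FockSpace.decompositionNumber n (l + 1) ε s lam mu = 0 := by
    intro mu hmu
    rw [h2, Finsupp.mapDomain_of_notMem_range]
    rintro ⟨nu, rfl⟩
    exact hmu (FockSpace.insertEmpty_same j nu)
  refine ⟨FockSpace.existsUnique_isCanonicalBasis n s ε,
    FockSpace.existsUnique_isCanonicalBasis n (j.removeNth s) ε, fun mu hmu => ?_, hvanish⟩
  by_cases hj : mu j = ⊥
  · rw [h2, h1, ← Finsupp.mapDomain_apply (FockSpace.insertEmpty_injective j) g,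
      FockSpace.insertEmpty_removeNth hj]
  · rw [hvanish mu hj, h1]
    by_contra hne
    -- removing a nonempty component decreases the number of boxes
    have e1 := h3 _ (Ne.symm hne)
    have e2 := hmu.resolve_left hj
    rw [FockSpace.size_removeNth j mu, FockSpace.size_removeNth j lam, hlarge.eq_bot,
      FockSpace.card_eq_zero_iff.mpr rfl, e1] at e2
    exact hj (FockSpace.card_eq_zero_iff.mp (by omega))
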